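/- **Setting.** Let $p\in(1,\infty)$, $d,\ell\in\mathbb N_{\ge1}$, $k\in\mathbb N_0$, $\lambda\in[0,1]$, let $X$ be a (real or complex) Banach space, and let $\gamma\in(-1,\infty)\setminus\{jp-1: j\in\mathbb N_{\ge 1}\}$ satisfy $\gamma>(k-(\ell+\lambda))_+\,p-1$, where $(a)_+=\max(a,0)$. Write $x=(x_1,\tilde x)\in\mathbb R\times\mathbb R^{d-1}$ and $\mathbb R^d_+=\{x_1>0\}$. *Special domain.* For $h:\mathbb R^{d-1}\to\mathbb R$ put $\|h\|_{C^{\ell,\lambda}}=\sum_{|\alpha|\le\ell}\sup|\partial^\alpha h|+\sum_{|\alpha|=\ell}[\partial^\alpha h]_\lambda$, where $[\cdot]_\lambda$ is the $\lambda$-Hölder seminorm and the second sum is omitted if $\lambda=0$. Let $\mathcal O\subseteq\mathbb R^d$ be a special $C^{\ell,\lambda}_c$-domain with $[\mathcal O]_{C^{\ell,\lambda}}\le1$: there are a Euclidean isometry $T$ of $\mathbb R^d$ and a compactly supported $h\in C^{\ell,\lambda}(\mathbb R^{d-1};\mathbb R)$ with $T(\mathcal O)=\{x: x_1>h(\tilde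 x)\}$ and $\|h\|_{C^{\ell,\lambda}}\le 1$. *The diffeomorphism $\Psi$.* Let $\varphi\in C_c^\infty(\mathbb R^{d-1})$ be nonnegative with support in the closed unit ball and $\int\varphi=1$, let $L\ge 2\sqrt2\,(1+\|h\|_{C^{0,1}})$, and put $$h_2(t,\tilde y)=\int_{\mathbb R^{d-1}}h\bigl(\tilde y-\tfrac tL z\bigr)\varphi(z)\,dz .$$ For every $x\in\mathbb R^d$ the equation $t=x_1-h_2(t,\tilde x)$ has exactly one solution $t=:\rho(x)\in\mathbb R$. Let $\Psi=\Psi_0\circ T$ with $\Psi_0(x)=(\rho(x),\tilde x)$ (the Dahlberg–Kenig–Stein pullback). Then $\Psi:\mathcal O\to\mathbb R^d_+$ is a bijection with inverse $\Psi^{-1}(y)=T^{-1}(y_1+h_2(y),\tilde y)$. *Spaces.* For an open set $U\subseteq\mathbb R^d$ with nonempty boundary put $w^{\partial U}_\gamma(x)=\operatorname{dist}(x,\partial U)^\gamma$ and $$W^{k,p}(U,w_\gamma^{\partial U};X)=\{f:\ \partial^\alpha f\in L^p(U,w_\gamma^{\partial U};X)\ \text{for all }|\alpha|\le k\}$$ (distributional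 derivatives), with norm $\bigl(\sum_{|\alpha|\le k}\|\partial^\alpha f\|_{L^p(U,w^{\partial U}_\gamma;X)}^p\bigr)^{1/p}$. For $\mathrm{BC}\in\{0,\mathrm{Dir},\mathrm{Neu}\}$ let $\mathring W^{k,p}_{\mathrm{BC}}(U,w^{\partial U}_\gamma;X)$ be the closure in $W^{k,p}(U,w^{\partial U}_\gamma;X)$ of those of its elements that belong to the following class of test functions: * $\mathrm{BC}=0$: $C_c^\infty(U;X)$; * $\mathrm{BC}=\mathrm{Dir}$: functions in $C^\infty(U;X)\cap C_c(\overline U;X)$ that vanish on $\partial U$; * $\mathrm{BC}=\mathrm{Neu}$: functions $f\in C^\infty(U;X)\cap C^1_c(\overline U;X)$ with $\partial_v f=0$ on $\partial U$. Here $C^1_c(\overline U;X)$ consists of the functions with compact support in $\overline U$ which, together with their first derivatives, extend continuously to $\overline U$; and $v$ is the first unit vector $e_1$ if $U=\mathbb R^d_+$, while for $U=\mathcal O$ it is the vector that the linear part of $T$ maps to $e_1$ (so that $v=e_1$ if $\mathcal O=\{x_1>h(\tilde x)\}$). **Statement.** The map $\Psi_*f:=f\circ\Psi^{-1}$ is an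 isomorphism of Banach spaces (a bounded linear bijection with bounded inverse) $$\Psi_*:W^{k,p}(\mathcal O,w_\gamma^{\partial\mathcal O};X)\to W^{k,p}(\mathbb R^d_+,w_\gamma^{\partial\mathbb R^d_+};X),$$ with inverse $g\mapsto g\circ\Psi$, and for each $\mathrm{BC}\in\{0,\mathrm{Dir},\mathrm{Neu}\}$ it restricts to an isomorphism $$\Psi_*:\mathring W^{k,p}_{\mathrm{BC}}(\mathcal O,w_\gamma^{\partial\mathcal O};X)\to \mathring W^{k,p}_{\mathrm{BC}}(\mathbb R^d_+,w_\gamma^{\partial\mathbb R^d_+};X).$$ -/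

import Mathlib

open MeasureTheory
open scoped NNReal ENNReal ContDiff

set_option linter.unusedSectionVars false

namespace WeightedSobolev

noncomputable section

/-! ### Multi-indices and partial derivatives -/

/-- The Euclidean space `ℝ^d`; its coordinates are numbered `0, …, d - 1`. -/
abbrev Euc (d : ℕ) : Type := EuclideanSpace ℝ (Fin d)

/-- The multi-indices `α ∈ ℕ₀^d` with `|α| ≤ k`. -/
abbrev MIdx (d k : ℕ) : Type := {α : Fin d → Fin (k + 1) // ∑ i, (α i : ℕ) ≤ k}

/-- The zero multi-index. -/
def MIdx.zero (d k : ℕ) : MIdx d k := ⟨fun _ => 0, by simp⟩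

/-- The components of a multi-index as natural numbers. -/
def MIdx.val {d k : ℕ} (α : MIdx d k) : Fin d → ℕ := fun i => (α.1 i : ℕ)

/-- The order `|α|`. -/
def MIdx.order {d k : ℕ} (α : MIdx d k) : ℕ := ∑ i, α.val i

/-- The (classical) partial derivative `∂_i f`. -/
def partialD {d : ℕ} {F : Type*} [NormedAddCommGroup F] [NormedSpace ℝ F]
    (i : Fin d) (f : Euc d → F) : Euc d → F :=
  fun x => fderiv ℝ f x (EuclideanSpace.single i 1)

/-- The (classical) derivative `∂^α f = ∂_0^{α_0} ⋯ ∂_{d-1}^{α_{d-1}} f`. -/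
def multiD {d : ℕ} {F : Type*} [NormedAddCommGroup F] [NormedSpace ℝ F]
    (α : Fin d → ℕ) (f : Euc d → F) : Euc d → F :=
  (List.finRange d).foldr (fun i g => (partialD i)^[α i] g) f

/-! ### Hölder functions with compact support -/

/-- `h ∈ C_c^{ℓ,λ}(ℝ^n; ℝ)`, for `λ ∈ [0,1]`. -/
structure MemCcHolder {n : ℕ} (ℓ : ℕ) (lam : ℝ≥0) (h : Euc n → ℝ) : Prop where
  contDiff : ContDiff ℝ ℓ h
  hasCompactSupport : HasCompactSupport h
  holder : ∀ α : MIdx n ℓ, eHolderNorm lam (multiD α.val h) < ⊤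

/-- The norm `∑_{|α| ≤ ℓ} sup |∂^α h| + ∑_{|α| = ℓ} [∂^α h]_λ` of `C^{ℓ,λ}(ℝ^n)`; for `λ = 0` this
is the space `C^ℓ_b` and the second sum is absent. -/
def holderNorm {n : ℕ} (ℓ : ℕ) (lam : ℝ≥0) (h : Euc n → ℝ) : ℝ≥0∞ :=
  (∑ α : MIdx n ℓ, ⨆ x, ‖multiD α.val h x‖ₑ) +
    if lam = 0 then 0 else
      ∑ α : MIdx n ℓ, if α.order = ℓ then eHolderNorm lam (multiD α.val h) else 0

/-! ### Special domains and the half-space -/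

/-- The last `n` coordinates `x̃` of `x = (x₁, x̃) ∈ ℝ^{n+1}`. -/
def tail {n : ℕ} (x : Euc (n + 1)) : Euc n := WithLp.toLp 2 (fun i => x i.succ)

/-- The point `(t, z) ∈ ℝ × ℝ^n = ℝ^{n+1}`. -/
def cons {n : ℕ} (t : ℝ) (z : Euc n) : Euc (n + 1) :=
  WithLp.toLp 2 (Fin.cons t (fun i => z i))

/-- The first unit vector `e₁`. -/
def e₁ (n : ℕ) : Euc (n + 1) := EuclideanSpace.single 0 1

/-- The half-space `ℝ^{n+1}_+ = (0,∞) × ℝ^n`. -/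
def halfSpace (n : ℕ) : Set (Euc (n + 1)) := {x | 0 < x 0}

/-- The domain `{(x₁, x̃) : x₁ > h(x̃)}` above the graph of `h`. -/
def aboveGraph {n : ℕ} (h : Euc n → ℝ) : Set (Euc (n + 1)) := {x | h (tail x) < x 0}

/-! ### The Dahlberg–Kenig–Stein pullback -/

/-- `φ` is a smooth mollifier on `ℝ^n` supported in the unit ball. -/
structure IsMollifier {n : ℕ} (φ : Euc n → ℝ) : Prop where
  contDiff : ContDiff ℝ ∞ φ
  nonneg : ∀ z, 0 ≤ φ z
  support_subset : Function.support φ ⊆ Metric.closedBall 0 1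
  integral_eq_one : ∫ z, φ z = 1

/-- `h₂(t, z̃) = ∫ h(z̃ - (t / L) z) φ(z) dz`. -/
def smoothed {n : ℕ} (h φ : Euc n → ℝ) (L : ℝ) (t : ℝ) (w : Euc n) : ℝ :=
  ∫ z, h (w - (t / L) • z) * φ z

/-- The regularised distance `ρ(x)`, the (unique) solution `t` of `t = x₁ - h₂(t, x̃)`. -/
def regDist {n : ℕ} (h φ : Euc n → ℝ) (L : ℝ) (x : Euc (n + 1)) : ℝ :=
  Classical.epsilon fun t : ℝ => t = x 0 - smoothed h φ L t (tail x)

/-- `Ψ(x) = (ρ(x), x̃) = (x₁ - h₁(x), x̃)` with `h₁(x) = x₁ - ρ(x)`. -/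
def dks {n : ℕ} (h φ : Euc n → ℝ) (L : ℝ) (x : Euc (n + 1)) : Euc (n + 1) :=
  cons (regDist h φ L x) (tail x)

/-- `Ψ⁻¹(y) = (y₁ + h₂(y), ỹ)`. -/
def dksInv {n : ℕ} (h φ : Euc n → ℝ) (L : ℝ) (y : Euc (n + 1)) : Euc (n + 1) :=
  cons (y 0 + smoothed h φ L (y 0) (tail y)) (tail y)

/-! ### Weighted Sobolev spaces -/

section Sobolev

variable {d : ℕ}

/-- The measure `dist(x, ∂O)^γ dx` on `O`. -/
def weightedMeasure (O : Set (Euc d)) (γ : ℝ) : Measure (Euc d) :=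
  (volume.restrict O).withDensity fun x => ENNReal.ofReal (Metric.infDist x (frontier O) ^ γ)

variable {X : Type*} [NormedAddCommGroup X] [NormedSpace ℝ X]

/-- `g` is the distributional derivative `∂^α f` on the open set `O`, both `f` and `g` being
locally integrable on `O`. -/
structure HasWeakDeriv (O : Set (Euc d)) (α : Fin d → ℕ) (f g : Euc d → X) : Prop where
  left : LocallyIntegrableOn f O
  right : LocallyIntegrableOn g O
  integral_eq : ∀ η : Euc d → ℝ, ContDiff ℝ ∞ η → HasCompactSupport η → tsupport η ⊆ O →
    ∫ x in O, multiD α η x • f x = (-1 : ℝ) ^ (∑ i, α i) • ∫ x in O, η x • g x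

theorem integrableOn_smul_of_test {O : Set (Euc d)} {f : Euc d → X} (hf : LocallyIntegrableOn f O)
    {η : Euc d → ℝ} (hη : Continuous η) (hc : HasCompactSupport η) (hs : tsupport η ⊆ O) :
    IntegrableOn (fun x => η x • f x) O := by
  have h1 : IntegrableOn f (tsupport η) := hf.integrableOn_compact_subset hs hc
  have h2 : IntegrableOn (fun x => η x • f x) (tsupport η) :=
    h1.continuousOn_smul hη.continuousOn hc
  refine (h2.integrable_of_forall_notMem_eq_zero fun x hx => ?_).integrableOn
  simp [image_eq_zero_of_notMem_tsupport hx]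

theorem partialD_test (i : Fin d) {η : Euc d → ℝ} {O : Set (Euc d)}
    (h : ContDiff ℝ ∞ η ∧ HasCompactSupport η ∧ tsupport η ⊆ O) :
    ContDiff ℝ ∞ (partialD i η) ∧ HasCompactSupport (partialD i η) ∧
      tsupport (partialD i η) ⊆ O := by
  obtain ⟨h1, h2, h3⟩ := h
  refine ⟨?_, h2.fderiv_apply ℝ _, (tsupport_fderiv_apply_subset ℝ _).trans h3⟩
  exact (h1.fderiv_right (m := ∞) (by simp)).clm_apply contDiff_const

theorem multiD_test (α : Fin d → ℕ) {η : Euc d → ℝ} {O : Set (Euc d)}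
    (h : ContDiff ℝ ∞ η ∧ HasCompactSupport η ∧ tsupport η ⊆ O) :
    ContDiff ℝ ∞ (multiD α η) ∧ HasCompactSupport (multiD α η) ∧ tsupport (multiD α η) ⊆ O := by
  unfold multiD
  induction List.finRange d with
  | nil => exact h
  | cons i l ih =>
    rw [List.foldr_cons]
    generalize α i = m
    induction m with
    | zero => exact ih
    | succ m ihm =>
      rw [Function.iterate_succ_apply']
      exact partialD_test i ihm

theorem HasWeakDeriv.add {O : Set (Euc d)} {α : Fin d → ℕ} {f g f' g' : Euc d → X}
    (h : HasWeakDeriv O α f g) (h' : HasWeakDeriv O α f' g') :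
    HasWeakDeriv O α (f + f') (g + g') where
  left := h.left.add h'.left
  right := h.right.add h'.right
  integral_eq η h1 h2 h3 := by
    obtain ⟨k1, k2, k3⟩ := multiD_test α ⟨h1, h2, h3⟩
    simp only [Pi.add_apply, smul_add]
    rw [integral_add (integrableOn_smul_of_test h.left k1.continuous k2 k3)
        (integrableOn_smul_of_test h'.left k1.continuous k2 k3),
      integral_add (integrableOn_smul_of_test h.right h1.continuous h2 h3)
        (integrableOn_smul_of_test h'.right h1.continuous h2 h3),
      h.integral_eq η h1 h2 h3, h'.integral_eq η h1 h2 h3, smul_add]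

variable (𝕜 : Type*) [RCLike 𝕜] [NormedSpace 𝕜 X] [SMulCommClass ℝ 𝕜 X]

theorem HasWeakDeriv.const_smul {O : Set (Euc d)} {α : Fin d → ℕ} {f g : Euc d → X} (c : 𝕜)
    (h : HasWeakDeriv O α f g) : HasWeakDeriv O α (c • f) (c • g) where
  left := h.left.smul c
  right := h.right.smul c
  integral_eq η h1 h2 h3 := by
    simp only [Pi.smul_apply, smul_comm _ c]
    rw [integral_smul, integral_smul, h.integral_eq η h1 h2 h3, smul_comm]

theorem HasWeakDeriv.zero (O : Set (Euc d)) (α : Fin d → ℕ) :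
    HasWeakDeriv O α (0 : Euc d → X) 0 where
  left := locallyIntegrable_zero.locallyIntegrableOn O
  right := locallyIntegrable_zero.locallyIntegrableOn O
  integral_eq η _ _ _ := by simp

variable (X) in
/-- The weighted Sobolev space `W^{k,p}(O, dist(·, ∂O)^γ; X)`. An element is the family
`(∂^α f)_{|α| ≤ k}` of (classes of) functions in `L^p(O, dist(·, ∂O)^γ; X)`, where `f` is the member
of index `0`; the norm is `(∑_{|α| ≤ k} ‖∂^α f‖^p)^{1/p}`. -/
def sobolev (O : Set (Euc d)) (k : ℕ) (p : ℝ≥0∞) [Fact (1 ≤ p)] (γ : ℝ) :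
    Submodule 𝕜 (PiLp p fun _ : MIdx d k => Lp X p (weightedMeasure O γ)) where
  carrier := {u | ∃ F : MIdx d k → Euc d → X, (∀ α, u α =ᵐ[weightedMeasure O γ] F α) ∧
    ∀ α, HasWeakDeriv O α.val (F (MIdx.zero d k)) (F α)}
  add_mem' := by
    rintro u v ⟨F, hF, hF'⟩ ⟨G, hG, hG'⟩
    refine ⟨F + G, fun α => ?_, fun α => (hF' α).add (hG' α)⟩
    rw [PiLp.add_apply]
    exact (Lp.coeFn_add _ _).trans ((hF α).add (hG α))
  zero_mem' := by
    refine ⟨0, fun α => ?_, fun α => HasWeakDeriv.zero O α.val⟩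
    rw [PiLp.zero_apply]
    exact Lp.coeFn_zero _ _ _
  smul_mem' := by
    rintro c u ⟨F, hF, hF'⟩
    refine ⟨c • F, fun α => ?_, fun α => (hF' α).const_smul 𝕜 c⟩
    rw [PiLp.smul_apply]
    exact (Lp.coeFn_smul _ _).trans ((hF α).const_smul c)

variable {𝕜}

/-- The function `f` underlying an element of `W^{k,p}(O, dist(·, ∂O)^γ; X)`. -/
def sobolevFun {O : Set (Euc d)} {k : ℕ} {p : ℝ≥0∞} [Fact (1 ≤ p)] {γ : ℝ}
    (u : sobolev X 𝕜 O k p γ) : Euc d → X :=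
  (u : PiLp p fun _ : MIdx d k => Lp X p (weightedMeasure O γ)) (MIdx.zero d k)

/-! ### Boundary conditions -/

/-- The boundary conditions: zero, Dirichlet, Neumann. -/
inductive BC
  | zero
  | dir
  | neu

/-- `f` vanishes on the closure of `O` outside a compact set. -/
def HasCompactSupportIn (O : Set (Euc d)) (f : Euc d → X) : Prop :=
  ∃ K, IsCompact K ∧ ∀ x ∈ closure O, x ∉ K → f x = 0

/-- The test functions: `C_c^∞(O; X)` for zero boundary conditions;
`C^∞(O; X) ∩ {f ∈ C_c(closure O; X) : f = 0 on ∂O}` for Dirichlet boundary conditions;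
`C^∞(O; X) ∩ {f ∈ C_c^1(closure O; X) : ∂_v f = 0 on ∂O}` for Neumann boundary conditions. Here
`f ∈ C^1(closure O; X)` means that `f` and its first derivative (on `O`) extend
continuously to the closure of `O`; the extension of the latter is `G`. -/
def IsTestFun (O : Set (Euc d)) (v : Euc d) : BC → (Euc d → X) → Prop
  | .zero, f => ContDiff ℝ ∞ f ∧ HasCompactSupport f ∧ tsupport f ⊆ O
  | .dir, f => ContDiffOn ℝ ∞ f O ∧ ContinuousOn f (closure O) ∧ HasCompactSupportIn O f ∧
      ∀ x ∈ frontier O, f x = 0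
  | .neu, f => ContDiffOn ℝ ∞ f O ∧ ContinuousOn f (closure O) ∧ HasCompactSupportIn O f ∧
      ∃ G : Euc d → Euc d →L[ℝ] X, ContinuousOn G (closure O) ∧
        (∀ x ∈ O, HasFDerivAt f (G x) x) ∧ ∀ x ∈ frontier O, G x v = 0

theorem HasCompactSupportIn.add {O : Set (Euc d)} {f g : Euc d → X}
    (hf : HasCompactSupportIn O f) (hg : HasCompactSupportIn O g) :
    HasCompactSupportIn O (f + g) := by
  obtain ⟨K, hK, hf⟩ := hf
  obtain ⟨K', hK', hg⟩ := hg
  refine ⟨K ∪ K', hK.union hK', fun x hx hxK => ?_⟩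
  rw [Set.mem_union, not_or] at hxK
  simp [hf x hx hxK.1, hg x hx hxK.2]

theorem HasCompactSupportIn.const_smul {O : Set (Euc d)} {f : Euc d → X} (c : 𝕜)
    (hf : HasCompactSupportIn O f) : HasCompactSupportIn O (c • f) := by
  obtain ⟨K, hK, hf⟩ := hf
  exact ⟨K, hK, fun x hx hxK => by simp [hf x hx hxK]⟩

theorem IsTestFun.zero (O : Set (Euc d)) (v : Euc d) (b : BC) :
    IsTestFun O v b (0 : Euc d → X) := by
  have hK : HasCompactSupportIn O (0 : Euc d → X) := ⟨∅, isCompact_empty, fun _ _ _ => rfl⟩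
  cases b with
  | zero =>
    refine ⟨contDiff_const, HasCompactSupport.zero, ?_⟩
    rw [tsupport_eq_empty_iff.2 rfl]
    exact Set.empty_subset _
  | dir => exact ⟨contDiffOn_const, continuousOn_const, hK, fun _ _ => rfl⟩
  | neu =>
    exact ⟨contDiffOn_const, continuousOn_const, hK, 0, continuousOn_const,
      fun x _ => hasFDerivAt_const 0 x, fun _ _ => rfl⟩

theorem IsTestFun.add {O : Set (Euc d)} {v : Euc d} {b : BC} {f g : Euc d → X}
    (hf : IsTestFun O v b f) (hg : IsTestFun O v b g) : IsTestFun O v b (f + g) := by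
  cases b with
  | zero =>
    obtain ⟨f1, f2, f3⟩ := hf
    obtain ⟨g1, g2, g3⟩ := hg
    exact ⟨f1.add g1, f2.add g2, (tsupport_add f g).trans (Set.union_subset f3 g3)⟩
  | dir =>
    obtain ⟨f1, f2, f3, f4⟩ := hf
    obtain ⟨g1, g2, g3, g4⟩ := hg
    exact ⟨f1.add g1, f2.add g2, f3.add g3, fun x hx => by simp [f4 x hx, g4 x hx]⟩
  | neu =>
    obtain ⟨f1, f2, f3, F, f4, f5, f6⟩ := hf
    obtain ⟨g1, g2, g3, G, g4, g5, g6⟩ := hg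
    exact ⟨f1.add g1, f2.add g2, f3.add g3, F + G, f4.add g4,
      fun x hx => (f5 x hx).add (g5 x hx), fun x hx => by simp [f6 x hx, g6 x hx]⟩

theorem IsTestFun.const_smul {O : Set (Euc d)} {v : Euc d} {b : BC} {f : Euc d → X} (c : 𝕜)
    (hf : IsTestFun O v b f) : IsTestFun O v b (c • f) := by
  cases b with
  | zero =>
    obtain ⟨f1, f2, f3⟩ := hf
    exact ⟨f1.const_smul c, f2.smul_left (f := fun _ => c),
      (tsupport_smul_subset_right (fun _ => c) f).trans f3⟩
  | dir =>
    obtain ⟨f1, f2, f3, f4⟩ := hf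
    exact ⟨f1.const_smul c, f2.const_smul c, f3.const_smul c, fun x hx => by simp [f4 x hx]⟩
  | neu =>
    obtain ⟨f1, f2, f3, F, f4, f5, f6⟩ := hf
    exact ⟨f1.const_smul c, f2.const_smul c, f3.const_smul c, c • F, f4.const_smul c,
      fun x hx => (f5 x hx).const_smul c, fun x hx => by simp [f6 x hx]⟩

variable (X 𝕜) in
/-- The elements of `W^{k,p}(O, dist(·, ∂O)^γ; X)` that are (classes of) test functions. -/
def testSubmodule (O : Set (Euc d)) (v : Euc d) (b : BC) (k : ℕ) (p : ℝ≥0∞) [Fact (1 ≤ p)]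
    (γ : ℝ) : Submodule 𝕜 (sobolev X 𝕜 O k p γ) where
  carrier := {u | ∃ f : Euc d → X, IsTestFun O v b f ∧ sobolevFun u =ᵐ[weightedMeasure O γ] f}
  add_mem' := by
    rintro u w ⟨f, hf, hf'⟩ ⟨g, hg, hg'⟩
    exact ⟨f + g, hf.add hg, (Lp.coeFn_add _ _).trans (hf'.add hg')⟩
  zero_mem' := ⟨0, IsTestFun.zero O v b, Lp.coeFn_zero _ _ _⟩
  smul_mem' := by
    rintro c u ⟨f, hf, hf'⟩
    exact ⟨c • f, hf.const_smul c, (Lp.coeFn_smul _ _).trans (hf'.const_smul c)⟩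

variable (X 𝕜) in
/-- The closure of the test functions in `W^{k,p}(O, dist(·, ∂O)^γ; X)`. -/
def sobolevBC (O : Set (Euc d)) (v : Euc d) (b : BC) (k : ℕ) (p : ℝ≥0∞) [Fact (1 ≤ p)]
    (γ : ℝ) : Submodule 𝕜 (sobolev X 𝕜 O k p γ) :=
  (testSubmodule X 𝕜 O v b k p γ).topologicalClosure

end Sobolev

end

end WeightedSobolev

namespace WeightedSobolev

noncomputable section

/-! ### Partial derivatives commute -/

section Partial

variable {d : ℕ} {F : Type*} [NormedAddCommGroup F] [NormedSpace ℝ F]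

/-! Write s = ℓ + λ, let y₀ be the normal coordinate and m = h₂. On the half-space, Ψ⁻¹ is T⁻¹
composed with the shear y ↦ y + m(y) e₁. The choice of L makes m Lipschitz with constant 1/2 in y₀.
Hence t = x₀ - h₂(t, x̃) is a contraction fixed point problem, and the shear is a bi-Lipschitz C¹
bijection of the whole space. Since m(0, ·) = h, it carries the half-space onto the region above the
graph. Distances to the boundary are therefore comparable and Jacobians bounded, so composition is
bounded on the weighted L^p spaces (`IsBiLipDiffeo.exists_eLpNorm_comp_le`).

For derivatives, the difficulty is that m is smooth only inside, with derivatives that blow up at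
the boundary. A first derivative of m, differentiated r more times, is O(min(y₀, 1)^{-(r + 1 - s)₊})
(`IsHolderReg.isSymbol_mollify`). As long as h has classical derivatives, the derivatives are put on
h. Afterwards they are put on the mollifier. Each of these costs a factor 1/y₀, but the new
mollifier has mean zero, and the Hölder continuity of the top derivatives then gives back y₀^λ.

By the chain rule, a derivative of order a ≠ 0 of a transformed function is a sum of terms c · F_b,
where F_b is a transformed derivative of order |b| ≥ 1, |b| + e = |a|, and |c| ≲ min(y₀, 1)^{-E}
with E = (e + 1 - s)₊ (`exists_comb`). As s ≥ 1, E ≤ e. Hardy's inequality exchanges one derivative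
for at most one power of y₀, so the e derivatives not yet used on F_b pay for the singular
coefficient (`IsComb.exists_eLpNorm_le`). As |b| ≥ 1, e + 1 ≤ k, and the lower bound on γ gives γ -
Ep > -1. All weights that occur then lie in the range where Hardy's inequality needs no boundary
condition. The inequality itself (`hardy`) compares f at y₀ and at 2y₀: for the weight y₀^σ the
dilation contracts the norm by 2^{-(σ + 1)/p} < 1, so f(2y₀, ỹ) can be absorbed.

One calculus serves both directions, because all coefficients are functions on the half-space. For f
∘ Ψ⁻¹ the F_b are (∂^b f) ∘ Ψ⁻¹, related to each other through DΨ⁻¹. For g ∘ Ψ they are the ∂^b g,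
and DΨ is expressed at the point y = Ψ(x) by the explicit inverse of a rank-one perturbation of the
identity. The higher derivatives of ρ are never estimated on the domain.

Finally, Ψ is smooth inside and C¹ up to the boundary, and a shear along e₁ sends the direction v to
multiples of e₁. Composition thus exchanges the three classes of test functions, hence also their
closures (`IsBiLipDiffeo.map_sobolevBC`). -/

theorem contDiff_partialD {r m : ℕ∞ω} {f : Euc d → F} (hf : ContDiff ℝ m f) (hm : r + 1 ≤ m)
    (i : Fin d) : ContDiff ℝ r (partialD i f) :=
  (hf.fderiv_right hm).clm_apply contDiff_const

theorem contDiff_partialD_iterate {r m : ℕ} {f : Euc d → F} (hf : ContDiff ℝ (m + r : ℕ) f)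
    (i : Fin d) : ContDiff ℝ r ((partialD i)^[m] f) := by
  induction m generalizing r with
  | zero => simpa using hf
  | succ m ih =>
    rw [Function.iterate_succ_apply']
    have : ContDiff ℝ (r + 1 : ℕ) ((partialD i)^[m] f) := by
      apply ih
      rwa [show m + (r + 1) = m + 1 + r by ring]
    exact contDiff_partialD this (by norm_cast) i

theorem partialD_comm {f : Euc d → F} (hf : ContDiff ℝ 2 f) (i j : Fin d) :
    partialD i (partialD j f) = partialD j (partialD i f) := by
  have key : ∀ i j : Fin d, ∀ x, partialD i (partialD j f) x =
      fderiv ℝ (fderiv ℝ f) x (EuclideanSpace.single i 1) (EuclideanSpace.single j 1) := by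
    intro i j x
    have h1 : DifferentiableAt ℝ (fderiv ℝ f) x :=
      ((hf.fderiv_right (m := 1) (by norm_num)).differentiable (by simp)) x
    have := (h1.hasFDerivAt.clm_apply (hasFDerivAt_const (EuclideanSpace.single j (1 : ℝ)) x)).fderiv
    unfold partialD
    rw [this]
    simp
  funext x
  rw [key, key]
  have := (hf.contDiffAt (x := x)).isSymmSndFDerivAt (by simp)
  exact this _ _

theorem partialD_iterate_comm {f : Euc d → F} {m : ℕ} (hf : ContDiff ℝ (m + 1 : ℕ) f)
    (i j : Fin d) : (partialD j)^[m] (partialD i f) = partialD i ((partialD j)^[m] f) := by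
  induction m generalizing f with
  | zero => rfl
  | succ m ih =>
    rw [Function.iterate_succ_apply, Function.iterate_succ_apply,
      partialD_comm (hf.of_le (by norm_cast; omega)),
      ih (contDiff_partialD hf (by norm_cast) j)]

/-- The iterated partial derivative along a list of coordinates. -/
theorem contDiff_foldr_partialD {r : ℕ} {f : Euc d → F} (α : Fin d → ℕ) (l : List (Fin d))
    (hf : ContDiff ℝ ((l.map α).sum + r : ℕ) f) :
    ContDiff ℝ r (l.foldr (fun i g => (partialD i)^[α i] g) f) := by
  induction l generalizing r with
  | nil => simpa using hf
  | cons i l ih =>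
    rw [List.foldr_cons]
    refine contDiff_partialD_iterate (ih ?_) i
    rw [List.map_cons, List.sum_cons] at hf
    rwa [show (l.map α).sum + (α i + r) = α i + (l.map α).sum + r by ring]

theorem foldr_partialD_comm {f : Euc d → F} (α : Fin d → ℕ) (l : List (Fin d)) (i : Fin d)
    (hf : ContDiff ℝ ((l.map α).sum + 1 : ℕ) f) :
    l.foldr (fun i g => (partialD i)^[α i] g) (partialD i f) =
      partialD i (l.foldr (fun i g => (partialD i)^[α i] g) f) := by
  induction l with
  | nil => rfl
  | cons j l ih =>
    rw [List.map_cons, List.sum_cons] at hf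
    rw [List.foldr_cons, List.foldr_cons, ih (hf.of_le (by norm_cast; omega)),
      partialD_iterate_comm]
    refine contDiff_foldr_partialD α l ?_
    rwa [show (l.map α).sum + (α j + 1) = α j + (l.map α).sum + 1 by ring]

theorem sum_map_finRange (α : Fin d → ℕ) : ((List.finRange d).map α).sum = ∑ i, α i := by
  rw [← List.ofFn_eq_map, List.sum_ofFn]

theorem contDiff_multiD {r : ℕ} {f : Euc d → F} (α : Fin d → ℕ)
    (hf : ContDiff ℝ ((∑ i, α i) + r : ℕ) f) : ContDiff ℝ r (multiD α f) :=
  contDiff_foldr_partialD α _ (by rwa [sum_map_finRange])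

theorem multiD_partialD {f : Euc d → F} (α : Fin d → ℕ) (i : Fin d)
    (hf : ContDiff ℝ ((∑ i, α i) + 1 : ℕ) f) :
    multiD α (partialD i f) = partialD i (multiD α f) :=
  foldr_partialD_comm α _ i (by rwa [sum_map_finRange])

theorem foldr_partialD_congr {f : Euc d → F} {α β : Fin d → ℕ} {l : List (Fin d)}
    (h : ∀ i ∈ l, α i = β i) :
    l.foldr (fun i g => (partialD i)^[α i] g) f = l.foldr (fun i g => (partialD i)^[β i] g) f := by
  induction l with
  | nil => rfl
  | cons j l ih =>
    rw [List.foldr_cons, List.foldr_cons, ih fun i hi => h i (List.mem_cons_of_mem _ hi),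
      h j List.mem_cons_self]

/-- `multiD` composes the coordinate derivatives in a fixed order, so the additional ∂_i appears
somewhere in the middle; symmetry of second derivatives moves it to the innermost place. There it
acts directly on the test function, which is how weak derivatives are raised by one order. -/
theorem multiD_add_single {f : Euc d → F} (α : Fin d → ℕ) (i : Fin d)
    (hf : ContDiff ℝ ((∑ i, α i) + 1 : ℕ) f) :
    multiD (α + Pi.single i 1) f = multiD α (partialD i f) := by
  rw [← sum_map_finRange] at hf
  have key : ∀ l : List (Fin d), l.Nodup → i ∈ l → ContDiff ℝ ((l.map α).sum + 1 : ℕ) f →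
      l.foldr (fun j g => (partialD j)^[(α + Pi.single i 1 : Fin d → ℕ) j] g) f =
        l.foldr (fun j g => (partialD j)^[α j] g) (partialD i f) := by
    intro l
    induction l with
    | nil => simp
    | cons j l ih =>
      intro hn hi hf
      rw [List.nodup_cons] at hn
      rw [List.map_cons, List.sum_cons] at hf
      rw [List.foldr_cons, List.foldr_cons]
      by_cases hij : j = i
      · subst hij
        rw [foldr_partialD_congr (β := α), foldr_partialD_comm α l j (hf.of_le (by norm_cast; omega))]
        · simp [Function.iterate_succ_apply]
        · intro i hi
          have : i ≠ j := fun h => hn.1 (h ▸ hi)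
          simp [this]
      · have hi' : i ∈ l := (List.mem_cons.1 hi).resolve_left fun h => hij h.symm
        rw [ih hn.2 hi' (hf.of_le (by norm_cast; omega))]
        simp [hij]
  exact key _ (List.nodup_finRange d) (List.mem_finRange i) hf

theorem multiD_zero (f : Euc d → F) : multiD 0 f = f := by
  unfold multiD
  induction List.finRange d with
  | nil => rfl
  | cons i l ih => simp [ih]

theorem multiD_single {f : Euc d → F} (i : Fin d) (hf : ContDiff ℝ 1 f) :
    multiD (Pi.single i 1) f = partialD i f := by
  have := multiD_add_single (f := f) 0 i (by simpa using hf)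
  rw [zero_add] at this
  rw [this, multiD_zero]

theorem fderiv_eq_sum_partialD {f : Euc d → F} (x v : Euc d) :
    fderiv ℝ f x v = ∑ i, v i • partialD i f x := by
  have : v = ∑ i, v i • EuclideanSpace.single i (1 : ℝ) := by
    ext j
    simp [Finset.sum_apply, Pi.single_apply]
  conv_lhs => rw [this]
  simp [partialD]

theorem fderiv_eq_sum_smulRight {f : Euc d → F} (x : Euc d) :
    fderiv ℝ f x = ∑ i, (EuclideanSpace.proj i : Euc d →L[ℝ] ℝ).smulRight (partialD i f x) := by
  ext v
  rw [fderiv_eq_sum_partialD]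
  simp

/-- Serves to bootstrap smoothness from formulas that express partial derivatives by functions of
the same type. -/
theorem contDiffOn_succ_of_partialD {O : Set (Euc d)} (hO : IsOpen O) {f : Euc d → F} {N : ℕ}
    (h1 : DifferentiableOn ℝ f O) (h2 : ∀ i, ContDiffOn ℝ N (partialD i f) O) :
    ContDiffOn ℝ (N + 1 : ℕ) f O := by
  push_cast
  rw [contDiffOn_succ_iff_fderiv_of_isOpen hO]
  refine ⟨h1, by simp, ?_⟩
  rw [show fderiv ℝ f = fun x => ∑ i, ((EuclideanSpace.proj i : Euc d →L[ℝ] ℝ)).smulRight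
    (partialD i f x) from funext fderiv_eq_sum_smulRight]
  exact ContDiffOn.sum fun i _ => contDiffOn_const.smulRight (h2 i)

theorem contDiffOn_partialD {O : Set (Euc d)} (hO : IsOpen O) {f : Euc d → F} {r m : ℕ∞ω}
    (hf : ContDiffOn ℝ m f O) (hm : r + 1 ≤ m) (i : Fin d) :
    ContDiffOn ℝ r (partialD i f) O :=
  (hf.fderiv_of_isOpen hO hm).clm_apply contDiffOn_const

theorem partialD_congr {O : Set (Euc d)} (hO : IsOpen O) {f g : Euc d → F} (h : Set.EqOn f g O)
    (i : Fin d) : Set.EqOn (partialD i f) (partialD i g) O := fun x hx => by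
  unfold partialD
  rw [(Filter.eventuallyEq_of_mem (hO.mem_nhds hx) h).fderiv_eq]

theorem partialD_smul {a : Euc d → ℝ} {f : Euc d → F} {x : Euc d} (ha : DifferentiableAt ℝ a x)
    (hf : DifferentiableAt ℝ f x) (i : Fin d) :
    partialD i (fun y => a y • f y) x = partialD i a x • f x + a x • partialD i f x := by
  unfold partialD
  rw [fderiv_fun_smul ha hf]
  simp [add_comm]

theorem partialD_add {f g : Euc d → F} {x : Euc d} (hf : DifferentiableAt ℝ f x)
    (hg : DifferentiableAt ℝ g x) (i : Fin d) :
    partialD i (fun y => f y + g y) x = partialD i f x + partialD i g x := by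
  unfold partialD
  rw [fderiv_fun_add hf hg]
  simp

theorem partialD_comp {d' : ℕ} {f : Euc d' → F} {χ : Euc d → Euc d'} {x : Euc d}
    (hf : DifferentiableAt ℝ f (χ x)) (hχ : DifferentiableAt ℝ χ x) (j : Fin d) :
    partialD j (f ∘ χ) x = ∑ i, (partialD j χ x) i • partialD i f (χ x) := by
  unfold partialD
  rw [fderiv_comp x hf hχ, ContinuousLinearMap.comp_apply, fderiv_eq_sum_partialD]
  rfl

end Partial

/-! ### Test functions -/

section Test

variable {d : ℕ} {F : Type*} [NormedAddCommGroup F] [NormedSpace ℝ F]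

/-- A function which is smooth near its support is smooth. -/
theorem contDiff_of_contDiffOn_tsupport {O : Set (Euc d)} (hO : IsOpen O) {f : Euc d → F}
    (hf : ContDiffOn ℝ ∞ f O) (hs : tsupport f ⊆ O) : ContDiff ℝ ∞ f := by
  rw [contDiff_iff_contDiffAt]
  intro x
  by_cases hx : x ∈ tsupport f
  · exact hf.contDiffAt (hO.mem_nhds (hs hx))
  · have : f =ᶠ[nhds x] fun _ => 0 := notMem_tsupport_iff_eventuallyEq.1 hx
    exact contDiffAt_const.congr_of_eventuallyEq this

/-- `η ∈ C_c^∞(O)`. -/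
def IsTest (O : Set (Euc d)) (η : Euc d → ℝ) : Prop :=
  ContDiff ℝ ∞ η ∧ HasCompactSupport η ∧ tsupport η ⊆ O

theorem IsTest.mul {O : Set (Euc d)} (hO : IsOpen O) {η a : Euc d → ℝ} (hη : IsTest O η)
    (ha : ContDiffOn ℝ ∞ a O) : IsTest O fun x => η x * a x := by
  have hs : tsupport (fun x => η x * a x) ⊆ O := (tsupport_mul_subset_left).trans hη.2.2
  exact ⟨contDiff_of_contDiffOn_tsupport hO (hη.1.contDiffOn.mul ha) hs, hη.2.1.mul_right, hs⟩

end Test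

end

end WeightedSobolev

namespace WeightedSobolev

noncomputable section

/-! ### Weak derivatives -/

section Weak

variable {d : ℕ} {X : Type*} [NormedAddCommGroup X] [NormedSpace ℝ X]

theorem sum_single_one (j : Fin d) : ∑ i, (Pi.single j 1 : Fin d → ℕ) i = 1 := by
  simp

theorem hasWeakDeriv_single_iff {O : Set (Euc d)} {j : Fin d} {f g : Euc d → X} :
    HasWeakDeriv O (Pi.single j 1) f g ↔ LocallyIntegrableOn f O ∧ LocallyIntegrableOn g O ∧
      ∀ η, IsTest O η → ∫ x in O, partialD j η x • f x = -∫ x in O, η x • g x := by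
  constructor
  · rintro ⟨h1, h2, h3⟩
    refine ⟨h1, h2, fun η hη => ?_⟩
    have := h3 η hη.1 hη.2.1 hη.2.2
    rwa [multiD_single j (hη.1.of_le (by norm_cast)), sum_single_one, pow_one,
      neg_one_smul] at this
  · rintro ⟨h1, h2, h3⟩
    refine ⟨h1, h2, fun η a b c => ?_⟩
    rw [multiD_single j (a.of_le (by norm_cast)), sum_single_one, pow_one,
      neg_one_smul]
    exact h3 η ⟨a, b, c⟩

theorem isTest_partialD {O : Set (Euc d)} {η : Euc d → ℝ} (h : IsTest O η) (i : Fin d) :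
    IsTest O (partialD i η) := partialD_test i h

theorem IsTest.integrableOn_smul {O : Set (Euc d)} {η : Euc d → ℝ} (h : IsTest O η) {f : Euc d → X}
    (hf : LocallyIntegrableOn f O) : IntegrableOn (fun x => η x • f x) O :=
  integrableOn_smul_of_test hf h.1.continuous h.2.1 h.2.2

theorem contDiff_nat_of_infty {F : Type*} [NormedAddCommGroup F] [NormedSpace ℝ F]
    {η : Euc d → F} (h : ContDiff ℝ ∞ η) (m : ℕ) : ContDiff ℝ m η :=
  h.of_le (by exact_mod_cast le_top)

/-- If η is a test function, so is ∂_j η: it is inserted in the first relation, and the second one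
removes the remaining derivative. -/
theorem HasWeakDeriv.step {O : Set (Euc d)} {α : Fin d → ℕ} {j : Fin d} {f g g' : Euc d → X}
    (h : HasWeakDeriv O α f g) (h' : HasWeakDeriv O (Pi.single j 1) g g') :
    HasWeakDeriv O (α + Pi.single j 1) f g' where
  left := h.left
  right := h'.right
  integral_eq η h1 h2 h3 := by
    have hη : IsTest O η := ⟨h1, h2, h3⟩
    obtain ⟨k1, k2, k3⟩ := isTest_partialD hη j
    rw [multiD_add_single α j (contDiff_nat_of_infty h1 _), h.integral_eq _ k1 k2 k3,
      (hasWeakDeriv_single_iff.1 h').2.2 η hη]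
    simp [Finset.sum_add_distrib, pow_succ]

/-- Turns a family in which every member is a derivative of the one function f into first-order
relations between neighbouring members, the form to which the chain rule applies. The sign (-1)^|α|
is cancelled. -/
theorem HasWeakDeriv.of_add {O : Set (Euc d)} {α : Fin d → ℕ} {j : Fin d} {f g g' : Euc d → X}
    (h : HasWeakDeriv O α f g) (h' : HasWeakDeriv O (α + Pi.single j 1) f g') :
    HasWeakDeriv O (Pi.single j 1) g g' := by
  refine hasWeakDeriv_single_iff.2 ⟨h.right, h'.right, fun η hη => ?_⟩
  obtain ⟨k1, k2, k3⟩ := isTest_partialD hη j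
  have e1 := h.integral_eq _ k1 k2 k3
  have e2 := h'.integral_eq η hη.1 hη.2.1 hη.2.2
  rw [multiD_add_single α j (contDiff_nat_of_infty hη.1 _), e1] at e2
  have hs : ∑ i, (α + Pi.single j 1 : Fin d → ℕ) i = (∑ i, α i) + 1 := by
    simp [Finset.sum_add_distrib]
  rw [hs, pow_succ, mul_smul] at e2
  have hne : ((-1 : ℝ) ^ (∑ i, α i)) ≠ 0 := by simp
  have := smul_right_injective X hne e2
  simpa using this

theorem HasWeakDeriv.congr {O : Set (Euc d)} {α : Fin d → ℕ} {f g f' g' : Euc d → X}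
    (h : HasWeakDeriv O α f g) (hf : f =ᵐ[volume.restrict O] f')
    (hg : g =ᵐ[volume.restrict O] g') : HasWeakDeriv O α f' g' where
  left := h.left.congr hf
  right := h.right.congr hg
  integral_eq η h1 h2 h3 := by
    rw [integral_congr_ae (g := fun x => multiD α η x • f x), h.integral_eq η h1 h2 h3,
      integral_congr_ae (g := fun x => η x • g' x)]
    · filter_upwards [hg] with x hx using by rw [hx]
    · filter_upwards [hf] with x hx using by rw [hx]

theorem HasWeakDeriv.ae_unique [CompleteSpace X] {O : Set (Euc d)} (hO : IsOpen O)
    {α : Fin d → ℕ} {f g g' : Euc d → X} (h : HasWeakDeriv O α f g) (h' : HasWeakDeriv O α f g') :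
    g =ᵐ[volume.restrict O] g' := by
  have key := hO.ae_eq_zero_of_integral_contDiff_smul_eq_zero (μ := volume) (f := g - g')
    (h.right.sub h'.right) ?_
  · rw [Filter.EventuallyEq, ae_restrict_iff' hO.measurableSet]
    filter_upwards [key] with x hx hxO
    simpa [sub_eq_zero] using hx hxO
  · intro η h1 h2 h3
    have e := (h.integral_eq η h1 h2 h3).symm.trans (h'.integral_eq η h1 h2 h3)
    have hne : ((-1 : ℝ) ^ (∑ i, α i)) ≠ 0 := by simp
    have e := smul_right_injective X hne e
    have hη : IsTest O η := ⟨h1, h2, h3⟩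
    rw [← setIntegral_eq_integral_of_forall_compl_eq_zero (s := O)]
    · simp only [Pi.sub_apply, smul_sub]
      rw [integral_sub (hη.integrableOn_smul h.right) (hη.integrableOn_smul h'.right)]
      simpa [sub_eq_zero] using e
    · intro x hx
      rw [image_eq_zero_of_notMem_tsupport fun hh => hx (h3 hh), zero_smul]

theorem LocallyIntegrableOn.continuousOn_smul_open {O : Set (Euc d)} (hO : IsOpen O)
    {f : Euc d → X} (hf : LocallyIntegrableOn f O) {a : Euc d → ℝ} (ha : ContinuousOn a O) :
    LocallyIntegrableOn (fun x => a x • f x) O :=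
  hf.continuousOn_smul hO.isLocallyClosed ha

/-- For a test function η on O the product η a is again a test function, although a may be singular
at the boundary; testing with it gives the product rule. -/
theorem HasWeakDeriv.smul_contDiffOn {O : Set (Euc d)} (hO : IsOpen O) {j : Fin d}
    {f g : Euc d → X} (h : HasWeakDeriv O (Pi.single j 1) f g) {a : Euc d → ℝ}
    (ha : ContDiffOn ℝ ∞ a O) :
    HasWeakDeriv O (Pi.single j 1) (fun x => a x • f x)
      (fun x => partialD j a x • f x + a x • g x) := by
  rw [hasWeakDeriv_single_iff] at h ⊢
  obtain ⟨h1, h2, h3⟩ := h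
  have ha' : ContDiffOn ℝ ∞ (partialD j a) O := contDiffOn_partialD hO ha (by simp) j
  have i1 := LocallyIntegrableOn.continuousOn_smul_open hO h1 ha'.continuousOn
  have i2 := LocallyIntegrableOn.continuousOn_smul_open hO h2 ha.continuousOn
  refine ⟨LocallyIntegrableOn.continuousOn_smul_open hO h1 ha.continuousOn, i1.add i2,
    fun η hη => ?_⟩
  have e := h3 _ (hη.mul hO ha)
  have hη' := isTest_partialD hη j
  have e1 : ∫ x in O, partialD j (fun x => η x * a x) x • f x =
      (∫ x in O, partialD j η x • a x • f x) +
        ∫ x in O, η x • partialD j a x • f x := by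
    rw [← integral_add (hη'.integrableOn_smul
      (LocallyIntegrableOn.continuousOn_smul_open hO h1 ha.continuousOn)) (hη.integrableOn_smul i1)]
    refine setIntegral_congr_fun hO.measurableSet fun x hx => ?_
    have := partialD_smul (i := j) (hη.1.contDiffAt.differentiableAt (x := x) (by simp))
      ((ha.contDiffAt (hO.mem_nhds hx)).differentiableAt (by simp))
    simp only [smul_eq_mul] at this
    simp only [this, add_smul, mul_smul]
  simp only [smul_add]
  rw [integral_add (hη.integrableOn_smul i1) (hη.integrableOn_smul i2)]
  rw [e1] at e
  have e2 : ∫ x in O, (η x * a x) • g x = ∫ x in O, η x • a x • g x := by simp only [mul_smul]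
  rw [e2] at e
  rw [neg_add, ← e]
  abel

theorem IsTest.integral_partialD {O : Set (Euc d)} {η : Euc d → ℝ} (h : IsTest O η) (j : Fin d) :
    ∫ x in O, partialD j η x = 0 := by
  have h' := isTest_partialD h j
  have e := integral_mul_fderiv_eq_neg_fderiv_mul_of_integrable (μ := (volume : Measure (Euc d)))
    (f := fun _ => (1 : ℝ)) (g := η) (v := EuclideanSpace.single j 1) (by simp)
    (by simp only [one_mul]; exact h'.1.continuous.integrable_of_hasCompactSupport h'.2.1)
    (by simpa using h.1.continuous.integrable_of_hasCompactSupport h.2.1)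
    (by fun_prop) (fun x _ => h.1.differentiable (by simp) x)
  rw [setIntegral_eq_integral_of_forall_compl_eq_zero]
  · simpa [partialD] using e
  · intro x hx
    exact image_eq_zero_of_notMem_tsupport fun hh => hx (h'.2.2 hh)

end Weak

end

end WeightedSobolev

namespace WeightedSobolev

noncomputable section

/-! ### Smooth changes of variables -/

section Diffeo

/-- By the Leibniz formula the determinant is a polynomial in the matrix entries. -/
theorem contDiff_clm_det {E : Type*} [NormedAddCommGroup E] [NormedSpace ℝ E]
    [FiniteDimensional ℝ E] : ContDiff ℝ ∞ (fun A : E →L[ℝ] E => A.det) := by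
  classical
  let b := Module.finBasis ℝ E
  have : (fun A : E →L[ℝ] E => A.det) = fun A => ∑ σ : Equiv.Perm (Fin (Module.finrank ℝ E)),
      ((Equiv.Perm.sign σ : ℤ) : ℝ) * ∏ i, b.repr (A (b i)) (σ i) := by
    funext A
    rw [ContinuousLinearMap.det, ← LinearMap.det_toMatrix b, Matrix.det_apply']
    simp [LinearMap.toMatrix_apply]
  rw [this]
  refine ContDiff.sum fun σ _ => contDiff_const.mul (contDiff_prod fun i _ => ?_)
  let l : (E →L[ℝ] E) →ₗ[ℝ] ℝ :=
    (b.coord (σ i)).comp ((LinearMap.applyₗ (b i)).comp (ContinuousLinearMap.coeLM ℝ))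
  exact (LinearMap.toContinuousLinearMap l).contDiff

variable {d : ℕ} {X : Type*} [NormedAddCommGroup X] [NormedSpace ℝ X]

/-- `χ` is a smooth diffeomorphism of the open set `V` onto the open set `V'`, with inverse `θ`. -/
structure IsSmoothDiffeo (V V' : Set (Euc d)) (χ θ : Euc d → Euc d) : Prop where
  isOpen_source : IsOpen V
  isOpen_target : IsOpen V'
  mapsTo : Set.MapsTo χ V V'
  mapsTo_inv : Set.MapsTo θ V' V
  left_inv : ∀ x ∈ V, θ (χ x) = x
  right_inv : ∀ y ∈ V', χ (θ y) = y
  contDiffOn : ContDiffOn ℝ ∞ χ V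
  contDiffOn_inv : ContDiffOn ℝ ∞ θ V'

/-- The absolute value of the Jacobian determinant. -/
def absJac (θ : Euc d → Euc d) (y : Euc d) : ℝ := |(fderiv ℝ θ y).det|

namespace IsSmoothDiffeo

variable {V V' : Set (Euc d)} {χ θ : Euc d → Euc d}

theorem symm (H : IsSmoothDiffeo V V' χ θ) : IsSmoothDiffeo V' V θ χ :=
  ⟨H.2, H.1, H.4, H.3, H.6, H.5, H.8, H.7⟩

theorem injOn (H : IsSmoothDiffeo V V' χ θ) : Set.InjOn χ V := fun x hx y hy h => by
  rw [← H.left_inv x hx, h, H.left_inv y hy]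

theorem image_eq (H : IsSmoothDiffeo V V' χ θ) : χ '' V = V' :=
  Set.Subset.antisymm (Set.image_subset_iff.2 H.mapsTo)
    fun y hy => ⟨θ y, H.mapsTo_inv hy, H.right_inv y hy⟩

theorem contDiffAt (H : IsSmoothDiffeo V V' χ θ) {x : Euc d} (hx : x ∈ V) :
    ContDiffAt ℝ ∞ χ x := H.contDiffOn.contDiffAt (H.isOpen_source.mem_nhds hx)

theorem differentiableAt (H : IsSmoothDiffeo V V' χ θ) {x : Euc d} (hx : x ∈ V) :
    DifferentiableAt ℝ χ x := (H.contDiffAt hx).differentiableAt (by simp)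

theorem hasFDerivWithinAt (H : IsSmoothDiffeo V V' χ θ) {S : Set (Euc d)} {x : Euc d}
    (hx : x ∈ V) : HasFDerivWithinAt χ (fderiv ℝ χ x) S x :=
  (H.differentiableAt hx).hasFDerivAt.hasFDerivWithinAt

theorem fderiv_comp_fderiv (H : IsSmoothDiffeo V V' χ θ) {x : Euc d} (hx : x ∈ V) :
    (fderiv ℝ θ (χ x)).comp (fderiv ℝ χ x) = ContinuousLinearMap.id ℝ _ := by
  rw [← fderiv_comp x (H.symm.differentiableAt (H.mapsTo hx)) (H.differentiableAt hx)]
  have : θ ∘ χ =ᶠ[nhds x] id :=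
    Filter.eventuallyEq_of_mem (H.isOpen_source.mem_nhds hx) fun y hy => H.left_inv y hy
  rw [this.fderiv_eq, fderiv_id]

theorem det_fderiv_ne_zero (H : IsSmoothDiffeo V V' χ θ) {x : Euc d} (hx : x ∈ V) :
    (fderiv ℝ χ x).det ≠ 0 := by
  have h := congrArg ContinuousLinearMap.det (H.fderiv_comp_fderiv hx)
  have h2 : ((fderiv ℝ θ (χ x)).comp (fderiv ℝ χ x)).det =
      (fderiv ℝ θ (χ x)).det * (fderiv ℝ χ x).det :=
    LinearMap.det_comp _ _
  have h3 : (ContinuousLinearMap.id ℝ (Euc d)).det = 1 := LinearMap.det_id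
  rw [h2, h3] at h
  exact right_ne_zero_of_mul (h.symm ▸ one_ne_zero)

theorem absJac_pos (H : IsSmoothDiffeo V V' χ θ) {x : Euc d} (hx : x ∈ V) : 0 < absJac χ x :=
  abs_pos.2 (H.det_fderiv_ne_zero hx)

theorem contDiffOn_absJac (H : IsSmoothDiffeo V V' χ θ) : ContDiffOn ℝ ∞ (absJac χ) V := by
  intro x hx
  have h1 : ContDiffAt ℝ ∞ (fderiv ℝ χ) x := (H.contDiffAt hx).fderiv_right (by simp)
  exact ((contDiffAt_abs (H.det_fderiv_ne_zero hx)).comp x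
    (contDiff_clm_det.contDiffAt.comp x h1)).contDiffWithinAt

theorem integral_eq (H : IsSmoothDiffeo V V' χ θ) (G : Euc d → X) :
    ∫ x in V, G x = ∫ y in V', absJac θ y • G (θ y) := by
  conv_lhs => rw [← H.symm.image_eq]
  exact integral_image_eq_integral_abs_det_fderiv_smul volume H.isOpen_target.measurableSet
    (fun x hx => H.symm.hasFDerivWithinAt hx) H.symm.injOn G

theorem lintegral_eq (H : IsSmoothDiffeo V V' χ θ) {S : Set (Euc d)} (hS : MeasurableSet S)
    (hSV : S ⊆ V') (G : Euc d → ℝ≥0∞) :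
    ∫⁻ x in θ '' S, G x = ∫⁻ y in S, ENNReal.ofReal (absJac θ y) * G (θ y) :=
  lintegral_image_eq_lintegral_abs_det_fderiv_mul volume hS
    (fun _ hx => H.symm.hasFDerivWithinAt (hSV hx)) (H.symm.injOn.mono hSV) G

/-- The change of variables formula yields integrability of |J| · f ∘ χ on compact sets, where |J|
is bounded away from zero and can be divided out. -/
theorem locallyIntegrableOn_comp (H : IsSmoothDiffeo V V' χ θ) {f : Euc d → X}
    (hf : LocallyIntegrableOn f V') : LocallyIntegrableOn (f ∘ χ) V := by
  rw [locallyIntegrableOn_iff H.isOpen_source.isLocallyClosed]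
  intro K hKV hK
  have hχK : IsCompact (χ '' K) := hK.image_of_continuousOn (H.contDiffOn.continuousOn.mono hKV)
  have h1 : IntegrableOn f (χ '' K) := hf.integrableOn_compact_subset
    (Set.image_subset_iff.2 fun x hx => H.mapsTo (hKV hx)) hχK
  rw [integrableOn_image_iff_integrableOn_abs_det_fderiv_smul volume hK.measurableSet
    (fun x hx => H.hasFDerivWithinAt (hKV hx)) (H.injOn.mono hKV)] at h1
  have hc : ContinuousOn (fun x => (absJac χ x)⁻¹) K :=
    (H.contDiffOn_absJac.continuousOn.mono hKV).inv₀ fun x hx => (H.absJac_pos (hKV hx)).ne'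
  refine (h1.continuousOn_smul hc hK).congr_fun (fun x hx => ?_) hK.measurableSet
  have := (H.absJac_pos (hKV hx)).ne'
  change (absJac χ x)⁻¹ • absJac χ x • f (χ x) = f (χ x)
  rw [smul_smul, inv_mul_cancel₀ this, one_smul]

theorem ae_comp (H : IsSmoothDiffeo V V' χ θ) {P : Euc d → Prop}
    (h : ∀ᵐ y ∂volume.restrict V', P y) : ∀ᵐ x ∂volume.restrict V, P (χ x) := by
  rw [ae_restrict_iff' H.isOpen_target.measurableSet] at h
  rw [ae_restrict_iff' H.isOpen_source.measurableSet]
  rw [ae_iff] at h ⊢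
  refine measure_mono_null (t := θ '' {a | ¬(a ∈ V' → P a)}) (fun x hx => ?_)
    (addHaar_image_eq_zero_of_differentiableOn_of_addHaar_eq_zero volume (fun y hy => ?_) h)
  · simp only [Set.mem_ofPred_eq, Classical.not_imp] at hx
    exact ⟨χ x, by simpa using ⟨H.mapsTo hx.1, hx.2⟩, H.left_inv x hx.1⟩
  · simp only [Set.mem_ofPred_eq, Classical.not_imp] at hy
    exact (H.symm.differentiableAt hy.1).differentiableWithinAt

theorem contDiffOn_partialD_apply (H : IsSmoothDiffeo V V' χ θ) (j i : Fin d) :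
    ContDiffOn ℝ ∞ (fun x => partialD j χ x i) V :=
  (EuclideanSpace.proj i : Euc d →L[ℝ] ℝ).contDiff.comp_contDiffOn
    (contDiffOn_partialD H.isOpen_source H.contDiffOn (by simp) j)

/-- The test functions by which the gradient of `f` is tested in the chain rule. -/
def pushTest (χ θ : Euc d → Euc d) (η : Euc d → ℝ) (j i : Fin d) (y : Euc d) : ℝ :=
  η (θ y) * (absJac θ y * partialD j χ (θ y) i)

/-- The indicator extends η ∘ θ by zero outside V'; its support lies in the compact image of supp η,
which stays inside V'. -/
theorem isTest_comp (H : IsSmoothDiffeo V V' χ θ) {η : Euc d → ℝ} (hη : IsTest V η) :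
    IsTest V' (V'.indicator (η ∘ θ)) := by
  have hK : IsCompact (χ '' tsupport η) :=
    hη.2.1.isCompact.image_of_continuousOn (H.contDiffOn.continuousOn.mono hη.2.2)
  have hs : tsupport (V'.indicator (η ∘ θ)) ⊆ χ '' tsupport η := by
    refine closure_minimal (fun y hy => ?_) hK.isClosed
    have hy' : y ∈ V' := by
      by_contra h
      exact hy (Set.indicator_of_notMem h _)
    rw [Function.mem_support, Set.indicator_of_mem hy'] at hy
    exact ⟨θ y, subset_tsupport _ hy, H.right_inv y hy'⟩
  have hs' : tsupport (V'.indicator (η ∘ θ)) ⊆ V' :=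
    hs.trans (Set.image_subset_iff.2 fun x hx => H.mapsTo (hη.2.2 hx))
  refine ⟨contDiff_of_contDiffOn_tsupport H.isOpen_target ?_ hs',
    hK.of_isClosed_subset (isClosed_tsupport _) hs, hs'⟩
  exact (hη.1.comp_contDiffOn H.contDiffOn_inv).congr fun y hy => Set.indicator_of_mem hy _

theorem isTest_pushTest (H : IsSmoothDiffeo V V' χ θ) {η : Euc d → ℝ} (hη : IsTest V η)
    (j i : Fin d) : IsTest V' (V'.indicator (pushTest χ θ η j i)) := by
  have h := (H.isTest_comp hη).mul H.isOpen_target (a := fun y => absJac θ y * partialD j χ (θ y) i)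
    (H.symm.contDiffOn_absJac.mul
      ((H.contDiffOn_partialD_apply j i).comp H.contDiffOn_inv H.mapsTo_inv))
  convert h using 1
  funext y
  by_cases hy : y ∈ V' <;> simp [hy, pushTest]

/-- Piola's identity. -/
theorem sum_partialD_pushTest (H : IsSmoothDiffeo V V' χ θ) {η : Euc d → ℝ} (hη : IsTest V η)
    (j : Fin d) {y : Euc d} (hy : y ∈ V') :
    ∑ i, partialD i (V'.indicator (pushTest χ θ η j i)) y = absJac θ y * partialD j η (θ y) := by
  have hζ := fun i => H.isTest_pushTest hη j i
  have c1 : ContinuousOn (fun y => ∑ i, partialD i (V'.indicator (pushTest χ θ η j i)) y) V' :=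
    (continuous_finsetSum _ fun i _ => (isTest_partialD (hζ i) i).1.continuous).continuousOn
  have c2 : ContinuousOn (fun y => absJac θ y * partialD j η (θ y)) V' :=
    H.symm.contDiffOn_absJac.continuousOn.mul
      ((isTest_partialD hη j).1.continuous.comp_continuousOn H.contDiffOn_inv.continuousOn)
  -- Both sides are continuous, so an identity almost everywhere suffices, and that can be proved by
  -- duality. Second derivatives of χ and cofactor identities are thereby avoided.
  refine Measure.eqOn_open_of_ae_eq (μ := volume) (f := fun y => ∑ i, partialD i
    (V'.indicator (pushTest χ θ η j i)) y) ?_ H.isOpen_target c1 c2 hy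
  have key := H.isOpen_target.ae_eq_zero_of_integral_contDiff_smul_eq_zero (μ := volume)
    (f := fun y => (∑ i, partialD i (V'.indicator (pushTest χ θ η j i)) y) -
      absJac θ y * partialD j η (θ y)) ((c1.sub c2).locallyIntegrableOn
        H.isOpen_target.measurableSet) ?_
  · rw [Filter.EventuallyEq, ae_restrict_iff' H.isOpen_target.measurableSet]
    filter_upwards [key] with x hx hxO
    simpa [sub_eq_zero] using hx hxO
  intro g g1 g2 g3
  have hg : IsTest V' g := ⟨g1, g2, g3⟩
  have hq : IsTest V fun x => η x * g (χ x) :=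
    hη.mul H.isOpen_source (g1.comp_contDiffOn H.contDiffOn)
  have hr := fun i => (hζ i).mul H.isOpen_target g1.contDiffOn
  rw [← setIntegral_eq_integral_of_forall_compl_eq_zero (s := V') fun x hx => by
    rw [image_eq_zero_of_notMem_tsupport fun hh => hx (g3 hh), zero_smul]]
  -- After multiplication by g, the terms containing derivatives of g cancel. What remains is a
  -- divergence of test functions on V' minus the pullback of ∂_j of the test function η · (g ∘ χ)
  -- on V. Both integrate to zero, the second after changing variables back to V.
  have e : ∀ y ∈ V', g y • ((∑ i, partialD i (V'.indicator (pushTest χ θ η j i)) y) -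
      absJac θ y * partialD j η (θ y)) =
      (∑ i, partialD i (fun y => V'.indicator (pushTest χ θ η j i) y * g y) y) -
        absJac θ y • partialD j (fun x => η x * g (χ x)) (θ y) := by
    intro y hy
    have hx := H.mapsTo_inv hy
    have d1 : partialD j (fun x => η x * g (χ x)) (θ y) = partialD j η (θ y) * g y +
        η (θ y) * ∑ i, partialD j χ (θ y) i * partialD i g y := by
      have := partialD_smul (i := j) (f := g ∘ χ) (hη.1.differentiable (by simp) (θ y))
        ((g1.differentiable (by simp) _).comp _ (H.differentiableAt hx))
      rw [partialD_comp (g1.differentiable (by simp) _) (H.differentiableAt hx)] at this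
      simpa [H.right_inv y hy] using this
    have d2 : ∀ i, partialD i (fun y => V'.indicator (pushTest χ θ η j i) y * g y) y =
        partialD i (V'.indicator (pushTest χ θ η j i)) y * g y +
          η (θ y) * (absJac θ y * partialD j χ (θ y) i) * partialD i g y := by
      intro i
      have := partialD_smul (i := i) (f := g) ((hζ i).1.differentiable (by simp) y)
        (g1.differentiable (by simp) y)
      simpa [Set.indicator_of_mem hy, pushTest] using this
    simp only [d1, d2, Finset.sum_add_distrib, smul_eq_mul, ← Finset.sum_mul]
    have : ∑ i, η (θ y) * (absJac θ y * partialD j χ (θ y) i) * partialD i g y =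
        absJac θ y * (η (θ y) * ∑ i, partialD j χ (θ y) i * partialD i g y) := by
      rw [Finset.mul_sum, Finset.mul_sum]
      exact Finset.sum_congr rfl fun i _ => by ring
    rw [this]
    ring
  rw [setIntegral_congr_fun H.isOpen_target.measurableSet e, integral_sub, integral_finsetSum,
    ← H.integral_eq, hq.integral_partialD, Finset.sum_eq_zero fun i _ => (hr i).integral_partialD i,
    sub_zero]
  · exact fun i _ => ((isTest_partialD (hr i) i).1.continuous.integrable_of_hasCompactSupport
      (isTest_partialD (hr i) i).2.1).integrableOn
  · exact integrable_finsetSum _ fun i _ =>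
      ((isTest_partialD (hr i) i).1.continuous.integrable_of_hasCompactSupport
        (isTest_partialD (hr i) i).2.1).integrableOn
  · have hq' := isTest_partialD hq j
    have := (integrableOn_image_iff_integrableOn_abs_det_fderiv_smul volume
      H.isOpen_target.measurableSet (fun x hx => H.symm.hasFDerivWithinAt hx) H.symm.injOn
      (partialD j fun x => η x * g (χ x))).1
    exact this (hq'.1.continuous.integrable_of_hasCompactSupport hq'.2.1).integrableOn

/-- The chain rule for weak derivatives. -/
theorem hasWeakDeriv_comp (H : IsSmoothDiffeo V V' χ θ) {f : Euc d → X} {f' : Fin d → Euc d → X}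
    (hf : ∀ i, HasWeakDeriv V' (Pi.single i 1) f (f' i)) (j : Fin d) :
    HasWeakDeriv V (Pi.single j 1) (f ∘ χ)
      (fun x => ∑ i, partialD j χ x i • f' i (χ x)) := by
  have hl : LocallyIntegrableOn (fun x => ∑ i, partialD j χ x i • f' i (χ x)) V := by
    have : ∀ s : Finset (Fin d),
        LocallyIntegrableOn (fun x => ∑ i ∈ s, partialD j χ x i • f' i (χ x)) V := by
      intro s
      induction s using Finset.induction_on with
      | empty => simpa using (locallyIntegrable_zero.locallyIntegrableOn V)
      | insert i s hi ih =>
        simp only [Finset.sum_insert hi]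
        exact (LocallyIntegrableOn.continuousOn_smul_open H.isOpen_source
          (H.locallyIntegrableOn_comp (hf i).right)
          (H.contDiffOn_partialD_apply j i).continuousOn).add ih
    exact this _
  have hl' : LocallyIntegrableOn f V' := (hf j).left
  refine hasWeakDeriv_single_iff.2 ⟨H.locallyIntegrableOn_comp hl', hl, fun η hη => ?_⟩
  have hζ := fun i => H.isTest_pushTest hη j i
  -- On V' the factor |J| ∂_j η ∘ θ is, by Piola's identity, a sum of derivatives of test functions,
  -- so the weak derivatives of f on V' can be inserted.
  rw [H.integral_eq, H.integral_eq]
  have e1 : ∀ y ∈ V', absJac θ y • partialD j η (θ y) • (f ∘ χ) (θ y) =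
      ∑ i, partialD i (V'.indicator (pushTest χ θ η j i)) y • f y := by
    intro y hy
    rw [← Finset.sum_smul, H.sum_partialD_pushTest hη j hy, Function.comp_apply, H.right_inv y hy,
      mul_smul]
  have e2 : ∀ y ∈ V', absJac θ y • η (θ y) • ∑ i, partialD j χ (θ y) i • f' i (χ (θ y)) =
      ∑ i, V'.indicator (pushTest χ θ η j i) y • f' i y := by
    intro y hy
    rw [H.right_inv y hy, smul_smul, Finset.smul_sum]
    refine Finset.sum_congr rfl fun i _ => ?_
    rw [Set.indicator_of_mem hy, smul_smul, pushTest]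
    congr 1
    ring
  rw [setIntegral_congr_fun H.isOpen_target.measurableSet e1,
    setIntegral_congr_fun H.isOpen_target.measurableSet e2,
    integral_finsetSum _ fun i _ => (isTest_partialD (hζ i) i).integrableOn_smul hl',
    integral_finsetSum _ fun i _ => (hζ i).integrableOn_smul (hf i).right,
    ← Finset.sum_neg_distrib]
  exact Finset.sum_congr rfl fun i _ => (hasWeakDeriv_single_iff.1 (hf i)).2.2 _ (hζ i)

end IsSmoothDiffeo

end Diffeo

end

end WeightedSobolev

namespace WeightedSobolev

noncomputable section

/-! ### Dilations of the half-space in the normal direction -/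

section Dilation

variable {n : ℕ}

theorem isOpen_halfSpace : IsOpen (halfSpace n) :=
  isOpen_lt continuous_const (by fun_prop)

/-- The dilation `(y₀, ỹ) ↦ (r y₀, ỹ)`. -/
def dil (r : ℝ) : Euc (n + 1) →L[ℝ] Euc (n + 1) :=
  ContinuousLinearMap.id ℝ _ +
    (r - 1) • (EuclideanSpace.proj 0 : Euc (n + 1) →L[ℝ] ℝ).smulRight (e₁ n)

theorem dil_apply (r : ℝ) (y : Euc (n + 1)) : dil r y = y + ((r - 1) * y 0) • e₁ n := by
  simp [dil, mul_smul]

theorem e₁_apply (i : Fin (n + 1)) : e₁ n i = if i = 0 then 1 else 0 := by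
  simp [e₁]

@[simp] theorem e₁_zero : e₁ n 0 = 1 := by simp [e₁_apply]

@[simp] theorem e₁_succ (i : Fin n) : e₁ n i.succ = 0 := by simp [e₁_apply]

theorem dil_apply_apply (r : ℝ) (y : Euc (n + 1)) (i : Fin (n + 1)) :
    dil r y i = (if i = 0 then r else 1) * y i := by
  rw [dil_apply]
  by_cases h : i = 0
  · subst h; simp; ring
  · simp [h, e₁_apply]

@[simp] theorem dil_apply_zero (r : ℝ) (y : Euc (n + 1)) : dil r y 0 = r * y 0 := by
  simp [dil_apply_apply]

theorem dil_inv_dil {r : ℝ} (hr : r ≠ 0) (y : Euc (n + 1)) : dil r⁻¹ (dil r y) = y := by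
  ext i
  rw [dil_apply_apply, dil_apply_apply]
  split_ifs <;> simp [hr]

theorem det_dil (r : ℝ) : (dil r : Euc (n + 1) →L[ℝ] Euc (n + 1)).det = r := by
  let b := (EuclideanSpace.basisFun (Fin (n + 1)) ℝ).toBasis
  rw [ContinuousLinearMap.det, ← LinearMap.det_toMatrix b]
  have : LinearMap.toMatrix b b (dil r : Euc (n + 1) →L[ℝ] Euc (n + 1)) =
      Matrix.diagonal fun i => if i = 0 then r else 1 := by
    ext i j
    simp [b, LinearMap.toMatrix_apply, dil_apply_apply, Matrix.diagonal_apply]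
  rw [this, Matrix.det_diagonal]
  simp

theorem isSmoothDiffeo_dil {r : ℝ} (hr : 0 < r) :
    IsSmoothDiffeo (halfSpace n) (halfSpace n) (dil r) (dil r⁻¹) where
  isOpen_source := isOpen_halfSpace
  isOpen_target := isOpen_halfSpace
  mapsTo x hx := by
    have hx : 0 < x 0 := hx
    simpa [halfSpace] using mul_pos hr hx
  mapsTo_inv x hx := by
    have hx : 0 < x 0 := hx
    simpa [halfSpace] using mul_pos (inv_pos.2 hr) hx
  left_inv x _ := dil_inv_dil hr.ne' x
  right_inv x _ := by simpa using dil_inv_dil (inv_ne_zero hr.ne') x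
  contDiffOn := (dil r).contDiff.contDiffOn
  contDiffOn_inv := (dil r⁻¹).contDiff.contDiffOn

theorem absJac_dil {r : ℝ} (hr : 0 < r) (y : Euc (n + 1)) : absJac (dil r) y = r := by
  rw [absJac, ContinuousLinearMap.fderiv, det_dil, abs_of_pos hr]

theorem measurable_dil : Measurable fun z : ℝ × Euc (n + 1) => dil z.1 z.2 := by
  simp only [dil_apply]
  fun_prop

theorem measurable_dil_kernel {κ : Euc (n + 1) → ℝ} (hκ : Measurable κ) :
    Measurable fun z : Euc (n + 1) × ℝ => -((z.2⁻¹) ^ 2 * κ (dil z.2⁻¹ z.1)) := by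
  have h1 : Measurable fun z : Euc (n + 1) × ℝ => dil z.2⁻¹ z.1 :=
    measurable_dil.comp (f := fun z : Euc (n + 1) × ℝ => (z.2⁻¹, z.1))
      (measurable_snd.inv.prodMk measurable_fst)
  have h3 : Measurable fun z : Euc (n + 1) × ℝ => (z.2⁻¹) ^ 2 := measurable_snd.inv.pow_const 2
  exact (h3.mul (hκ.comp h1)).neg

theorem isSmoothDiffeo_dil_inv {r : ℝ} (hr : 0 < r) :
    IsSmoothDiffeo (halfSpace n) (halfSpace n) (dil r⁻¹) (dil r) := by
  simpa using isSmoothDiffeo_dil (n := n) (inv_pos.2 hr)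

/-- Only the normal coordinate is scaled, so y₀^σ dy is homogeneous of degree σ + 1. The factor is
below one for r > 1 exactly when σ > -1, and this drives Hardy's inequality. -/
theorem lintegral_dil {r σ : ℝ} (hr : 0 < r) (φ : Euc (n + 1) → ℝ≥0∞) :
    ∫⁻ y in halfSpace n, φ (dil r y) * ENNReal.ofReal (y 0 ^ σ) =
      ENNReal.ofReal (r ^ (-(σ + 1))) * ∫⁻ y in halfSpace n, φ y * ENNReal.ofReal (y 0 ^ σ) := by
  have H := isSmoothDiffeo_dil_inv (n := n) hr
  have e := H.lintegral_eq isOpen_halfSpace.measurableSet subset_rfl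
    fun y => φ y * ENNReal.ofReal (y 0 ^ σ)
  rw [H.symm.image_eq] at e
  rw [e, ← lintegral_const_mul' _ _ ENNReal.ofReal_ne_top]
  refine setLIntegral_congr_fun isOpen_halfSpace.measurableSet fun y hy => ?_
  have hy : 0 < y 0 := hy
  simp only [absJac_dil hr, dil_apply_zero]
  rw [Real.mul_rpow hr.le hy.le, ENNReal.ofReal_mul (by positivity)]
  have : ENNReal.ofReal (r ^ (-(σ + 1))) * (ENNReal.ofReal r * ENNReal.ofReal (r ^ σ)) = 1 := by
    rw [← ENNReal.ofReal_mul hr.le, ← ENNReal.ofReal_mul (by positivity), ← ENNReal.ofReal_one]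
    congr 1
    rw [neg_add, Real.rpow_add hr, Real.rpow_neg hr.le, Real.rpow_neg_one]
    have : r ^ σ ≠ 0 := (Real.rpow_pos_of_pos hr _).ne'
    field_simp
  calc _ = 1 * (φ (dil r y) * ENNReal.ofReal (y 0 ^ σ)) := (one_mul _).symm
    _ = _ := by rw [← this]; ring

/-! ### The increment of a function under dilation as an integral of its normal derivative. -/

variable {X : Type*} [NormedAddCommGroup X] [NormedSpace ℝ X]

/-- The compact set swept out by a compact set under dilations by factors in `[1, 2]`. -/
theorem isCompact_sweep {K : Set (Euc (n + 1))} (hK : IsCompact K) :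
    IsCompact ((fun z : ℝ × Euc (n + 1) => dil z.1 z.2) '' (Set.Icc 1 2 ×ˢ K)) := by
  refine (isCompact_Icc.prod hK).image ?_
  simp only [dil_apply]
  fun_prop

theorem sweep_subset {K : Set (Euc (n + 1))} (hK : K ⊆ halfSpace n) :
    (fun z : ℝ × Euc (n + 1) => dil z.1 z.2) '' (Set.Icc 1 2 ×ˢ K) ⊆ halfSpace n := by
  rintro _ ⟨⟨r, y⟩, ⟨hr, hy⟩, rfl⟩
  exact (isSmoothDiffeo_dil (lt_of_lt_of_le one_pos hr.1)).mapsTo (hK hy)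

/-- By Tonelli: each slice is transformed by the dilation with factor r, and all the images lie in
one compact subset of the half-space, where g is integrable. -/
theorem integrable_dil_prod {g : Euc (n + 1) → X} (hg : LocallyIntegrableOn g (halfSpace n))
    (hgm : StronglyMeasurable g) {K : Set (Euc (n + 1))} (hK : IsCompact K)
    (hKU : K ⊆ halfSpace n) :
    Integrable (fun z : ℝ × Euc (n + 1) => z.2 0 • g (dil z.1 z.2))
      ((volume.restrict (Set.Icc 1 2)).prod (volume.restrict K)) := by
  set K' := (fun z : ℝ × Euc (n + 1) => dil z.1 z.2) '' (Set.Icc 1 2 ×ˢ K) with hK'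
  have hm : StronglyMeasurable (fun z : ℝ × Euc (n + 1) => z.2 0 • g (dil z.1 z.2)) :=
    StronglyMeasurable.smul (Measurable.stronglyMeasurable (by fun_prop))
      (hgm.comp_measurable measurable_dil)
  refine ⟨hm.aestronglyMeasurable, ?_⟩
  have hg' : IntegrableOn g K' :=
    hg.integrableOn_compact_subset (sweep_subset hKU) (isCompact_sweep hK)
  obtain ⟨M, hM⟩ := hK.exists_bound_of_continuousOn (f := fun y : Euc (n + 1) => y 0)
    (by fun_prop)
  have hfin : ENNReal.ofReal M * ∫⁻ y in K', ‖g y‖ₑ < ⊤ :=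
    ENNReal.mul_lt_top ENNReal.ofReal_lt_top hg'.2
  rw [HasFiniteIntegral, lintegral_prod _ hm.enorm.aemeasurable]
  refine lt_of_le_of_lt (setLIntegral_mono' (g := fun _ => ENNReal.ofReal M * ∫⁻ y in K', ‖g y‖ₑ)
    measurableSet_Icc fun r hr => ?_) ?_
  · have hr0 : 0 < r := lt_of_lt_of_le one_pos hr.1
    have e := (isSmoothDiffeo_dil_inv (n := n) hr0).lintegral_eq hK.measurableSet hKU
      fun y => ‖g y‖ₑ
    rw [← lintegral_const_mul' _ _ ENNReal.ofReal_ne_top]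
    calc ∫⁻ y in K, ‖y 0 • g (dil r y)‖ₑ
        ≤ ∫⁻ y in K, ENNReal.ofReal M * (ENNReal.ofReal (absJac (dil r) y) * ‖g (dil r y)‖ₑ) := by
          refine setLIntegral_mono' hK.measurableSet fun y hy => ?_
          rw [enorm_smul, absJac_dil hr0, ← mul_assoc]
          gcongr
          rw [← mul_one ‖y 0‖ₑ]
          gcongr
          · rw [← ofReal_norm]
            exact ENNReal.ofReal_le_ofReal (hM y hy)
          · exact ENNReal.one_le_ofReal.2 hr.1
      _ = ∫⁻ y in dil r '' K, ENNReal.ofReal M * ‖g y‖ₑ := by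
          rw [lintegral_const_mul' _ _ ENNReal.ofReal_ne_top,
            lintegral_const_mul' _ _ ENNReal.ofReal_ne_top, e]
      _ ≤ _ := by
          refine lintegral_mono_set ?_
          rintro _ ⟨y, hy, rfl⟩
          exact ⟨(r, y), ⟨hr, hy⟩, rfl⟩
  · rw [setLIntegral_const]
    exact ENNReal.mul_lt_top hfin (by simp)

/-- The difference of a function and its dilation is the integral of the weak derivative. -/
theorem integral_smul_dil_sub [CompleteSpace X] {f g : Euc (n + 1) → X}
    (h : HasWeakDeriv (halfSpace n) (Pi.single 0 1) f g) (hgm : StronglyMeasurable g)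
    {η : Euc (n + 1) → ℝ} (hη : IsTest (halfSpace n) η) :
    ∫ y in halfSpace n, η y • (f (dil 2 y) - f y) =
      ∫ y in halfSpace n, η y • ∫ r in Set.Icc (1 : ℝ) 2, y 0 • g (dil r y) := by
  set U := halfSpace n with hU
  have hUm : MeasurableSet U := isOpen_halfSpace.measurableSet
  have hf : LocallyIntegrableOn f U := h.left
  -- Transposing f ↦ f ∘ `dil r` onto η gives the kernel r⁻¹ η(`dil r⁻¹` y). Its derivative in r is
  -- -r⁻² κ(`dil r⁻¹` y) with κ = η + y₀ ∂₀η = ∂₀(y₀ η), and this is why ξ = y₀ η is the right test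
  -- function.
  set ξ : Euc (n + 1) → ℝ := fun x => η x * x 0 with hξdef
  have hξ : IsTest U ξ := hη.mul isOpen_halfSpace (by fun_prop)
  have hκ := isTest_partialD hξ 0
  set κ := partialD 0 ξ with hκdef
  have hκ_eq : ∀ x, κ x = η x + x 0 * partialD 0 η x := by
    intro x
    have := partialD_smul (i := 0) (f := fun x : Euc (n + 1) => x 0)
      (hη.1.differentiable (by simp) x) (by fun_prop)
    rw [hκdef, hξdef]
    simp only [smul_eq_mul] at this
    rw [this]
    have : partialD 0 (fun x : Euc (n + 1) => x 0) x = 1 := by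
      have : (fun x : Euc (n + 1) => x 0) = (EuclideanSpace.proj 0 : Euc (n + 1) →L[ℝ] ℝ) := rfl
      rw [partialD, this, ContinuousLinearMap.fderiv]
      simp
    rw [this]
    ring
  clear_value κ
  -- the kernel identity
  have hker : ∀ y, (2 : ℝ)⁻¹ * η (dil 2⁻¹ y) - η y =
      ∫ r in Set.Icc (1 : ℝ) 2, -((r⁻¹) ^ 2 * κ (dil r⁻¹ y)) := by
    intro y
    have hd : ∀ r ∈ Set.uIcc (1 : ℝ) 2, HasDerivAt (fun r => r⁻¹ * η (dil r⁻¹ y))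
        (-((r⁻¹) ^ 2 * κ (dil r⁻¹ y))) r := by
      intro r hr
      rw [Set.uIcc_of_le one_le_two] at hr
      have hr0 : r ≠ 0 := (lt_of_lt_of_le one_pos hr.1).ne'
      have d1 : HasDerivAt (fun r : ℝ => r⁻¹) (-(r⁻¹) ^ 2) r := by
        simpa using hasDerivAt_inv hr0
      have d2 : HasDerivAt (fun r : ℝ => dil r⁻¹ y) ((-(r⁻¹) ^ 2 * y 0) • e₁ n) r := by
        simp only [dil_apply]
        exact (((d1.sub_const 1).mul_const (y 0)).smul_const (e₁ n)).const_add y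
      have d3 := (hη.1.differentiable (by simp) (dil r⁻¹ y)).hasFDerivAt.comp_hasDerivAt r d2
      refine (show HasDerivAt (fun r => r⁻¹ * η (dil r⁻¹ y)) _ r from d1.mul d3).congr_deriv ?_
      rw [hκ_eq, map_smul, dil_apply_zero]
      simp only [partialD, e₁, smul_eq_mul]
      ring
    rw [integral_Icc_eq_integral_Ioc, ← intervalIntegral.integral_of_le one_le_two,
      intervalIntegral.integral_eq_sub_of_hasDerivAt hd]
    · have : dil (1 : ℝ) y = y := by simp [dil_apply]
      simp [this]
    · refine ContinuousOn.intervalIntegrable fun r hr => ?_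
      rw [Set.uIcc_of_le one_le_two] at hr
      have hr0 : r ≠ 0 := (lt_of_lt_of_le one_pos hr.1).ne'
      have c1 : ContinuousAt (fun r : ℝ => r⁻¹) r := continuousAt_inv₀ hr0
      have c2 : ContinuousAt (fun r : ℝ => dil r⁻¹ y) r := by
        simp only [dil_apply]
        fun_prop
      exact ((c1.pow 2).mul (ContinuousAt.comp (g := κ) hκ.1.continuous.continuousAt
        c2)).neg.continuousWithinAt
  -- the left-hand side
  have H2 := isSmoothDiffeo_dil_inv (n := n) (r := 2) two_pos
  have i1 : IntegrableOn (fun y => η y • f (dil 2 y)) U :=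
    hη.integrableOn_smul (H2.symm.locallyIntegrableOn_comp hf)
  have e1 : ∫ y in U, η y • f (dil 2 y) = ∫ y in U, ((2 : ℝ)⁻¹ * η (dil 2⁻¹ y)) • f y := by
    rw [H2.symm.integral_eq]
    refine setIntegral_congr_fun hUm fun y hy => ?_
    simp only [absJac_dil (inv_pos.2 (two_pos (α := ℝ))), smul_smul]
    rw [H2.left_inv y hy]
  have hη2 : IsTest U (U.indicator (η ∘ dil 2⁻¹)) := H2.symm.isTest_comp hη
  have i2 : IntegrableOn (fun y => ((2 : ℝ)⁻¹ * η (dil 2⁻¹ y)) • f y) U := by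
    have : IntegrableOn (fun y => (2 : ℝ)⁻¹ • (U.indicator (η ∘ dil 2⁻¹) y • f y)) U :=
      (hη2.integrableOn_smul hf).smul (2 : ℝ)⁻¹
    refine this.congr_fun (fun y hy => ?_) hUm
    simp [Set.indicator_of_mem hy, mul_smul]
  have e2 : ∫ y in U, η y • (f (dil 2 y) - f y) =
      ∫ y in U, (∫ r in Set.Icc (1 : ℝ) 2, -((r⁻¹) ^ 2 * κ (dil r⁻¹ y))) • f y := by
    simp only [smul_sub]
    rw [integral_sub i1 (hη.integrableOn_smul hf), e1,
      ← integral_sub i2 (hη.integrableOn_smul hf)]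
    simp only [← sub_smul, hker]
  -- first application of Fubini's theorem
  set K := (fun z : ℝ × Euc (n + 1) => dil z.1 z.2) '' (Set.Icc 1 2 ×ˢ tsupport κ) with hKdef
  have hK : IsCompact K := isCompact_sweep hκ.2.1
  have hKU : K ⊆ U := sweep_subset hκ.2.2
  -- As f is only locally integrable, it is cut off to K before Fubini is applied; for every r in
  -- [1, 2] the kernel vanishes outside K, so nothing is lost.
  have hf' : Integrable (K.indicator f) :=
    (integrable_indicator_iff hK.measurableSet).2 (hf.integrableOn_compact_subset hKU hK)
  have hzero : ∀ r ∈ Set.Icc (1 : ℝ) 2, ∀ y, y ∉ K → κ (dil r⁻¹ y) = 0 := by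
    intro r hr y hy
    refine image_eq_zero_of_notMem_tsupport fun hh => hy ⟨(r, dil r⁻¹ y), ⟨hr, hh⟩, ?_⟩
    simpa using dil_inv_dil (inv_ne_zero (lt_of_lt_of_le one_pos hr.1).ne') y
  obtain ⟨C, hC⟩ := hκ.2.1.exists_bound_of_continuous hκ.1.continuous
  have iF : Integrable (fun z : Euc (n + 1) × ℝ =>
      (-((z.2⁻¹) ^ 2 * κ (dil z.2⁻¹ z.1))) • K.indicator f z.1)
      ((volume.restrict U).prod (volume.restrict (Set.Icc 1 2))) := by
    have hm := measurable_dil_kernel hκ.1.continuous.measurable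
    have hff : Integrable (fun z : Euc (n + 1) × ℝ => K.indicator f z.1)
        ((volume.restrict U).prod (volume.restrict (Set.Icc 1 2))) := hf'.integrableOn.comp_fst _
    refine Integrable.bdd_smul hff C hm.aestronglyMeasurable ?_
    · have : ∀ᵐ z ∂((volume.restrict U).prod (volume.restrict (Set.Icc (1 : ℝ) 2))),
          z.2 ∈ Set.Icc (1 : ℝ) 2 :=
        (Measure.quasiMeasurePreserving_snd).ae (ae_restrict_mem measurableSet_Icc)
      filter_upwards [this] with z hz
      rw [norm_neg, norm_mul, norm_pow, norm_inv, Real.norm_of_nonneg (zero_le_one.trans hz.1)]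
      have h1 : (z.2⁻¹) ^ 2 ≤ 1 := pow_le_one₀ (inv_nonneg.2 (zero_le_one.trans hz.1))
        (inv_le_one_of_one_le₀ hz.1)
      calc _ ≤ 1 * ‖κ (dil z.2⁻¹ z.1)‖ := by gcongr
        _ ≤ C := by rw [one_mul]; exact hC _
  have e3 : ∫ y in U, (∫ r in Set.Icc (1 : ℝ) 2, -((r⁻¹) ^ 2 * κ (dil r⁻¹ y))) • f y =
      ∫ r in Set.Icc (1 : ℝ) 2, ∫ y in U, (-((r⁻¹) ^ 2 * κ (dil r⁻¹ y))) • f y := by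
    have a1 : ∀ y, (∫ r in Set.Icc (1 : ℝ) 2, -((r⁻¹) ^ 2 * κ (dil r⁻¹ y))) • f y =
        ∫ r in Set.Icc (1 : ℝ) 2, (-((r⁻¹) ^ 2 * κ (dil r⁻¹ y))) • K.indicator f y := by
      intro y
      by_cases hy : y ∈ K
      · rw [Set.indicator_of_mem hy, integral_smul_const]
      · rw [setIntegral_eq_zero_of_forall_eq_zero fun r hr => by rw [hzero r hr y hy]; simp]
        simp [Set.indicator_of_notMem hy]
    have a2 : ∀ r ∈ Set.Icc (1 : ℝ) 2,
        ∫ y in U, (-((r⁻¹) ^ 2 * κ (dil r⁻¹ y))) • f y =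
          ∫ y in U, (-((r⁻¹) ^ 2 * κ (dil r⁻¹ y))) • K.indicator f y := by
      intro r hr
      congr 1
      funext y
      by_cases hy : y ∈ K
      · rw [Set.indicator_of_mem hy]
      · rw [hzero r hr y hy]
        simp
    simp only [a1]
    rw [integral_integral_swap iF]
    exact (setIntegral_congr_fun measurableSet_Icc a2).symm
  -- integration by parts
  have e4 : ∀ r ∈ Set.Icc (1 : ℝ) 2, ∫ y in U, (-((r⁻¹) ^ 2 * κ (dil r⁻¹ y))) • f y =
      ∫ y in U, η y • y 0 • g (dil r y) := by
    intro r hr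
    have hr0 : 0 < r := lt_of_lt_of_le one_pos hr.1
    have H := isSmoothDiffeo_dil_inv (n := n) hr0
    have hζ : IsTest U (U.indicator (ξ ∘ dil r⁻¹)) := H.symm.isTest_comp hξ
    have hp : ∀ y ∈ U, partialD 0 (U.indicator (ξ ∘ dil r⁻¹)) y = r⁻¹ * κ (dil r⁻¹ y) := by
      intro y hy
      rw [partialD_congr isOpen_halfSpace (g := ξ ∘ dil r⁻¹)
        (fun y hy => Set.indicator_of_mem hy _) 0 hy]
      unfold partialD
      rw [fderiv_comp y (hξ.1.differentiable (by simp) _) (dil r⁻¹).differentiableAt,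
        ContinuousLinearMap.fderiv, ContinuousLinearMap.comp_apply]
      have : dil r⁻¹ (EuclideanSpace.single 0 (1 : ℝ) : Euc (n + 1)) =
          r⁻¹ • EuclideanSpace.single 0 (1 : ℝ) := by
        ext i
        rw [dil_apply_apply]
        by_cases hi : i = 0 <;> simp [hi]
      rw [this, map_smul, hκdef]
      rfl
    have e := (hasWeakDeriv_single_iff.1 h).2.2 _ hζ
    calc ∫ y in U, (-((r⁻¹) ^ 2 * κ (dil r⁻¹ y))) • f y
        = -(r⁻¹ • ∫ y in U, partialD 0 (U.indicator (ξ ∘ dil r⁻¹)) y • f y) := by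
          rw [← integral_smul, ← integral_neg]
          refine setIntegral_congr_fun hUm fun y hy => ?_
          simp only [hp y hy]
          rw [smul_smul, neg_smul, pow_two, mul_assoc]
      _ = ∫ y in U, r⁻¹ • (U.indicator (ξ ∘ dil r⁻¹) y • g y) := by
          rw [e, smul_neg, neg_neg, integral_smul]
      _ = ∫ y in U, η y • y 0 • g (dil r y) := by
          rw [H.integral_eq]
          refine setIntegral_congr_fun hUm fun y hy => ?_
          simp only [absJac_dil hr0]
          rw [Set.indicator_of_mem (H.mapsTo_inv hy), Function.comp_apply, dil_inv_dil hr0.ne',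
            smul_smul, mul_inv_cancel₀ hr0.ne', one_smul, mul_smul]
  -- second application of Fubini's theorem
  have iG := integrable_dil_prod (h.right) hgm hη.2.1 hη.2.2
  obtain ⟨C', hC'⟩ := hη.2.1.exists_bound_of_continuous hη.1.continuous
  have iG' : Integrable (fun z : ℝ × Euc (n + 1) => η z.2 • z.2 0 • g (dil z.1 z.2))
      ((volume.restrict (Set.Icc 1 2)).prod (volume.restrict (tsupport η))) :=
    Integrable.bdd_smul iG C' (hη.1.continuous.comp continuous_snd).aestronglyMeasurable (Filter.Eventually.of_forall fun z => hC' _)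
  have hcut : ∀ F : Euc (n + 1) → X, ∫ y in U, η y • F y = ∫ y in tsupport η, η y • F y := by
    intro F
    refine setIntegral_eq_of_subset_of_forall_sdiff_eq_zero hUm hη.2.2 fun x hx => ?_
    rw [image_eq_zero_of_notMem_tsupport hx.2, zero_smul]
  rw [e2, e3, setIntegral_congr_fun measurableSet_Icc e4]
  simp only [hcut]
  rw [integral_integral_swap iG']
  simp only [integral_smul]

end Dilation

end

end WeightedSobolev

namespace WeightedSobolev

noncomputable section

/-! ### Hardy's inequality -/

section Hardy

variable {n : ℕ} {X : Type*} [NormedAddCommGroup X] [NormedSpace ℝ X]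

/-- The measure `y₀^σ dy` on the half-space. -/
def powerMeasure (n : ℕ) (σ : ℝ) : Measure (Euc (n + 1)) :=
  (volume.restrict (halfSpace n)).withDensity fun y => ENNReal.ofReal (y 0 ^ σ)

theorem measurable_power (σ : ℝ) : Measurable fun y : Euc (n + 1) => ENNReal.ofReal (y 0 ^ σ) := by
  fun_prop

theorem measurableSet_strip (a b : ℝ) :
    MeasurableSet {y : Euc (n + 1) | a < y 0 ∧ y 0 < b} := by
  have : Measurable fun y : Euc (n + 1) => y 0 := by fun_prop
  exact this measurableSet_Ioo

theorem lintegral_powerMeasure (σ : ℝ) (φ : Euc (n + 1) → ℝ≥0∞) :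
    ∫⁻ y, φ y ∂powerMeasure n σ = ∫⁻ y in halfSpace n, φ y * ENNReal.ofReal (y 0 ^ σ) := by
  rw [powerMeasure, lintegral_withDensity_eq_lintegral_mul_non_measurable _ (measurable_power σ)
    (Filter.Eventually.of_forall fun y => ENNReal.ofReal_lt_top)]
  simp only [Pi.mul_apply, mul_comm]

theorem lintegral_powerMeasure_dil {r σ : ℝ} (hr : 0 < r) (φ : Euc (n + 1) → ℝ≥0∞) :
    ∫⁻ y, φ (dil r y) ∂powerMeasure n σ =
      ENNReal.ofReal (r ^ (-(σ + 1))) * ∫⁻ y, φ y ∂powerMeasure n σ := by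
  rw [lintegral_powerMeasure, lintegral_powerMeasure, lintegral_dil hr]

theorem powerMeasure_absolutelyContinuous (σ : ℝ) :
    powerMeasure n σ ≪ volume.restrict (halfSpace n) := withDensity_absolutelyContinuous _ _

theorem lintegral_powerMeasure_mono {σ τ : ℝ} {φ ψ : Euc (n + 1) → ℝ≥0∞}
    (h : ∀ y ∈ halfSpace n, φ y * ENNReal.ofReal (y 0 ^ σ) ≤ ψ y * ENNReal.ofReal (y 0 ^ τ)) :
    ∫⁻ y, φ y ∂powerMeasure n σ ≤ ∫⁻ y, ψ y ∂powerMeasure n τ := by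
  rw [lintegral_powerMeasure, lintegral_powerMeasure]
  exact setLIntegral_mono' isOpen_halfSpace.measurableSet h

/-- The tested identity becomes a pointwise one by the fundamental lemma of the calculus of
variations. It takes the place of absolute continuity along lines for a vector-valued weakly
differentiable function. -/
theorem dil_sub_ae_eq [CompleteSpace X] {f g : Euc (n + 1) → X}
    (h : HasWeakDeriv (halfSpace n) (Pi.single 0 1) f g) (hgm : StronglyMeasurable g) :
    ∀ᵐ y ∂volume.restrict (halfSpace n),
      f (dil 2 y) - f y = ∫ r in Set.Icc (1 : ℝ) 2, y 0 • g (dil r y) := by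
  have l1 : LocallyIntegrableOn (fun y => f (dil 2 y) - f y) (halfSpace n) :=
    ((isSmoothDiffeo_dil two_pos).locallyIntegrableOn_comp h.left).sub h.left
  have l2 : LocallyIntegrableOn (fun y => ∫ r in Set.Icc (1 : ℝ) 2, y 0 • g (dil r y))
      (halfSpace n) := by
    rw [locallyIntegrableOn_iff isOpen_halfSpace.isLocallyClosed]
    exact fun K hK hKc => (integrable_dil_prod h.right hgm hKc hK).integral_prod_right
  have key := isOpen_halfSpace.ae_eq_zero_of_integral_contDiff_smul_eq_zero (μ := volume)
    (l1.sub l2) ?_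
  · rw [ae_restrict_iff' isOpen_halfSpace.measurableSet]
    filter_upwards [key] with x hx hxO
    simpa [sub_eq_zero] using hx hxO
  · intro η h1 h2 h3
    have hη : IsTest (halfSpace n) η := ⟨h1, h2, h3⟩
    rw [← setIntegral_eq_integral_of_forall_compl_eq_zero (s := halfSpace n)]
    · simp only [Pi.sub_apply, smul_sub (η _) (f _ - f _)]
      rw [integral_sub (hη.integrableOn_smul l1) (hη.integrableOn_smul l2),
        integral_smul_dil_sub h hgm hη, sub_self]
    · intro x hx
      rw [image_eq_zero_of_notMem_tsupport fun hh => hx (h3 hh), zero_smul]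

/-- Jensen's inequality: [1, 2] has length one. -/
theorem lintegral_rpow_le_of_Icc {G : ℝ → X} (hG : AEStronglyMeasurable G
    (volume.restrict (Set.Icc (1 : ℝ) 2))) {q : ℝ} (hq : 1 ≤ q) :
    (∫⁻ r in Set.Icc (1 : ℝ) 2, ‖G r‖ₑ) ^ q ≤ ∫⁻ r in Set.Icc (1 : ℝ) 2, ‖G r‖ₑ ^ q := by
  have : IsProbabilityMeasure (volume.restrict (Set.Icc (1 : ℝ) 2)) :=
    ⟨by simp; norm_num⟩
  have h := eLpNorm'_le_eLpNorm'_of_exponent_le one_pos hq _ hG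
  rw [eLpNorm'_eq_lintegral_enorm, eLpNorm'_eq_lintegral_enorm] at h
  simp only [ENNReal.rpow_one, one_div_one] at h
  calc _ ≤ ((∫⁻ r in Set.Icc (1 : ℝ) 2, ‖G r‖ₑ ^ q) ^ (1 / q)) ^ q :=
        ENNReal.rpow_le_rpow h (by linarith)
    _ = _ := by
        rw [← ENNReal.rpow_mul, one_div, inv_mul_cancel₀ (by linarith), ENNReal.rpow_one]

/-- The derivative term in Hardy's inequality. -/
theorem lintegral_dil_average_le {g : Euc (n + 1) → X} (hgm : StronglyMeasurable g)
    {q θ τ : ℝ} (hq : 1 ≤ q) (hθ1 : θ ≤ 1) (hσ : -1 < τ) (ε : ℝ) :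
    ∫⁻ y in {y | ε < y 0 ∧ y 0 < 1}, (∫⁻ r in Set.Icc (1 : ℝ) 2, ‖y 0 • g (dil r y)‖ₑ) ^ q
      ∂powerMeasure n (τ - θ * q) ≤ ∫⁻ y, ‖g y‖ₑ ^ q ∂powerMeasure n τ := by
  set S : Set (Euc (n + 1)) := {y | ε < y 0 ∧ y 0 < 1} with hS
  have hSm : MeasurableSet S :=
    measurableSet_strip ε 1
  have hm2 : Measurable fun z : Euc (n + 1) × ℝ => ‖g (dil z.2 z.1)‖ₑ ^ q :=
    ((hgm.comp_measurable (measurable_dil.comp measurable_swap)).enorm).pow_const q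
  calc _ ≤ ∫⁻ y, (∫⁻ r in Set.Icc (1 : ℝ) 2, ‖g (dil r y)‖ₑ ^ q) ∂powerMeasure n τ := by
        rw [← lintegral_indicator hSm]
        refine lintegral_powerMeasure_mono fun y hy => ?_
        have hy : 0 < y 0 := hy
        by_cases hyS : y ∈ S
        · rw [Set.indicator_of_mem hyS]
          have hG : StronglyMeasurable fun r : ℝ => y 0 • g (dil r y) :=
            (hgm.comp_measurable
              (measurable_dil.comp (measurable_id.prodMk measurable_const))).const_smul (y 0)
          refine (mul_le_mul_left (lintegral_rpow_le_of_Icc hG.aestronglyMeasurable hq) _).trans ?_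
          simp only [enorm_smul, ENNReal.mul_rpow_of_nonneg _ _ (zero_le_one.trans hq)]
          rw [lintegral_const_mul' _ _ (by simp [hy.ne']), mul_right_comm,
            mul_comm]
          gcongr
          have : ‖y 0‖ₑ ^ q = ENNReal.ofReal (y 0 ^ q) := by
            rw [Real.enorm_eq_ofReal hy.le, ENNReal.ofReal_rpow_of_pos hy]
          rw [this, ← ENNReal.ofReal_mul (by positivity), ← Real.rpow_add hy]
          -- The factor y₀ in the integrand raises the exponent from τ - θq to τ + (1 - θ)q ≥ τ, and
          -- y₀ < 1 on the strip. Here θ ≤ 1 is used: one derivative pays for at most one power.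
          refine ENNReal.ofReal_le_ofReal (Real.rpow_le_rpow_of_exponent_ge hy hyS.2.le ?_)
          nlinarith
        · rw [Set.indicator_of_notMem hyS, zero_mul]
          exact zero_le
    _ = ∫⁻ r in Set.Icc (1 : ℝ) 2, ∫⁻ y, ‖g (dil r y)‖ₑ ^ q ∂powerMeasure n τ := by
        have : SFinite (powerMeasure n τ) := by unfold powerMeasure; infer_instance
        exact lintegral_lintegral_swap hm2.aemeasurable
    _ ≤ ∫⁻ r in Set.Icc (1 : ℝ) 2, ∫⁻ y, ‖g y‖ₑ ^ q ∂powerMeasure n τ := by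
        refine setLIntegral_mono' measurableSet_Icc fun r hr => ?_
        have hr0 : 0 < r := lt_of_lt_of_le one_pos hr.1
        rw [lintegral_powerMeasure_dil hr0 fun y => ‖g y‖ₑ ^ q]
        calc _ ≤ 1 * ∫⁻ y, ‖g y‖ₑ ^ q ∂powerMeasure n τ := by
              gcongr
              rw [← ENNReal.ofReal_one]
              exact ENNReal.ofReal_le_ofReal
                (Real.rpow_le_one_of_one_le_of_nonpos hr.1 (by linarith))
          _ = _ := one_mul _
    _ = _ := by
        rw [setLIntegral_const]
        simp only [Real.volume_Icc]
        norm_num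

/-- The absorption step in Hardy's inequality. -/
theorem ennreal_le_of_le_mul_add {a c R : ℝ≥0∞} (ha : a ≠ ⊤) (hc : c < 1)
    (h : a ≤ c * a + R) : a ≤ (1 - c)⁻¹ * R := by
  have h1 : (1 - c) * a ≤ R := by
    rw [ENNReal.sub_mul fun _ _ => ha, one_mul]
    exact tsub_le_iff_left.2 h
  have h2 : 1 - c ≠ 0 := (tsub_pos_of_lt hc).ne'
  have h3 : 1 - c ≠ ⊤ := (tsub_le_self.trans_lt ENNReal.one_lt_top).ne
  calc a = (1 - c)⁻¹ * ((1 - c) * a) := by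
        rw [← mul_assoc, ENNReal.inv_mul_cancel h2 h3, one_mul]
    _ ≤ _ := by gcongr

/-- The constant in Hardy's inequality. -/
def hardyConst (q σ : ℝ) : ℝ≥0∞ := ENNReal.ofReal (2 ^ (-(σ + 1))) ^ (1 / q)

theorem hardyConst_lt_one {q σ : ℝ} (hq : 1 ≤ q) (hσ : -1 < σ) : hardyConst q σ < 1 := by
  refine ENNReal.rpow_lt_one ?_ (by positivity)
  rw [← ENNReal.ofReal_one]
  exact (ENNReal.ofReal_lt_ofReal_iff one_pos).2
    (Real.rpow_lt_one_of_one_lt_of_neg one_lt_two (by linarith))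

/-- By the triangle inequality f(y) is bounded by f(2y₀, ỹ) and an average of y₀ g. By scaling, the
norm of the first is c < 1 times the norm of f over the doubled strip, which is covered by the strip
itself and by {y₀ ≥ 1}; the former part is absorbed. The cut-off at ε is there to make the absorbed
quantity finite, and the constant does not depend on it. -/
theorem hardy_strip [CompleteSpace X] {f g : Euc (n + 1) → X}
    (h : HasWeakDeriv (halfSpace n) (Pi.single 0 1) f g) (hgm : StronglyMeasurable g)
    {q θ τ : ℝ} (hq : 1 ≤ q) (hθ0 : 0 ≤ θ) (hθ1 : θ ≤ 1) (hσ : -1 < τ - θ * q) {ε : ℝ}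
    (hε : 0 < ε) :
    (∫⁻ y in {y | ε < y 0 ∧ y 0 < 1}, ‖f y‖ₑ ^ q ∂powerMeasure n (τ - θ * q)) ^ (1 / q) ≤
      (1 - hardyConst q (τ - θ * q))⁻¹ * ((∫⁻ y, ‖f y‖ₑ ^ q ∂powerMeasure n τ) ^ (1 / q) +
        (∫⁻ y, ‖g y‖ₑ ^ q ∂powerMeasure n τ) ^ (1 / q)) := by
  have hq0 : 0 < q := by linarith
  have hq' : 0 ≤ 1 / q := by positivity
  set σ := τ - θ * q with hσdef
  have hστ : σ ≤ τ := by nlinarith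
  set S : Set (Euc (n + 1)) := {y | ε < y 0 ∧ y 0 < 1} with hS
  have hSm : MeasurableSet S :=
    measurableSet_strip ε 1
  set A := (∫⁻ y, ‖f y‖ₑ ^ q ∂powerMeasure n τ) ^ (1 / q) with hA
  set B := (∫⁻ y, ‖g y‖ₑ ^ q ∂powerMeasure n τ) ^ (1 / q) with hB
  have hC : (1 - hardyConst q σ)⁻¹ ≠ 0 := by
    exact ENNReal.inv_ne_zero.2 ((tsub_le_self.trans_lt ENNReal.one_lt_top).ne : 1 - hardyConst q σ ≠ ⊤)
  by_cases hAtop : A = ⊤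
  · rw [hAtop, top_add, ENNReal.mul_top hC]
    exact le_top
  set a := (∫⁻ y in S, ‖f y‖ₑ ^ q ∂powerMeasure n σ) ^ (1 / q) with ha
  -- On the strip y₀ > ε, so y₀^σ ≤ ε^(σ - τ) y₀^τ, and finiteness follows from that of A.
  have hafin : a ≠ ⊤ := by
    have hfin : ∫⁻ y, ‖f y‖ₑ ^ q ∂powerMeasure n τ ≠ ⊤ := fun hh => hAtop <| by
      rw [hA, hh, ENNReal.top_rpow_of_pos (by positivity)]
    refine ENNReal.rpow_ne_top_of_nonneg hq' (ne_top_of_le_ne_top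
      (b := ∫⁻ y, ENNReal.ofReal (ε ^ (σ - τ)) * ‖f y‖ₑ ^ q ∂powerMeasure n τ) ?_ ?_)
    · rw [lintegral_const_mul' _ _ ENNReal.ofReal_ne_top]
      exact ENNReal.mul_ne_top ENNReal.ofReal_ne_top hfin
    · rw [← lintegral_indicator hSm]
      refine lintegral_powerMeasure_mono fun y hy => ?_
      by_cases hyS : y ∈ S
      · have hy : 0 < y 0 := hy
        rw [Set.indicator_of_mem hyS, mul_right_comm, mul_comm, ← ENNReal.ofReal_mul (by positivity)]
        gcongr
        calc y 0 ^ σ = y 0 ^ (σ - τ) * y 0 ^ τ := by rw [← Real.rpow_add hy]; ring_nf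
          _ ≤ _ := by
            exact mul_le_mul_of_nonneg_right
              (Real.rpow_le_rpow_of_nonpos hε hyS.1.le (by linarith)) (by positivity)
      · rw [Set.indicator_of_notMem hyS, zero_mul]
        exact zero_le
  have hf2 : AEStronglyMeasurable (fun y => f (dil 2 y)) (volume.restrict (halfSpace n)) :=
    ((isSmoothDiffeo_dil two_pos).locallyIntegrableOn_comp h.left).aestronglyMeasurable
  have hm : Measurable fun y : Euc (n + 1) => ∫⁻ r in Set.Icc (1 : ℝ) 2, ‖y 0 • g (dil r y)‖ₑ := by
    refine Measurable.lintegral_prod_right' (f := fun z : Euc (n + 1) × ℝ =>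
      ‖z.1 0 • g (dil z.2 z.1)‖ₑ) ?_
    exact (StronglyMeasurable.smul (Measurable.stronglyMeasurable (by fun_prop))
      (hgm.comp_measurable (measurable_dil.comp measurable_swap))).enorm
  have hac : (powerMeasure n σ).restrict S ≪ volume.restrict (halfSpace n) :=
    Measure.absolutelyContinuous_of_le Measure.restrict_le_self |>.trans
      (powerMeasure_absolutelyContinuous σ)
  have step1 : a ≤ (∫⁻ y in S, ‖f (dil 2 y)‖ₑ ^ q ∂powerMeasure n σ) ^ (1 / q) +
      (∫⁻ y in S, (∫⁻ r in Set.Icc (1 : ℝ) 2, ‖y 0 • g (dil r y)‖ₑ) ^ q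
        ∂powerMeasure n σ) ^ (1 / q) := by
    refine le_trans ?_ (ENNReal.lintegral_Lp_add_le (hf2.enorm.mono_ac hac) hm.aemeasurable hq)
    refine ENNReal.rpow_le_rpow (lintegral_mono_ae ?_) hq'
    filter_upwards [hac.ae_le (dil_sub_ae_eq h hgm)] with y hy
    refine ENNReal.rpow_le_rpow ?_ hq0.le
    have : f y = f (dil 2 y) - ∫ r in Set.Icc (1 : ℝ) 2, y 0 • g (dil r y) := by rw [← hy]; abel
    rw [this]
    exact enorm_sub_le.trans (add_le_add_right (enorm_integral_le_lintegral_enorm _) _)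
  have step2 : (∫⁻ y in S, ‖f (dil 2 y)‖ₑ ^ q ∂powerMeasure n σ) ^ (1 / q) ≤
      hardyConst q σ * (a + A) := by
    set φ : Euc (n + 1) → ℝ≥0∞ := {y : Euc (n + 1) | 2 * ε < y 0 ∧ y 0 < 2}.indicator
      fun y => ‖f y‖ₑ ^ q with hφ
    have e1 : ∫⁻ y in S, ‖f (dil 2 y)‖ₑ ^ q ∂powerMeasure n σ =
        ∫⁻ y, φ (dil 2 y) ∂powerMeasure n σ := by
      rw [← lintegral_indicator hSm]
      congr 1
      funext y
      have : y ∈ S ↔ dil 2 y ∈ {y : Euc (n + 1) | 2 * ε < y 0 ∧ y 0 < 2} := by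
        simp [hS]
      by_cases hyS : y ∈ S
      · rw [Set.indicator_of_mem hyS, hφ, Set.indicator_of_mem (this.1 hyS)]
      · rw [Set.indicator_of_notMem hyS, hφ, Set.indicator_of_notMem fun hh => hyS (this.2 hh)]
    -- A point with 2ε < y₀ < 2 lies in the strip or satisfies y₀ ≥ 1; in the latter case y₀^σ ≤
    -- y₀^τ because σ ≤ τ.
    have e2 : ∫⁻ y, φ y ∂powerMeasure n σ ≤
        (∫⁻ y in S, ‖f y‖ₑ ^ q ∂powerMeasure n σ) + ∫⁻ y, ‖f y‖ₑ ^ q ∂powerMeasure n τ := by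
      have hsplit : ∀ y, φ y ≤ S.indicator (fun y => ‖f y‖ₑ ^ q) y +
          {y : Euc (n + 1) | 1 ≤ y 0}.indicator (fun y => ‖f y‖ₑ ^ q) y := by
        intro y
        by_cases hy : y ∈ {y : Euc (n + 1) | 2 * ε < y 0 ∧ y 0 < 2}
        · rw [hφ, Set.indicator_of_mem hy]
          by_cases hy1 : 1 ≤ y 0
          · rw [Set.indicator_of_mem (s := {y : Euc (n + 1) | 1 ≤ y 0}) hy1]
            exact le_add_self
          · rw [Set.indicator_of_mem (s := S) ⟨by linarith [hy.1], not_le.1 hy1⟩]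
            exact le_self_add
        · rw [hφ, Set.indicator_of_notMem hy]
          exact zero_le
      refine (lintegral_mono hsplit).trans ?_
      have hm1 : MeasurableSet {y : Euc (n + 1) | 1 ≤ y 0} :=
        measurableSet_le (by fun_prop) (by fun_prop)
      rw [lintegral_add_left' (((h.left.aestronglyMeasurable.enorm.mono_ac
        (powerMeasure_absolutelyContinuous σ)).pow_const q).indicator hSm), lintegral_indicator hSm]
      refine add_le_add_right (lintegral_powerMeasure_mono fun y hy => ?_) _
      by_cases hy1 : 1 ≤ y 0
      · rw [Set.indicator_of_mem (s := {y : Euc (n + 1) | 1 ≤ y 0}) hy1]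
        gcongr
      · rw [Set.indicator_of_notMem (s := {y : Euc (n + 1) | 1 ≤ y 0}) hy1, zero_mul]
        exact zero_le
    rw [e1, lintegral_powerMeasure_dil two_pos, ENNReal.mul_rpow_of_nonneg _ _ hq', hardyConst]
    gcongr
    refine (ENNReal.rpow_le_rpow e2 hq').trans ?_
    exact ENNReal.rpow_add_le_add_rpow _ _ hq' ((div_le_one hq0).2 hq)
  have step3 : (∫⁻ y in S, (∫⁻ r in Set.Icc (1 : ℝ) 2, ‖y 0 • g (dil r y)‖ₑ) ^ q
        ∂powerMeasure n σ) ^ (1 / q) ≤ B :=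
    ENNReal.rpow_le_rpow (lintegral_dil_average_le hgm hq hθ1 (lt_of_lt_of_le hσ hστ) ε) hq'
  refine ennreal_le_of_le_mul_add hafin (hardyConst_lt_one hq hσ) ?_
  calc a ≤ hardyConst q σ * (a + A) + B := step1.trans (add_le_add step2 step3)
    _ = hardyConst q σ * a + (hardyConst q σ * A + B) := by ring
    _ ≤ hardyConst q σ * a + (1 * A + B) := by gcongr; exact (hardyConst_lt_one hq hσ).le
    _ = _ := by rw [one_mul]

/-- Hardy's inequality on the half-space. -/
theorem hardy [CompleteSpace X] {p : ℝ≥0∞} (hp : 1 ≤ p) (hp' : p ≠ ⊤) {θ τ : ℝ} (hθ0 : 0 ≤ θ)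
    (hθ1 : θ ≤ 1) (hσ : -1 < τ - θ * p.toReal) :
    ∃ C : ℝ≥0∞, C ≠ ⊤ ∧ ∀ f g : Euc (n + 1) → X,
      HasWeakDeriv (halfSpace n) (Pi.single 0 1) f g →
      eLpNorm f p (powerMeasure n (τ - θ * p.toReal)) ≤
        C * (eLpNorm f p (powerMeasure n τ) + eLpNorm g p (powerMeasure n τ)) := by
  have hp0 : p ≠ 0 := (one_pos.trans_le hp).ne'
  have hq : 1 ≤ p.toReal := (ENNReal.ofReal_le_iff_le_toReal hp').1 (by simpa using hp)
  set q := p.toReal with hqdef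
  have hq0 : 0 < q := by linarith
  have hq' : 0 ≤ 1 / q := by positivity
  set σ := τ - θ * q with hσdef
  have hστ : σ ≤ τ := by nlinarith
  have hc : 1 - hardyConst q σ ≠ 0 := (tsub_pos_of_lt (hardyConst_lt_one hq hσ)).ne'
  refine ⟨(1 - hardyConst q σ)⁻¹ + 1, by simpa using hc, fun f g h => ?_⟩
  wlog hgm : StronglyMeasurable g with H
  · have hg := h.right.aestronglyMeasurable
    have := H hp hp' hθ0 hθ1 hp0 hq hqdef hq0 hq' hσ hσdef hστ hc f (hg.mk g)
      (h.congr Filter.EventuallyEq.rfl hg.ae_eq_mk) hg.stronglyMeasurable_mk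
    rwa [eLpNorm_congr_ae ((powerMeasure_absolutelyContinuous τ).ae_eq hg.ae_eq_mk.symm)] at this
  simp only [eLpNorm_eq_lintegral_rpow_enorm_toReal hp0 hp', ← hqdef]
  set A := (∫⁻ y, ‖f y‖ₑ ^ q ∂powerMeasure n τ) ^ (1 / q) with hA
  set B := (∫⁻ y, ‖g y‖ₑ ^ q ∂powerMeasure n τ) ^ (1 / q) with hB
  set D := (1 - hardyConst q σ)⁻¹ * (A + B) with hD
  -- The strips with ε = 1/(m + 1) increase to {0 < y₀ < 1}, and the bound is uniform in ε. On the
  -- complement the weight of exponent σ is dominated by the one of exponent τ, which accounts for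
  -- the additional 1 in the constant.
  have hnear : (∫⁻ y in {y | y 0 < 1}, ‖f y‖ₑ ^ q ∂powerMeasure n σ) ≤ D ^ q := by
    set S : ℕ → Set (Euc (n + 1)) := fun m => {y | 1 / ((m : ℝ) + 1) < y 0 ∧ y 0 < 1} with hS
    have hmono : Monotone S := by
      intro m m' hmm y hy
      refine ⟨lt_of_le_of_lt ?_ hy.1, hy.2⟩
      exact one_div_le_one_div_of_le (by positivity) (by gcongr)
    calc _ ≤ ∫⁻ y in ⋃ m, S m, ‖f y‖ₑ ^ q ∂powerMeasure n σ := by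
          have hU : {y : Euc (n + 1) | y 0 < 1} ∩ halfSpace n ⊆ ⋃ m, S m := by
            rintro y ⟨hy1, hy0⟩
            obtain ⟨m, hm⟩ := exists_nat_one_div_lt (show 0 < y 0 from hy0)
            exact Set.mem_iUnion.2 ⟨m, hm, hy1⟩
          have hae : ∀ᵐ y ∂powerMeasure n σ, y ∈ halfSpace n :=
            (powerMeasure_absolutelyContinuous σ).ae_le
              (ae_restrict_mem isOpen_halfSpace.measurableSet)
          refine lintegral_mono' (Measure.restrict_mono_ae ?_) le_rfl
          filter_upwards [hae] with y hy hy1 using hU ⟨hy1, hy⟩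
      _ = ⨆ m, ∫⁻ y in S m, ‖f y‖ₑ ^ q ∂powerMeasure n σ :=
          setLIntegral_iUnion_of_directed _ hmono.directed_le
      _ ≤ D ^ q := by
          refine iSup_le fun m => ?_
          have := hardy_strip h hgm hq hθ0 hθ1 hσ (ε := 1 / ((m : ℝ) + 1)) (by positivity)
          have h2 := ENNReal.rpow_le_rpow this hq0.le
          rwa [← ENNReal.rpow_mul, one_div_mul_cancel hq0.ne', ENNReal.rpow_one] at h2
  have hfar : (∫⁻ y in {y | y 0 < 1}ᶜ, ‖f y‖ₑ ^ q ∂powerMeasure n σ) ≤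
      ∫⁻ y, ‖f y‖ₑ ^ q ∂powerMeasure n τ := by
    have hm1 : MeasurableSet {y : Euc (n + 1) | y 0 < 1} :=
      measurableSet_lt (by fun_prop) (by fun_prop)
    rw [← lintegral_indicator hm1.compl]
    refine lintegral_powerMeasure_mono fun y hy => ?_
    by_cases hy1 : y ∈ {y : Euc (n + 1) | y 0 < 1}ᶜ
    · rw [Set.indicator_of_mem hy1]
      gcongr
      exact not_lt.1 hy1
    · rw [Set.indicator_of_notMem hy1, zero_mul]
      exact zero_le
  have hm1 : MeasurableSet {y : Euc (n + 1) | y 0 < 1} :=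
    measurableSet_lt (by fun_prop) (by fun_prop)
  rw [← lintegral_add_compl _ hm1]
  calc _ ≤ (D ^ q + ∫⁻ y, ‖f y‖ₑ ^ q ∂powerMeasure n τ) ^ (1 / q) :=
        ENNReal.rpow_le_rpow (add_le_add hnear hfar) hq'
    _ ≤ (D ^ q) ^ (1 / q) + A :=
        ENNReal.rpow_add_le_add_rpow _ _ hq' ((div_le_one hq0).2 hq)
    _ = D + A := by rw [← ENNReal.rpow_mul, mul_one_div_cancel hq0.ne', ENNReal.rpow_one]
    _ ≤ D + (A + B) := by gcongr; exact le_self_add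
    _ = _ := by rw [hD]; ring

end Hardy

end

end WeightedSobolev

namespace WeightedSobolev

noncomputable section

/-! ### Coefficients with controlled blow-up at the boundary -/

section Symbol

variable {n : ℕ} {s : ℝ}

/-- `a` is smooth on the half-space and its derivatives of order `r ≤ N` are bounded by a multiple
of `min(y₀, 1) ^ -(m + r - s)₊`. -/
def IsSymbol (s : ℝ) : ℕ → ℕ → (Euc (n + 1) → ℝ) → Prop
  | 0, m, a => ContDiffOn ℝ ∞ a (halfSpace n) ∧
      ∃ C, ∀ y ∈ halfSpace n, |a y| ≤ C * min (y 0) 1 ^ (-max (m - s) 0)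
  | N + 1, m, a => (ContDiffOn ℝ ∞ a (halfSpace n) ∧
      ∃ C, ∀ y ∈ halfSpace n, |a y| ≤ C * min (y 0) 1 ^ (-max (m - s) 0)) ∧
        ∀ j, IsSymbol s N (m + 1) (partialD j a)

theorem IsSymbol.base {N m : ℕ} {a : Euc (n + 1) → ℝ} (h : IsSymbol s N m a) :
    ContDiffOn ℝ ∞ a (halfSpace n) ∧
      ∃ C, ∀ y ∈ halfSpace n, |a y| ≤ C * min (y 0) 1 ^ (-max (m - s) 0) := by
  cases N with
  | zero => exact h
  | succ N => exact h.1

theorem IsSymbol.of_succ {N m : ℕ} {a : Euc (n + 1) → ℝ} (h : IsSymbol s (N + 1) m a) :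
    IsSymbol s N m a := by
  induction N generalizing m a with
  | zero => exact h.1
  | succ N ih => exact ⟨h.1, fun j => ih (h.2 j)⟩

theorem min_pos_of_mem {y : Euc (n + 1)} (hy : y ∈ halfSpace n) : 0 < min (y 0) 1 :=
  lt_min hy one_pos

theorem min_rpow_le {y : Euc (n + 1)} (hy : y ∈ halfSpace n) {u v : ℝ} (h : u ≤ v) :
    min (y 0) 1 ^ (-u) ≤ min (y 0) 1 ^ (-v) :=
  Real.rpow_le_rpow_of_exponent_ge (min_pos_of_mem hy) (min_le_right _ _) (neg_le_neg h)

theorem one_le_min_rpow {y : Euc (n + 1)} (hy : y ∈ halfSpace n) (u : ℝ) :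
    1 ≤ min (y 0) 1 ^ (-max u 0) := by
  simpa using min_rpow_le hy (le_max_right u 0)

theorem IsSymbol.congr {N m : ℕ} {a b : Euc (n + 1) → ℝ} (h : IsSymbol s N m a)
    (hab : Set.EqOn a b (halfSpace n)) : IsSymbol s N m b := by
  have key : ∀ {m : ℕ} {a b : Euc (n + 1) → ℝ}, (ContDiffOn ℝ ∞ a (halfSpace n) ∧
      ∃ C, ∀ y ∈ halfSpace n, |a y| ≤ C * min (y 0) 1 ^ (-max (m - s) 0)) →
      Set.EqOn a b (halfSpace n) → (ContDiffOn ℝ ∞ b (halfSpace n) ∧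
      ∃ C, ∀ y ∈ halfSpace n, |b y| ≤ C * min (y 0) 1 ^ (-max (m - s) 0)) := by
    rintro m a b ⟨h1, C, hC⟩ hab
    exact ⟨h1.congr fun y hy => (hab hy).symm, C, fun y hy => by rw [← hab hy]; exact hC y hy⟩
  induction N generalizing m a b with
  | zero => exact key h hab
  | succ N ih =>
    exact ⟨key h.1 hab, fun j => ih (h.2 j) (partialD_congr isOpen_halfSpace hab j)⟩

theorem differentiableAt_of_contDiffOn {F : Type*} [NormedAddCommGroup F] [NormedSpace ℝ F]
    {O : Set (Euc n)} (hO : IsOpen O) {a : Euc n → F}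
    (h : ContDiffOn ℝ ∞ a O) {y : Euc n} (hy : y ∈ O) : DifferentiableAt ℝ a y :=
  (h.contDiffAt (hO.mem_nhds hy)).differentiableAt (by simp)

theorem IsSymbol.add {N m : ℕ} {a b : Euc (n + 1) → ℝ} (ha : IsSymbol s N m a)
    (hb : IsSymbol s N m b) : IsSymbol s N m fun y => a y + b y := by
  have key : ∀ {m : ℕ} {a b : Euc (n + 1) → ℝ}, (ContDiffOn ℝ ∞ a (halfSpace n) ∧
      ∃ C, ∀ y ∈ halfSpace n, |a y| ≤ C * min (y 0) 1 ^ (-max (m - s) 0)) →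
      (ContDiffOn ℝ ∞ b (halfSpace n) ∧
      ∃ C, ∀ y ∈ halfSpace n, |b y| ≤ C * min (y 0) 1 ^ (-max (m - s) 0)) →
      (ContDiffOn ℝ ∞ (fun y => a y + b y) (halfSpace n) ∧
      ∃ C, ∀ y ∈ halfSpace n, |a y + b y| ≤ C * min (y 0) 1 ^ (-max (m - s) 0)) := by
    rintro m a b ⟨h1, C, hC⟩ ⟨h2, D, hD⟩
    refine ⟨h1.add h2, C + D, fun y hy => ?_⟩
    rw [add_mul]
    exact (abs_add_le _ _).trans (add_le_add (hC y hy) (hD y hy))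
  induction N generalizing m a b with
  | zero => exact key ha hb
  | succ N ih =>
    refine ⟨key ha.1 hb.1, fun j => (ih (ha.2 j) (hb.2 j)).congr fun y hy => ?_⟩
    exact (partialD_add (differentiableAt_of_contDiffOn isOpen_halfSpace ha.1.1 hy)
      (differentiableAt_of_contDiffOn isOpen_halfSpace hb.1.1 hy) j).symm

theorem isSymbol_const (N m : ℕ) (c : ℝ) : IsSymbol s N m fun _ : Euc (n + 1) => c := by
  have key : ∀ (m : ℕ) (c : ℝ), (ContDiffOn ℝ ∞ (fun _ : Euc (n + 1) => c) (halfSpace n) ∧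
      ∃ C, ∀ y ∈ halfSpace n, |c| ≤ C * min (y 0) 1 ^ (-max (m - s) 0)) := fun m c =>
    ⟨contDiffOn_const, |c|, fun y hy => le_mul_of_one_le_right (abs_nonneg c) (one_le_min_rpow hy _)⟩
  induction N generalizing m c with
  | zero => exact key m c
  | succ N ih =>
    refine ⟨key m c, fun j => (ih (m + 1) 0).congr fun y _ => ?_⟩
    simp [partialD]

theorem IsSymbol.sum {ι : Type*} {N m : ℕ} (t : Finset ι) {a : ι → Euc (n + 1) → ℝ}
    (ha : ∀ i ∈ t, IsSymbol s N m (a i)) : IsSymbol s N m fun y => ∑ i ∈ t, a i y := by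
  classical
  induction t using Finset.induction_on with
  | empty => simpa using isSymbol_const N m 0
  | insert i t hi ih =>
    simp only [Finset.sum_insert hi]
    exact (ha i (Finset.mem_insert_self _ _)).add
      (ih fun j hj => ha j (Finset.mem_insert_of_mem hj))

/-- Orders are counted from one because the basic symbols are first derivatives of m. With a, b ≥ 0
and s ≥ 1, (a + 1 - s)₊ + (b + 1 - s)₊ ≤ (a + b + 1 - s)₊, so the exponents of a product add up
without loss. The Leibniz rule preserves this form. -/
theorem IsSymbol.mul (hs : 1 ≤ s) {N m m' : ℕ} {a b : Euc (n + 1) → ℝ}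
    (ha : IsSymbol s N (m + 1) a) (hb : IsSymbol s N (m' + 1) b) :
    IsSymbol s N (m + m' + 1) fun y => a y * b y := by
  have key : ∀ {m m' : ℕ} {a b : Euc (n + 1) → ℝ}, (ContDiffOn ℝ ∞ a (halfSpace n) ∧
      ∃ C, ∀ y ∈ halfSpace n, |a y| ≤ C * min (y 0) 1 ^ (-max ((m + 1 : ℕ) - s) 0)) →
      (ContDiffOn ℝ ∞ b (halfSpace n) ∧
      ∃ C, ∀ y ∈ halfSpace n, |b y| ≤ C * min (y 0) 1 ^ (-max ((m' + 1 : ℕ) - s) 0)) →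
      (ContDiffOn ℝ ∞ (fun y => a y * b y) (halfSpace n) ∧
      ∃ C, ∀ y ∈ halfSpace n,
        |a y * b y| ≤ C * min (y 0) 1 ^ (-max ((m + m' + 1 : ℕ) - s) 0)) := by
    rintro m m' a b ⟨h1, C, hC⟩ ⟨h2, D, hD⟩
    refine ⟨h1.mul h2, |C| * |D|, fun y hy => ?_⟩
    have hpos := min_pos_of_mem hy
    have hle : max (((m + 1 : ℕ) : ℝ) - s) 0 + max (((m' + 1 : ℕ) : ℝ) - s) 0 ≤
        max (((m + m' + 1 : ℕ) : ℝ) - s) 0 := by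
      have hm : (0 : ℝ) ≤ m := m.cast_nonneg
      have hm' : (0 : ℝ) ≤ m' := m'.cast_nonneg
      push_cast
      rcases max_cases ((m : ℝ) + 1 - s) 0 with h | h <;>
        rcases max_cases ((m' : ℝ) + 1 - s) 0 with h' | h' <;>
        rcases max_cases ((m : ℝ) + m' + 1 - s) 0 with h'' | h'' <;> linarith
    have e1 : |a y| ≤ |C| * min (y 0) 1 ^ (-max (((m + 1 : ℕ) : ℝ) - s) 0) :=
      (hC y hy).trans (mul_le_mul_of_nonneg_right (le_abs_self C) (by positivity))
    have e2 : |b y| ≤ |D| * min (y 0) 1 ^ (-max (((m' + 1 : ℕ) : ℝ) - s) 0) :=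
      (hD y hy).trans (mul_le_mul_of_nonneg_right (le_abs_self D) (by positivity))
    rw [abs_mul]
    calc |a y| * |b y| ≤ (|C| * min (y 0) 1 ^ (-max (((m + 1 : ℕ) : ℝ) - s) 0)) *
          (|D| * min (y 0) 1 ^ (-max (((m' + 1 : ℕ) : ℝ) - s) 0)) :=
          mul_le_mul e1 e2 (abs_nonneg _) (by positivity)
      _ = |C| * |D| * min (y 0) 1 ^ (-(max (((m + 1 : ℕ) : ℝ) - s) 0 +
          max (((m' + 1 : ℕ) : ℝ) - s) 0)) := by
          rw [neg_add, Real.rpow_add hpos]; ring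
      _ ≤ _ := mul_le_mul_of_nonneg_left (min_rpow_le hy hle) (by positivity)
  induction N generalizing m m' a b with
  | zero => exact key ha hb
  | succ N ih =>
    refine ⟨key ha.1 hb.1, fun j => ?_⟩
    have h1 := ih (ha.2 j) hb.of_succ
    have h2 := ih ha.of_succ (hb.2 j)
    rw [show m + 1 + m' + 1 = m + m' + 1 + 1 by ring] at h1
    rw [show m + (m' + 1) + 1 = m + m' + 1 + 1 by ring] at h2
    refine (h1.add h2).congr fun y hy => ?_
    have := partialD_smul (i := j) (differentiableAt_of_contDiffOn isOpen_halfSpace ha.1.1 hy)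
      (differentiableAt_of_contDiffOn isOpen_halfSpace hb.1.1 hy)
    simpa using this.symm

/-- By induction on the number of derivatives from ∂(1/a) = -∂a · (1/a)²: multiplication by symbols
of order one does not change the order. -/
theorem IsSymbol.inv (hs : 1 ≤ s) {N : ℕ} {a : Euc (n + 1) → ℝ} (ha : IsSymbol s N 1 a) {c : ℝ}
    (hc : 0 < c) (hac : ∀ y ∈ halfSpace n, c ≤ |a y|) : IsSymbol s N 1 fun y => (a y)⁻¹ := by
  have hne : ∀ y ∈ halfSpace n, a y ≠ 0 := fun y hy => abs_pos.1 (hc.trans_le (hac y hy))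
  have key : ContDiffOn ℝ ∞ (fun y => (a y)⁻¹) (halfSpace n) ∧
      ∃ C, ∀ y ∈ halfSpace n, |(a y)⁻¹| ≤ C * min (y 0) 1 ^ (-max ((1 : ℕ) - s) 0) := by
    refine ⟨ha.base.1.inv hne, c⁻¹, fun y hy => ?_⟩
    rw [abs_inv]
    exact (inv_anti₀ hc (hac y hy)).trans
      (le_mul_of_one_le_right (inv_nonneg.2 hc.le) (one_le_min_rpow hy _))
  induction N with
  | zero => exact key
  | succ N ih =>
    refine ⟨key, fun j => ?_⟩
    have h1 := ih ha.of_succ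
    have h2 := ((ha.2 j).mul (m' := 0) hs h1).mul (m' := 0) hs h1
    have h3 := (isSymbol_const (n := n) (s := s) N 1 (-1)).mul (m := 0) hs h2
    rw [show 0 + (1 + 0 + 0) + 1 = 1 + 1 from rfl] at h3
    refine h3.congr fun y hy => ?_
    have hd := differentiableAt_of_contDiffOn isOpen_halfSpace ha.1.1 hy
    have := ((hasDerivAt_inv (hne y hy)).comp_hasFDerivAt y hd.hasFDerivAt).fderiv
    simp only [partialD]
    change _ = fderiv ℝ (Inv.inv ∘ a) y _
    rw [this]
    simp
    field_simp

end Symbol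

/-! ### Linear combinations of derivatives -/

section Comb

variable {n : ℕ} {X : Type*} [NormedAddCommGroup X] [NormedSpace ℝ X]

/-- A symbol of order `m`, with bounds for all its derivatives. -/
def IsSmoothSymbol (s : ℝ) (m : ℕ) (a : Euc (n + 1) → ℝ) : Prop := ∀ N, IsSymbol s N m a

theorem IsSmoothSymbol.partialD {s : ℝ} {m : ℕ} {a : Euc (n + 1) → ℝ} (h : IsSmoothSymbol s m a)
    (j : Fin (n + 1)) : IsSmoothSymbol s (m + 1) (partialD j a) := fun N => (h (N + 1)).2 j

/-- `F` consists of functions on the half-space with `∂_j F_b = ∑_i A_{ji} F_{b + e_i}` in the weak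
sense. -/
structure IsFrameFamily (A : Fin (n + 1) → Fin (n + 1) → Euc (n + 1) → ℝ) (k : ℕ)
    (F : (Fin (n + 1) → ℕ) → Euc (n + 1) → X) : Prop where
  locallyIntegrableOn : ∀ b, ∑ i, b i ≤ k → LocallyIntegrableOn (F b) (halfSpace n)
  hasWeakDeriv : ∀ b, ∑ i, b i < k → ∀ j, HasWeakDeriv (halfSpace n) (Pi.single j 1) (F b)
    (fun y => ∑ i, A j i y • F (b + Pi.single i 1) y)

/-- The linear combinations of the functions `F_b`, `1 ≤ |b| ≤ m`, which occur in the derivatives of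
order `m` of a transformed function. -/
inductive IsComb (X : Type*) [NormedAddCommGroup X] [NormedSpace ℝ X] (s : ℝ) (m : ℕ) :
    (((Fin (n + 1) → ℕ) → Euc (n + 1) → X) → Euc (n + 1) → X) → Prop
  | term (e : ℕ) (b : Fin (n + 1) → ℕ) (c : Euc (n + 1) → ℝ) (h1 : 1 ≤ ∑ i, b i)
      (h2 : ∑ i, b i + e = m) (hc : IsSmoothSymbol s (e + 1) c) : IsComb X s m fun F y => c y • F b y
  | zero : IsComb X s m fun _ _ => 0
  | add (P Q : ((Fin (n + 1) → ℕ) → Euc (n + 1) → X) → Euc (n + 1) → X)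
      (hP : IsComb X s m P) (hQ : IsComb X s m Q) : IsComb X s m fun F y => P F y + Q F y

variable {s : ℝ} {A : Fin (n + 1) → Fin (n + 1) → Euc (n + 1) → ℝ}

/-- Symbols of order one are bounded since s ≥ 1 and act as multipliers; these are the coefficients
that a single use of the chain rule produces. -/
theorem IsComb.smul (hs : 1 ≤ s) {m : ℕ}
    {P : ((Fin (n + 1) → ℕ) → Euc (n + 1) → X) → Euc (n + 1) → X} (hP : IsComb X s m P)
    {a : Euc (n + 1) → ℝ} (ha : IsSmoothSymbol s 1 a) :
    IsComb X s m fun F y => a y • P F y := by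
  induction hP with
  | term e b c h1 h2 hc =>
    simp only [smul_smul]
    refine .term e b (fun y => a y * c y) h1 h2 fun N => ?_
    simpa using (ha N).mul (m := 0) hs (hc N)
  | zero => simpa using IsComb.zero
  | add P Q _ _ hP hQ =>
    simp only [smul_add]
    exact .add _ _ hP hQ

theorem IsComb.sum {ι : Type*} {m : ℕ} (t : Finset ι)
    {P : ι → ((Fin (n + 1) → ℕ) → Euc (n + 1) → X) → Euc (n + 1) → X}
    (hP : ∀ i ∈ t, IsComb X s m (P i)) : IsComb X s m fun F y => ∑ i ∈ t, P i F y := by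
  classical
  induction t using Finset.induction_on with
  | empty => simpa using IsComb.zero
  | insert i t hi ih =>
    simp only [Finset.sum_insert hi]
    exact .add _ _ (hP i (Finset.mem_insert_self _ _))
      (ih fun j hj => hP j (Finset.mem_insert_of_mem hj))

theorem sum_add_single (b : Fin (n + 1) → ℕ) (i : Fin (n + 1)) :
    ∑ j, (b + Pi.single i 1 : Fin (n + 1) → ℕ) j = ∑ j, b j + 1 := by
  simp [Finset.sum_add_distrib]

/-- A derivative falls either on the coefficient, raising e, or on F_b, raising |b| and multiplying
by entries of A of order one. In both cases |b| + e grows by one. The new combination is chosen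
before the family F, so that later constants do not depend on F. -/
theorem IsComb.exists_deriv (hs : 1 ≤ s) (hA : ∀ j i, IsSmoothSymbol s 1 (A j i)) {m : ℕ}
    {P : ((Fin (n + 1) → ℕ) → Euc (n + 1) → X) → Euc (n + 1) → X} (hP : IsComb X s m P)
    (j : Fin (n + 1)) : ∃ P', IsComb X s (m + 1) P' ∧ ∀ k F, m < k → IsFrameFamily A k F →
      HasWeakDeriv (halfSpace n) (Pi.single j 1) (P F) (P' F) := by
  induction hP with
  | term e b c h1 h2 hc =>
    refine ⟨fun F y => partialD j c y • F b y + c y • ∑ i, A j i y • F (b + Pi.single i 1) y,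
      ?_, ?_⟩
    · refine .add _ _ (.term (e + 1) b _ h1 (by omega) (hc.partialD j)) ?_
      simp only [Finset.smul_sum, smul_smul]
      refine IsComb.sum _ fun i _ => ?_
      refine .term e (b + Pi.single i 1) (fun y => c y * A j i y) ?_ ?_ fun N => ?_
      · rw [sum_add_single]; omega
      · rw [sum_add_single]; omega
      · exact (hc N).mul (m' := 0) hs (hA j i N)
    · intro k F hk hF
      exact (hF.hasWeakDeriv b (by omega) j).smul_contDiffOn isOpen_halfSpace (hc 0).1
  | zero => exact ⟨_, .zero, fun k F _ _ => HasWeakDeriv.zero _ _⟩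
  | add P Q _ _ hP hQ =>
    obtain ⟨P', hP1, hP2⟩ := hP
    obtain ⟨Q', hQ1, hQ2⟩ := hQ
    exact ⟨_, .add _ _ hP1 hQ1, fun k F hk hF => (hP2 k F hk hF).add (hQ2 k F hk hF)⟩

theorem hasWeakDeriv_zero_self {d : ℕ} {O : Set (Euc d)} {f : Euc d → X}
    (hf : LocallyIntegrableOn f O) : HasWeakDeriv O 0 f f :=
  ⟨hf, hf, fun η _ _ _ => by simp [multiD_zero]⟩

/-- The derivatives of a transformed function are linear combinations of those of the original
one. -/
theorem exists_comb (hs : 1 ≤ s) (hA : ∀ j i, IsSmoothSymbol s 1 (A j i))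
    {B : Fin (n + 1) → Fin (n + 1) → Euc (n + 1) → ℝ} (hB : ∀ i j, IsSmoothSymbol s 1 (B i j))
    {V : Set (Euc (n + 1))} {χ : Euc (n + 1) → Euc (n + 1)}
    (hloc : ∀ g : Euc (n + 1) → X, LocallyIntegrableOn g (halfSpace n) →
      LocallyIntegrableOn (g ∘ χ) V)
    (hχ : ∀ (g : Euc (n + 1) → X) (g' : Fin (n + 1) → Euc (n + 1) → X),
      (∀ j, HasWeakDeriv (halfSpace n) (Pi.single j 1) g (g' j)) →
        ∀ i, HasWeakDeriv V (Pi.single i 1) (g ∘ χ) ((fun y => ∑ j, B i j y • g' j y) ∘ χ))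
    (a : Fin (n + 1) → ℕ) :
    ∃ P : ((Fin (n + 1) → ℕ) → Euc (n + 1) → X) → Euc (n + 1) → X,
      ((a = 0 ∧ P = fun F => F 0) ∨ IsComb X s (∑ i, a i) P) ∧
      ∀ k F, ∑ i, a i ≤ k → IsFrameFamily A k F → HasWeakDeriv V a (F 0 ∘ χ) (P F ∘ χ) := by
  obtain ⟨m, hm⟩ : ∃ m, ∑ i, a i = m := ⟨_, rfl⟩
  induction m generalizing a with
  | zero =>
    have ha : a = 0 := by
      funext i
      exact (Finset.sum_eq_zero_iff.1 hm) i (Finset.mem_univ i)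
    subst ha
    exact ⟨_, .inl ⟨rfl, rfl⟩, fun k F hk hF =>
      hasWeakDeriv_zero_self (hloc _ (hF.locallyIntegrableOn 0 hk))⟩
  | succ m ih =>
    obtain ⟨i, hi⟩ : ∃ i, a i ≠ 0 := by
      by_contra hcon
      push Not at hcon
      rw [Finset.sum_eq_zero fun i _ => hcon i] at hm
      omega
    obtain ⟨a', rfl⟩ : ∃ a' : Fin (n + 1) → ℕ, a = a' + Pi.single i 1 := by
      refine ⟨a - Pi.single i 1, funext fun j => ?_⟩
      by_cases hj : j = i
      · subst hj; simp; omega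
      · simp [hj]
    rw [sum_add_single] at hm
    have hm : ∑ i, a' i = m := by omega
    obtain ⟨P, hP1, hP2⟩ := ih a' hm
    have hderiv : ∀ j, ∃ P', IsComb X s (m + 1) P' ∧ ∀ k F, m < k → IsFrameFamily A k F →
        HasWeakDeriv (halfSpace n) (Pi.single j 1) (P F) (P' F) := by
      intro j
      -- The undifferentiated function is not a combination in the sense of `IsComb`, since |b| ≥ 1
      -- is required there. The first derivative produces terms with |b| = 1 and e = 0, and from
      -- then on |b| never decreases.
      rcases hP1 with ⟨ha', hP⟩ | hP
      · subst ha' hP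
        have hm0 : m = 0 := by simpa using hm.symm
        subst hm0
        refine ⟨fun F y => ∑ i, A j i y • F (0 + Pi.single i 1) y, ?_, fun k F hk hF =>
          hF.hasWeakDeriv 0 (by simpa using hk) j⟩
        refine IsComb.sum _ fun i _ => .term 0 _ _ ?_ ?_ (hA j i)
        · rw [sum_add_single]; omega
        · rw [sum_add_single]; simp
      · rw [hm] at hP
        exact hP.exists_deriv hs hA j
    choose P' hP'1 hP'2 using hderiv
    refine ⟨fun F y => ∑ j, B i j y • P' j F y, .inr ?_, fun k F hk hF => ?_⟩
    · rw [sum_add_single, hm]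
      exact IsComb.sum _ fun j _ => (hP'1 j).smul hs (hB i j)
    · rw [sum_add_single, hm] at hk
      exact (hP2 k F (by omega) hF).step
        (hχ (P F) (fun j => P' j F) (fun j => hP'2 j k F (by omega) hF) i)

end Comb

end

end WeightedSobolev

namespace WeightedSobolev

noncomputable section

/-! ### Bounds in weighted spaces -/

section Bounds

variable {n : ℕ} {X : Type*} [NormedAddCommGroup X] [NormedSpace ℝ X]

/-- The multi-index `b` as an element of `MIdx d k`. -/
def MIdx.ofFun {d k : ℕ} (b : Fin d → ℕ) (h : ∑ i, b i ≤ k) : MIdx d k :=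
  ⟨fun i => ⟨b i, Nat.lt_succ_of_le
    ((Finset.single_le_sum (fun _ _ => Nat.zero_le _) (Finset.mem_univ i)).trans h)⟩, h⟩

@[simp] theorem MIdx.val_ofFun {d k : ℕ} (b : Fin d → ℕ) (h : ∑ i, b i ≤ k) :
    (MIdx.ofFun b h).val = b := rfl

theorem MIdx.sum_val_le {d k : ℕ} (α : MIdx d k) : ∑ i, α.val i ≤ k := α.2

theorem ennreal_le_sum_univ {ι : Type*} [Fintype ι] (f : ι → ℝ≥0∞) (i : ι) : f i ≤ ∑ i, f i :=
  Finset.single_le_sum (fun _ _ => zero_le) (Finset.mem_univ i)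

/-- The sum of the norms of the members of a family. -/
def famNorm (p : ℝ≥0∞) (γ : ℝ) (k : ℕ) (F : (Fin (n + 1) → ℕ) → Euc (n + 1) → X) : ℝ≥0∞ :=
  ∑ b : MIdx (n + 1) k, eLpNorm (F b.val) p (powerMeasure n γ)

theorem eLpNorm_le_famNorm {p : ℝ≥0∞} {γ : ℝ} {k : ℕ}
    {F : (Fin (n + 1) → ℕ) → Euc (n + 1) → X} {b : Fin (n + 1) → ℕ} (hb : ∑ i, b i ≤ k) :
    eLpNorm (F b) p (powerMeasure n γ) ≤ famNorm p γ k F :=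
  ennreal_le_sum_univ (fun b : MIdx (n + 1) k => eLpNorm (F b.val) p (powerMeasure n γ))
    (MIdx.ofFun b hb)

variable {s : ℝ} {A : Fin (n + 1) → Fin (n + 1) → Euc (n + 1) → ℝ}

theorem ae_mem_powerMeasure (γ : ℝ) : ∀ᵐ y ∂powerMeasure n γ, y ∈ halfSpace n :=
  (powerMeasure_absolutelyContinuous γ).ae_le (ae_restrict_mem isOpen_halfSpace.measurableSet)

theorem IsSmoothSymbol.exists_bound (hs : 1 ≤ s) {a : Euc (n + 1) → ℝ}
    (ha : IsSmoothSymbol s 1 a) : ∃ C : ℝ≥0, ∀ y ∈ halfSpace n, ‖a y‖ ≤ C := by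
  obtain ⟨_, C, hC⟩ := (ha 0).base
  refine ⟨C.toNNReal, fun y hy => (hC y hy).trans ?_⟩
  rw [max_eq_right (by push_cast; linarith), neg_zero, Real.rpow_zero, mul_one]
  exact Real.le_coe_toNNReal C

/-- Iterated Hardy inequality. -/
theorem IsFrameFamily.exists_eLpNorm_le [CompleteSpace X] {p : ℝ≥0∞} (hp : 1 ≤ p) (hp' : p ≠ ⊤)
    (hs : 1 ≤ s) (hA : ∀ j i, IsSmoothSymbol s 1 (A j i)) {γ E : ℝ} (hE : 0 ≤ E) {e k : ℕ}
    (hEe : E ≤ e) (hγ : -1 < γ - E * p.toReal) :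
    ∃ C : ℝ≥0∞, C ≠ ⊤ ∧ ∀ F : (Fin (n + 1) → ℕ) → Euc (n + 1) → X, IsFrameFamily A k F →
      ∀ b, ∑ i, b i + e ≤ k →
        eLpNorm (F b) p (powerMeasure n (γ - E * p.toReal)) ≤ C * famNorm p γ k F := by
  have hq : 0 ≤ p.toReal := ENNReal.toReal_nonneg
  rcases Nat.eq_zero_or_pos e with rfl | he
  · have hE0 : E = 0 := le_antisymm (by simpa using hEe) hE
    subst hE0
    refine ⟨1, ENNReal.one_ne_top, fun F _ b hb => ?_⟩
    simpa using eLpNorm_le_famNorm (by simpa using hb)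
  have he' : (0 : ℝ) < e := by exact_mod_cast he
  -- The gain E is distributed over e equal Hardy steps with θ ≤ 1. Each step spends one derivative,
  -- since ∂₀F_b is a bounded combination of the F_{b + e_i}, and all intermediate weight exponents
  -- stay at or above γ - Ep > -1.
  set θ : ℝ := E / e with hθ
  have hθ0 : 0 ≤ θ := by positivity
  have hθ1 : θ ≤ 1 := (div_le_one he').2 hEe
  choose CA hCA using fun j i => (hA j i).exists_bound hs
  suffices H : ∀ j : ℕ, j ≤ e → ∃ C : ℝ≥0∞, C ≠ ⊤ ∧
      ∀ F : (Fin (n + 1) → ℕ) → Euc (n + 1) → X, IsFrameFamily A k F →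
        ∀ b, ∑ i, b i + j ≤ k →
          eLpNorm (F b) p (powerMeasure n (γ - j * θ * p.toReal)) ≤ C * famNorm p γ k F by
    have := H e le_rfl
    rwa [show (e : ℝ) * θ = E by rw [hθ]; field_simp] at this
  intro j
  induction j with
  | zero =>
    intro _
    refine ⟨1, ENNReal.one_ne_top, fun F _ b hb => ?_⟩
    simpa using eLpNorm_le_famNorm (by simpa using hb)
  | succ j ih =>
    intro hj
    obtain ⟨C, hC, hF⟩ := ih (by omega)
    have hτ : γ - ((j + 1 : ℕ) : ℝ) * θ * p.toReal = (γ - j * θ * p.toReal) - θ * p.toReal := by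
      push_cast; ring
    have hjE : ((j + 1 : ℕ) : ℝ) * θ ≤ E := by
      calc ((j + 1 : ℕ) : ℝ) * θ ≤ e * θ := by gcongr
        _ = E := by rw [hθ]; field_simp
    have hlt : -1 < (γ - j * θ * p.toReal) - θ * p.toReal := by
      rw [← hτ]
      have := mul_le_mul_of_nonneg_right hjE hq
      linarith
    obtain ⟨D, hD, hhardy⟩ := hardy (n := n) (X := X) hp hp' hθ0 hθ1 hlt
    refine ⟨D * (C + ∑ i, (CA 0 i : ℝ≥0∞) * C), ?_, fun F hFF b hb => ?_⟩
    · refine ENNReal.mul_ne_top hD (ENNReal.add_ne_top.2 ⟨hC, ?_⟩)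
      exact ENNReal.sum_ne_top.2 fun i _ => ENNReal.mul_ne_top ENNReal.coe_ne_top hC
    rw [hτ]
    refine (hhardy _ _ (hFF.hasWeakDeriv b (by omega) 0)).trans ?_
    rw [mul_assoc D]
    gcongr
    rw [add_mul, Finset.sum_mul]
    refine add_le_add (hF F hFF b (by omega)) ?_
    have hloc : ∀ i, LocallyIntegrableOn (fun y => A 0 i y • F (b + Pi.single i 1) y)
        (halfSpace n) := fun i =>
      LocallyIntegrableOn.continuousOn_smul_open isOpen_halfSpace
        (hFF.locallyIntegrableOn _ (by rw [sum_add_single]; omega)) ((hA 0 i) 0).1.continuousOn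
    have hb' : ∀ i, ∑ l, (b + Pi.single i 1 : Fin (n + 1) → ℕ) l + j ≤ k := fun i => by
      rw [sum_add_single]; omega
    have hsum : (fun y => ∑ i, A 0 i y • F (b + Pi.single i 1) y) =
        ∑ i, fun y => A 0 i y • F (b + Pi.single i 1) y := by
      funext y; simp
    rw [hsum]
    refine (eLpNorm_sum_le (fun i _ => (hloc i).aestronglyMeasurable.mono_ac
      (powerMeasure_absolutelyContinuous _)) hp).trans (Finset.sum_le_sum fun i _ => ?_)
    rw [mul_assoc (CA 0 i : ℝ≥0∞)]
    refine (eLpNorm_le_nnreal_smul_eLpNorm_of_ae_le_mul (c := CA 0 i)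
      (g := F (b + Pi.single i 1)) ?_ p).trans ?_
    · filter_upwards [ae_mem_powerMeasure _] with y hy
      rw [nnnorm_smul]
      gcongr
      exact hCA 0 i y hy
    · rw [ENNReal.smul_def, smul_eq_mul]
      exact mul_le_mul_right (hF F hFF _ (hb' i)) _

/-- Multiplication by a symbol costs powers of the distance to the boundary. -/
theorem eLpNorm_symbol_smul_le {p : ℝ≥0∞} (hp : 1 ≤ p) (hp' : p ≠ ⊤) {γ E C : ℝ}
    {c : Euc (n + 1) → ℝ} (hc : ∀ y ∈ halfSpace n, |c y| ≤ C * min (y 0) 1 ^ (-E))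
    {f : Euc (n + 1) → X} (hf : AEStronglyMeasurable f (volume.restrict (halfSpace n))) :
    eLpNorm (fun y => c y • f y) p (powerMeasure n γ) ≤ ENNReal.ofReal C *
      (eLpNorm f p (powerMeasure n (γ - E * p.toReal)) + eLpNorm f p (powerMeasure n γ)) := by
  have hp0 : p ≠ 0 := (one_pos.trans_le hp).ne'
  have hq : 1 ≤ p.toReal := (ENNReal.ofReal_le_iff_le_toReal hp').1 (by simpa using hp)
  simp only [eLpNorm_eq_lintegral_rpow_enorm_toReal hp0 hp']
  set q := p.toReal with hqdef
  have hq0 : 0 < q := by linarith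
  have hq' : 0 ≤ 1 / q := by positivity
  have key : ∫⁻ y, ‖c y • f y‖ₑ ^ q ∂powerMeasure n γ ≤ ENNReal.ofReal C ^ q *
      (∫⁻ y, ‖f y‖ₑ ^ q ∂powerMeasure n (γ - E * q) + ∫⁻ y, ‖f y‖ₑ ^ q ∂powerMeasure n γ) := by
    simp only [lintegral_powerMeasure]
    have hm : AEMeasurable (fun y => ‖f y‖ₑ ^ q * ENNReal.ofReal (y 0 ^ (γ - E * q)))
        (volume.restrict (halfSpace n)) :=
      (hf.enorm.pow_const q).mul (measurable_power _).aemeasurable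
    rw [← lintegral_add_left' hm,
      ← lintegral_const_mul' _ _ (ENNReal.rpow_ne_top_of_nonneg hq0.le ENNReal.ofReal_ne_top)]
    refine setLIntegral_mono' isOpen_halfSpace.measurableSet fun y hy => ?_
    have hpos := min_pos_of_mem hy
    have hy0 : 0 < y 0 := hy
    have h1 : ‖c y‖ₑ ^ q ≤ ENNReal.ofReal C ^ q * ENNReal.ofReal (min (y 0) 1 ^ (-E * q)) := by
      rw [Real.rpow_mul hpos.le, ← ENNReal.ofReal_rpow_of_pos (by positivity),
        ← ENNReal.mul_rpow_of_nonneg _ _ hq0.le,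
        ← ENNReal.ofReal_mul' (Real.rpow_nonneg hpos.le _)]
      refine ENNReal.rpow_le_rpow ?_ hq0.le
      rw [Real.enorm_eq_ofReal_abs]
      exact ENNReal.ofReal_le_ofReal (hc y hy)
    -- For y₀ ≤ 1 the singular factor lowers the exponent of the weight, for y₀ ≥ 1 it equals one;
    -- the sum of the two weights covers both cases.
    have h2 : ENNReal.ofReal (min (y 0) 1 ^ (-E * q)) * ENNReal.ofReal (y 0 ^ γ) ≤
        ENNReal.ofReal (y 0 ^ (γ - E * q)) + ENNReal.ofReal (y 0 ^ γ) := by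
      rw [← ENNReal.ofReal_mul (by positivity), ← ENNReal.ofReal_add (by positivity) (by positivity)]
      refine ENNReal.ofReal_le_ofReal ?_
      rcases le_total (y 0) 1 with h | h
      · rw [min_eq_left h, ← Real.rpow_add hy0, show -E * q + γ = γ - E * q by ring]
        exact le_add_of_nonneg_right (by positivity)
      · rw [min_eq_right h, Real.one_rpow, one_mul]
        exact le_add_of_nonneg_left (by positivity)
    rw [enorm_smul, ENNReal.mul_rpow_of_nonneg _ _ hq0.le]
    calc ‖c y‖ₑ ^ q * ‖f y‖ₑ ^ q * ENNReal.ofReal (y 0 ^ γ)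
        ≤ (ENNReal.ofReal C ^ q * ENNReal.ofReal (min (y 0) 1 ^ (-E * q))) * ‖f y‖ₑ ^ q *
          ENNReal.ofReal (y 0 ^ γ) := by gcongr
      _ = ENNReal.ofReal C ^ q * ‖f y‖ₑ ^ q *
          (ENNReal.ofReal (min (y 0) 1 ^ (-E * q)) * ENNReal.ofReal (y 0 ^ γ)) := by ring
      _ ≤ ENNReal.ofReal C ^ q * ‖f y‖ₑ ^ q *
          (ENNReal.ofReal (y 0 ^ (γ - E * q)) + ENNReal.ofReal (y 0 ^ γ)) := by gcongr
      _ = _ := by ring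
  refine (ENNReal.rpow_le_rpow key hq').trans ?_
  rw [ENNReal.mul_rpow_of_nonneg _ _ hq', ← ENNReal.rpow_mul, mul_one_div_cancel hq0.ne',
    ENNReal.rpow_one]
  gcongr
  exact ENNReal.rpow_add_le_add_rpow _ _ hq' ((div_le_one hq0).2 hq)

/-- In a term c · F_b with |b| + e = m the coefficient costs E = (e + 1 - s)₊ powers of y₀. As s ≥
1, this is at most e, and F_b has e derivatives left within the order k, so the iterated Hardy
inequality recovers the loss. -/
theorem IsComb.exists_eLpNorm_le [CompleteSpace X] {p : ℝ≥0∞} (hp : 1 ≤ p) (hp' : p ≠ ⊤)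
    (hs : 1 ≤ s) (hA : ∀ j i, IsSmoothSymbol s 1 (A j i)) {γ : ℝ} {k m : ℕ} (hm : m ≤ k)
    (hγ : max ((k : ℝ) - s) 0 * p.toReal - 1 < γ)
    {P : ((Fin (n + 1) → ℕ) → Euc (n + 1) → X) → Euc (n + 1) → X} (hP : IsComb X s m P) :
    ∃ C : ℝ≥0∞, C ≠ ⊤ ∧ ∀ F : (Fin (n + 1) → ℕ) → Euc (n + 1) → X, IsFrameFamily A k F →
      AEStronglyMeasurable (P F) (volume.restrict (halfSpace n)) ∧
      eLpNorm (P F) p (powerMeasure n γ) ≤ C * famNorm p γ k F := by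
  induction hP with
  | term e b c h1 h2 hc =>
    obtain ⟨hcs, C, hC⟩ := (hc 0).base
    set E : ℝ := max (((e + 1 : ℕ) : ℝ) - s) 0 with hE
    have hEe : E ≤ e := max_le (by push_cast; linarith) e.cast_nonneg
    -- Here |b| ≥ 1 enters: it gives e + 1 ≤ m ≤ k, so the exponents needed are exactly those that
    -- the lower bound on γ permits.
    have hEk : E ≤ max ((k : ℝ) - s) 0 := by
      refine max_le_max_right 0 (sub_le_sub_right ?_ s)
      exact_mod_cast (by omega : e + 1 ≤ k)
    have hγ' : -1 < γ - E * p.toReal := by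
      have := mul_le_mul_of_nonneg_right hEk (ENNReal.toReal_nonneg (a := p))
      linarith
    obtain ⟨D, hD, hF⟩ := IsFrameFamily.exists_eLpNorm_le (X := X) (k := k) hp hp' hs hA
      (le_max_right _ _) hEe hγ'
    refine ⟨ENNReal.ofReal C * (D + 1), ENNReal.mul_ne_top ENNReal.ofReal_ne_top (by simp [hD]),
      fun F hFF => ?_⟩
    have hbl := hFF.locallyIntegrableOn b (by omega)
    refine ⟨(LocallyIntegrableOn.continuousOn_smul_open isOpen_halfSpace hbl
      hcs.continuousOn).aestronglyMeasurable, ?_⟩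
    refine (eLpNorm_symbol_smul_le hp hp' hC hbl.aestronglyMeasurable).trans ?_
    rw [mul_assoc, add_mul, one_mul]
    gcongr
    · exact hF F hFF b (by omega)
    · exact eLpNorm_le_famNorm (by omega)
  | zero =>
    refine ⟨0, ENNReal.zero_ne_top, fun F _ => ⟨aestronglyMeasurable_const, ?_⟩⟩
    simp
  | add P Q _ _ hP hQ =>
    obtain ⟨C, hC, hP⟩ := hP
    obtain ⟨D, hD, hQ⟩ := hQ
    refine ⟨C + D, ENNReal.add_ne_top.2 ⟨hC, hD⟩, fun F hF => ?_⟩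
    obtain ⟨a1, a2⟩ := hP F hF
    obtain ⟨b1, b2⟩ := hQ F hF
    refine ⟨a1.add b1, ?_⟩
    rw [add_mul]
    exact (eLpNorm_add_le (a1.mono_ac (powerMeasure_absolutelyContinuous _))
      (b1.mono_ac (powerMeasure_absolutelyContinuous _)) hp).trans (add_le_add a2 b2)

end Bounds

end

end WeightedSobolev

namespace WeightedSobolev

noncomputable section

/-! ### Composition operators on weighted Sobolev spaces -/

section Transport

variable {n : ℕ} {X : Type*} [NormedAddCommGroup X] [NormedSpace ℝ X]

/-- Points of an open set have positive distance from a nonempty frontier, so the weight is positive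
there. For an empty frontier `Metric.infDist` would be zero. The null sets of both measures on O
thus agree, and weighted classes can be compared with Lebesgue ones. -/
theorem volume_absolutelyContinuous_weightedMeasure {d : ℕ} {O : Set (Euc d)} (hO : IsOpen O)
    (hf : (frontier O).Nonempty) (γ : ℝ) : volume.restrict O ≪ weightedMeasure O γ := by
  refine withDensity_absolutelyContinuous' ?_ ?_
  · exact (((Metric.continuous_infDist_pt _).measurable.pow_const γ).ennreal_ofReal).aemeasurable
  · filter_upwards [ae_restrict_mem hO.measurableSet] with x hx
    have hx' : x ∉ closure (frontier O) := by
      rw [isClosed_frontier.closure_eq, hO.frontier_eq]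
      exact fun h => h.2 hx
    have := (Metric.infDist_pos_iff_notMem_closure hf).1 hx'
    simpa using Real.rpow_pos_of_pos this γ

theorem weightedMeasure_absolutelyContinuous {d : ℕ} (O : Set (Euc d)) (γ : ℝ) :
    weightedMeasure O γ ≪ volume.restrict O := withDensity_absolutelyContinuous _ _

theorem piLp_norm_le_sum {ι : Type*} [Fintype ι] {E : ι → Type*}
    [∀ i, NormedAddCommGroup (E i)] (p : ℝ≥0∞) [Fact (1 ≤ p)] (v : PiLp p E) :
    ‖v‖ ≤ ∑ i, ‖v i‖ := by
  classical
  have hv : v = ∑ i, PiLp.single p i (v i) := by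
    ext j
    rw [WithLp.ofLp_sum, Finset.sum_apply]
    simp only [PiLp.ofLp_single]
    rw [Finset.sum_pi_single]
    simp
  conv_lhs => rw [hv]
  refine (norm_sum_le _ _).trans (Finset.sum_le_sum fun i _ => ?_)
  simp [PiLp.norm_single]

variable {𝕜 : Type*} [RCLike 𝕜] [NormedSpace 𝕜 X] [SMulCommClass ℝ 𝕜 X]

/-- A Sobolev function is determined by its class. -/
theorem sobolev_ext [CompleteSpace X] {d : ℕ} {O : Set (Euc d)} (hO : IsOpen O)
    (hf : (frontier O).Nonempty) {k : ℕ} {p : ℝ≥0∞} [Fact (1 ≤ p)] {γ : ℝ}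
    {u v : sobolev X 𝕜 O k p γ} (h : sobolevFun u =ᵐ[volume.restrict O] sobolevFun v) : u = v := by
  obtain ⟨u, F, hF, hF'⟩ := u
  obtain ⟨v, G, hG, hG'⟩ := v
  have hac := volume_absolutelyContinuous_weightedMeasure hO hf γ
  have hFG : F (MIdx.zero d k) =ᵐ[volume.restrict O] G (MIdx.zero d k) :=
    (hac.ae_eq (hF _)).symm.trans (h.trans (hac.ae_eq (hG _)))
  have : u = v := by
    ext1 α
    refine Lp.ext ((hF α).trans (Filter.EventuallyEq.trans ?_ (hG α).symm))
    exact (weightedMeasure_absolutelyContinuous O γ).ae_eq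
      (((hF' α).congr hFG Filter.EventuallyEq.rfl).ae_unique hO (hG' α))
  subst this
  rfl

variable {s : ℝ} {A B : Fin (n + 1) → Fin (n + 1) → Euc (n + 1) → ℝ}

/-- Separates the index a = 0, where the function itself is kept, from the others, where the
combination and its bound are available. Both P and C are independent of the family. -/
theorem exists_comb_bound [CompleteSpace X] {p : ℝ≥0∞} (hp : 1 ≤ p) (hp' : p ≠ ⊤)
    (hs : 1 ≤ s) (hA : ∀ j i, IsSmoothSymbol s 1 (A j i)) (hB : ∀ i j, IsSmoothSymbol s 1 (B i j))
    {γ : ℝ} {k : ℕ} (hγ : max ((k : ℝ) - s) 0 * p.toReal - 1 < γ) {V : Set (Euc (n + 1))}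
    {χ θ : Euc (n + 1) → Euc (n + 1)} (H : IsSmoothDiffeo V (halfSpace n) χ θ)
    (hχ : ∀ x ∈ V, ∀ i j, partialD i χ x j = B i j (χ x)) (a : Fin (n + 1) → ℕ)
    (ha : ∑ i, a i ≤ k) :
    ∃ (P : ((Fin (n + 1) → ℕ) → Euc (n + 1) → X) → Euc (n + 1) → X) (C : ℝ≥0∞), C ≠ ⊤ ∧
      (a = 0 → P = fun F => F 0) ∧ ∀ F, IsFrameFamily A k F →
        HasWeakDeriv V a (F 0 ∘ χ) (P F ∘ χ) ∧
        AEStronglyMeasurable (P F) (volume.restrict (halfSpace n)) ∧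
        eLpNorm (P F) p (powerMeasure n γ) ≤ C * famNorm p γ k F := by
  by_cases h0 : a = 0
  · subst h0
    refine ⟨fun F => F 0, 1, ENNReal.one_ne_top, fun _ => rfl, fun F hF => ?_⟩
    have hl := hF.locallyIntegrableOn 0 ha
    refine ⟨hasWeakDeriv_zero_self (H.locallyIntegrableOn_comp hl), hl.aestronglyMeasurable, ?_⟩
    simpa using eLpNorm_le_famNorm ha
  · obtain ⟨P, hP, hP'⟩ := exists_comb (X := X) hs hA hB (V := V) (χ := χ)
      (fun g hg => H.locallyIntegrableOn_comp hg) (fun g g' hg i => by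
        have hw := H.hasWeakDeriv_comp hg i
        refine hw.congr Filter.EventuallyEq.rfl ?_
        rw [Filter.EventuallyEq, ae_restrict_iff' H.isOpen_source.measurableSet]
        refine Filter.Eventually.of_forall fun x hx => ?_
        simp only [Function.comp_apply, hχ x hx]) a
    have hPc : IsComb X s (∑ i, a i) P := hP.resolve_left fun h => h0 h.1
    obtain ⟨C, hC, hb⟩ := hPc.exists_eLpNorm_le hp hp' hs hA ha hγ
    exact ⟨P, C, hC, fun h => absurd h h0, fun F hF => ⟨hP' k F ha hF, hb F hF⟩⟩

/-- Composition with `χ₁ ∘ χ₂ : V → U → S`, where `U` is the half-space, is bounded. -/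
theorem exists_sobolev_comp [CompleteSpace X] {p : ℝ≥0∞} [Fact (1 ≤ p)] (hp' : p ≠ ⊤)
    (hs : 1 ≤ s) (hA : ∀ j i, IsSmoothSymbol s 1 (A j i)) (hB : ∀ i j, IsSmoothSymbol s 1 (B i j))
    {γ : ℝ} {k : ℕ} (hγ : max ((k : ℝ) - s) 0 * p.toReal - 1 < γ) {S V : Set (Euc (n + 1))}
    (hS : (frontier S).Nonempty) (hV : (frontier V).Nonempty)
    {χ₁ θ₁ χ₂ θ₂ : Euc (n + 1) → Euc (n + 1)} (H₁ : IsSmoothDiffeo (halfSpace n) S χ₁ θ₁)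
    (H₂ : IsSmoothDiffeo V (halfSpace n) χ₂ θ₂)
    (h₁ : ∀ y ∈ halfSpace n, ∀ j i, partialD j χ₁ y i = A j i y)
    (h₂ : ∀ x ∈ V, ∀ i j, partialD i χ₂ x j = B i j (χ₂ x))
    {C₁ C₂ : ℝ≥0∞} (hC₁ : C₁ ≠ ⊤) (hC₂ : C₂ ≠ ⊤)
    (hn₁ : ∀ f : Euc (n + 1) → X, AEStronglyMeasurable f (volume.restrict S) →
      eLpNorm (f ∘ χ₁) p (powerMeasure n γ) ≤ C₁ * eLpNorm f p (weightedMeasure S γ))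
    (hn₂ : ∀ g : Euc (n + 1) → X, AEStronglyMeasurable g (volume.restrict (halfSpace n)) →
      eLpNorm (g ∘ χ₂) p (weightedMeasure V γ) ≤ C₂ * eLpNorm g p (powerMeasure n γ)) :
    ∃ C : ℝ, ∀ u : sobolev X 𝕜 S k p γ, ∃ v : sobolev X 𝕜 V k p γ,
      sobolevFun v =ᵐ[volume.restrict V] sobolevFun u ∘ (χ₁ ∘ χ₂) ∧ ‖v‖ ≤ C * ‖u‖ := by
  have hp : 1 ≤ p := Fact.out
  choose P C hC hP0 hP using fun α : MIdx (n + 1) k =>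
    exists_comb_bound (X := X) hp hp' hs hA hB hγ H₂ h₂ α.val α.sum_val_le
  set D : MIdx (n + 1) k → ℝ≥0∞ := fun α =>
    C₂ * (C α * (Fintype.card (MIdx (n + 1) k) * C₁)) with hD
  have hDtop : ∀ α, D α ≠ ⊤ := fun α => ENNReal.mul_ne_top hC₂ (ENNReal.mul_ne_top (hC α)
    (ENNReal.mul_ne_top (ENNReal.natCast_ne_top _) hC₁))
  refine ⟨∑ α, (D α).toReal, ?_⟩
  rintro ⟨u, F, hF, hF'⟩
  have hacS := volume_absolutelyContinuous_weightedMeasure H₁.isOpen_target hS γ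
  have hacV := volume_absolutelyContinuous_weightedMeasure H₂.isOpen_source hV γ
  -- the family transported to the half-space
  set F' : (Fin (n + 1) → ℕ) → Euc (n + 1) → X := fun b =>
    if h : ∑ i, b i ≤ k then F (MIdx.ofFun b h) else 0 with hF'def
  have hF'eq : ∀ b (h : ∑ i, b i ≤ k), F' b = F (MIdx.ofFun b h) := fun b h => dif_pos h
  have hF'0 : F' 0 = F (MIdx.zero (n + 1) k) := hF'eq 0 (by simp)
  have hw : ∀ b, ∑ i, b i ≤ k → HasWeakDeriv S b (F' 0) (F' b) := fun b hb => by
    rw [hF'0, hF'eq b hb]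
    exact hF' (MIdx.ofFun b hb)
  set G : (Fin (n + 1) → ℕ) → Euc (n + 1) → X := fun b => F' b ∘ χ₁ with hG
  have hGf : IsFrameFamily A k G := by
    refine ⟨fun b hb => H₁.locallyIntegrableOn_comp (hw b hb).right, fun b hb j => ?_⟩
    -- The members for b and b + e_i are derivatives of the same function, hence ∂_i of the former
    -- is the latter; the chain rule then gives the relations with coefficients A = Dχ₁.
    have h := H₁.hasWeakDeriv_comp (f := F' b) (f' := fun i => F' (b + Pi.single i 1))
      (fun i => (hw b hb.le).of_add (hw _ (by rw [sum_add_single]; omega))) j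
    refine h.congr Filter.EventuallyEq.rfl ?_
    rw [Filter.EventuallyEq, ae_restrict_iff' isOpen_halfSpace.measurableSet]
    refine Filter.Eventually.of_forall fun x hx => ?_
    simp only [h₁ x hx, hG, Function.comp_apply]
  have hnorm : famNorm p γ k G ≤
      Fintype.card (MIdx (n + 1) k) * C₁ * ENNReal.ofReal ‖u‖ := by
    have hle : ∀ α : MIdx (n + 1) k,
        eLpNorm (G α.val) p (powerMeasure n γ) ≤ C₁ * ENNReal.ofReal ‖u‖ := by
      intro α
      have e : F' α.val = F α := hF'eq α.val α.sum_val_le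
      have hm := (hw α.val α.sum_val_le).right.aestronglyMeasurable
      refine (hn₁ _ hm).trans ?_
      gcongr
      rw [e, ← eLpNorm_congr_ae (hF α), ← Lp.enorm_def, ← ofReal_norm]
      exact ENNReal.ofReal_le_ofReal (PiLp.norm_apply_le u α)
    refine (Finset.sum_le_sum fun α _ => hle α).trans ?_
    rw [Finset.sum_const, Finset.card_univ, nsmul_eq_mul, mul_assoc]
  have hbound : ∀ α, eLpNorm (P α G ∘ χ₂) p (weightedMeasure V γ) ≤
      D α * ENNReal.ofReal ‖u‖ := by
    intro α
    obtain ⟨_, a2, a3⟩ := hP α G hGf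
    calc _ ≤ C₂ * (C α * famNorm p γ k G) := (hn₂ _ a2).trans (by gcongr)
      _ ≤ C₂ * (C α * (Fintype.card (MIdx (n + 1) k) * C₁ * ENNReal.ofReal ‖u‖)) := by gcongr
      _ = _ := by rw [hD]; ring
  have hmem : ∀ α, MemLp (P α G ∘ χ₂) p (weightedMeasure V γ) := fun α =>
    ⟨(hP α G hGf).1.right.aestronglyMeasurable.mono_ac (weightedMeasure_absolutelyContinuous V γ),
      (hbound α).trans_lt (ENNReal.mul_lt_top (hDtop α).lt_top ENNReal.ofReal_lt_top)⟩
  have hz : P (MIdx.zero (n + 1) k) G = G 0 := by rw [hP0 _ (by funext i; rfl)]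
  refine ⟨⟨WithLp.toLp p fun α => (hmem α).toLp _, fun α => P α G ∘ χ₂, fun α =>
    (hmem α).coeFn_toLp, fun α => ?_⟩, ?_, ?_⟩
  · change HasWeakDeriv V α.val (P (MIdx.zero (n + 1) k) G ∘ χ₂) (P α G ∘ χ₂)
    rw [hz]
    exact (hP α G hGf).1
  · refine (hacV.ae_eq (hmem (MIdx.zero (n + 1) k)).coeFn_toLp).trans ?_
    rw [hz, hG]
    change (F' 0 ∘ χ₁) ∘ χ₂ =ᵐ[volume.restrict V] _
    rw [hF'0]
    have h1 : ∀ᵐ x ∂volume.restrict S, F (MIdx.zero (n + 1) k) x = u (MIdx.zero (n + 1) k) x :=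
      (hacS.ae_eq (hF (MIdx.zero (n + 1) k))).symm
    exact H₂.ae_comp (H₁.ae_comp h1)
  · change ‖WithLp.toLp p fun α => (hmem α).toLp _‖ ≤ _ * ‖u‖
    refine (piLp_norm_le_sum p _).trans ?_
    rw [Finset.sum_mul]
    refine Finset.sum_le_sum fun α _ => ?_
    change ‖(hmem α).toLp _‖ ≤ _
    rw [Lp.norm_toLp]
    calc _ ≤ (D α * ENNReal.ofReal ‖u‖).toReal :=
          ENNReal.toReal_mono (ENNReal.mul_ne_top (hDtop α) ENNReal.ofReal_ne_top) (hbound α)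
      _ = _ := by rw [ENNReal.toReal_mul, ENNReal.toReal_ofReal (norm_nonneg u)]

/-- Mutually inverse bounded composition operators form an isomorphism. -/
theorem exists_sobolev_equiv [CompleteSpace X] {d : ℕ} {p : ℝ≥0∞} [Fact (1 ≤ p)] {γ : ℝ} {k : ℕ}
    {S V : Set (Euc d)} (hS : (frontier S).Nonempty) (hV : (frontier V).Nonempty)
    {χ θ : Euc d → Euc d} (H : IsSmoothDiffeo V S χ θ)
    (h₁ : ∃ C : ℝ, ∀ u : sobolev X 𝕜 S k p γ, ∃ v : sobolev X 𝕜 V k p γ,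
      sobolevFun v =ᵐ[volume.restrict V] sobolevFun u ∘ χ ∧ ‖v‖ ≤ C * ‖u‖)
    (h₂ : ∃ C : ℝ, ∀ v : sobolev X 𝕜 V k p γ, ∃ u : sobolev X 𝕜 S k p γ,
      sobolevFun u =ᵐ[volume.restrict S] sobolevFun v ∘ θ ∧ ‖u‖ ≤ C * ‖v‖) :
    ∃ Φ : sobolev X 𝕜 S k p γ ≃L[𝕜] sobolev X 𝕜 V k p γ,
      (∀ f, sobolevFun (Φ f) =ᵐ[volume.restrict V] sobolevFun f ∘ χ) ∧
      ∀ g, sobolevFun (Φ.symm g) =ᵐ[volume.restrict S] sobolevFun g ∘ θ := by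
  have hclm : ∀ {S V : Set (Euc d)} {χ θ : Euc d → Euc d}, (frontier S).Nonempty →
      (frontier V).Nonempty → IsSmoothDiffeo V S χ θ →
      (∃ C : ℝ, ∀ u : sobolev X 𝕜 S k p γ, ∃ v : sobolev X 𝕜 V k p γ,
        sobolevFun v =ᵐ[volume.restrict V] sobolevFun u ∘ χ ∧ ‖v‖ ≤ C * ‖u‖) →
      ∃ Φ : sobolev X 𝕜 S k p γ →L[𝕜] sobolev X 𝕜 V k p γ,
        ∀ f, sobolevFun (Φ f) =ᵐ[volume.restrict V] sobolevFun f ∘ χ := by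
    intro S V χ θ hS hV H ⟨C, hC⟩
    -- The image is determined by its class, so any choice of images is automatically linear.
    choose T hT hTn using hC
    have hacS := volume_absolutelyContinuous_weightedMeasure H.isOpen_target hS γ
    have hacV := volume_absolutelyContinuous_weightedMeasure H.isOpen_source hV γ
    let L : sobolev X 𝕜 S k p γ →ₗ[𝕜] sobolev X 𝕜 V k p γ :=
      { toFun := T
        map_add' := fun u v => by
          refine sobolev_ext H.isOpen_source hV ?_
          have e1 : ∀ᵐ x ∂volume.restrict S, sobolevFun (u + v) x = sobolevFun u x + sobolevFun v x :=
            hacS.ae_eq (Lp.coeFn_add _ _)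
          have e2 : ∀ᵐ x ∂volume.restrict V,
              sobolevFun (T u + T v) x = sobolevFun (T u) x + sobolevFun (T v) x :=
            hacV.ae_eq (Lp.coeFn_add _ _)
          filter_upwards [hT u, hT v, hT (u + v), H.ae_comp e1, e2] with x a b c d e
          rw [c, e, a, b]
          exact d
        map_smul' := fun r u => by
          refine sobolev_ext H.isOpen_source hV ?_
          have e1 : ∀ᵐ x ∂volume.restrict S, sobolevFun (r • u) x = r • sobolevFun u x :=
            hacS.ae_eq (Lp.coeFn_smul _ _)
          have e2 : ∀ᵐ x ∂volume.restrict V, sobolevFun (r • T u) x = r • sobolevFun (T u) x :=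
            hacV.ae_eq (Lp.coeFn_smul _ _)
          filter_upwards [hT u, hT (r • u), H.ae_comp e1, e2] with x a c d e
          rw [RingHom.id_apply, c, e, a]
          exact d }
    exact ⟨L.mkContinuous C hTn, hT⟩
  obtain ⟨Φ, hΦ⟩ := hclm hS hV H h₁
  obtain ⟨Θ, hΘ⟩ := hclm hV hS H.symm h₂
  refine ⟨ContinuousLinearEquiv.equivOfInverse Φ Θ (fun u => ?_) (fun v => ?_), hΦ, hΘ⟩
  · refine sobolev_ext H.isOpen_target hS ?_
    have e : ∀ᵐ x ∂volume.restrict V, sobolevFun (Φ u) x = (sobolevFun u ∘ χ) x := hΦ u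
    filter_upwards [hΘ (Φ u), H.symm.ae_comp e, ae_restrict_mem H.isOpen_target.measurableSet]
      with x a b hx
    rw [a, Function.comp_apply, b, Function.comp_apply, H.right_inv x hx]
  · refine sobolev_ext H.isOpen_source hV ?_
    have e : ∀ᵐ x ∂volume.restrict S, sobolevFun (Θ v) x = (sobolevFun v ∘ θ) x := hΘ v
    filter_upwards [hΦ (Θ v), H.ae_comp e, ae_restrict_mem H.isOpen_source.measurableSet]
      with x a b hx
    rw [a, Function.comp_apply, b, Function.comp_apply, H.left_inv x hx]

end Transport

end

end WeightedSobolev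

namespace WeightedSobolev

noncomputable section

/-! ### Mollification at the scale of the distance to the boundary -/

section Mollify

variable {n : ℕ}

/-- The projection onto the last coordinates as a continuous linear map. -/
def tailL : Euc (n + 1) →L[ℝ] Euc n :=
  LinearMap.toContinuousLinearMap
    { toFun := tail
      map_add' := fun x y => by ext i; simp [tail]
      map_smul' := fun c x => by ext i; simp [tail] }

theorem tailL_apply (x : Euc (n + 1)) : tailL x = tail x := rfl

@[simp] theorem tail_apply (x : Euc (n + 1)) (i : Fin n) : tail x i = x i.succ := rfl

theorem tail_add (x y : Euc (n + 1)) : tail (x + y) = tail x + tail y := map_add tailL x y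

theorem tail_smul (c : ℝ) (x : Euc (n + 1)) : tail (c • x) = c • tail x := map_smul tailL c x

theorem tail_sub (x y : Euc (n + 1)) : tail (x - y) = tail x - tail y := map_sub tailL x y

@[simp] theorem tail_single_succ (i : Fin n) :
    tail (EuclideanSpace.single i.succ (1 : ℝ)) = EuclideanSpace.single i 1 := by
  ext j
  simp

@[simp] theorem tail_e₁ : tail (e₁ n) = 0 := by
  ext j
  simp

@[fun_prop] theorem contDiff_tail {m : ℕ∞ω} : ContDiff ℝ m (tail : Euc (n + 1) → Euc n) :=
  tailL.contDiff

@[fun_prop] theorem continuous_tail : Continuous (tail : Euc (n + 1) → Euc n) := tailL.continuous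

/-- Differentiation under the integral sign over a compact set. -/
theorem partialD_integral {d m : ℕ} {g : Euc m → ℝ} (hg : Continuous g)
    {K : Euc d → Euc m → ℝ} {W : Set (Euc d)} (hW : IsOpen W)
    (hK : ContDiffOn ℝ 1 (Function.uncurry K) (W ×ˢ Set.univ)) {C : Set (Euc m)}
    (hC : IsCompact C) {y : Euc d} (hy : y ∈ W) :
    DifferentiableAt ℝ (fun y => ∫ v in C, g v * K y v) y ∧
      ∀ i, partialD i (fun y => ∫ v in C, g v * K y v) y =
        ∫ v in C, g v * partialD i (fun y => K y v) y := by
  have hopen : IsOpen (W ×ˢ (Set.univ : Set (Euc m))) := hW.prod isOpen_univ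
  set k' : Euc d → Euc m → (Euc d →L[ℝ] ℝ) := fun y v =>
    g v • (fderiv ℝ (Function.uncurry K) (y, v)).comp (ContinuousLinearMap.inl ℝ _ _) with hk'
  have hc1 : ContinuousOn (fun z : Euc d × Euc m => fderiv ℝ (Function.uncurry K) z)
      (W ×ˢ Set.univ) := hK.continuousOn_fderiv_of_isOpen hopen le_rfl
  have hc : ContinuousOn (Function.uncurry k') (W ×ˢ Set.univ) :=
    (hg.comp continuous_snd).continuousOn.smul (hc1.clm_comp continuousOn_const)
  have hd0 : ∀ v, ∀ y ∈ W, HasFDerivAt (fun y => K y v)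
      ((fderiv ℝ (Function.uncurry K) (y, v)).comp (ContinuousLinearMap.inl ℝ _ _)) y := by
    intro v y hy
    have h1 : HasFDerivAt (Function.uncurry K) (fderiv ℝ (Function.uncurry K) (y, v)) (y, v) :=
      ((hK.contDiffAt (hopen.mem_nhds ⟨hy, Set.mem_univ v⟩)).differentiableAt
        (by simp)).hasFDerivAt
    exact HasFDerivAt.comp (g := Function.uncurry K) (f := fun y => (y, v)) y h1
      (hasFDerivAt_prodMk_left y v)
  have hd : ∀ v, ∀ y ∈ W, HasFDerivAt (fun y => g v * K y v) (k' y v) y := fun v y hy =>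
    (hd0 v y hy).const_mul (g v)
  obtain ⟨ε, hε, hball⟩ := Metric.nhds_basis_closedBall.mem_iff.1 (hW.mem_nhds hy)
  -- Continuity on a compact product gives a constant dominating function, integrable because C has
  -- finite measure.
  obtain ⟨M, hM⟩ := ((isCompact_closedBall y ε).prod hC).exists_bound_of_continuousOn
    (hc.mono (Set.prod_mono hball (Set.subset_univ C)))
  have hkc : ∀ y ∈ W, Continuous fun v => g v * K y v := by
    intro y hy
    refine hg.mul (continuousOn_univ.1 ?_)
    exact hK.continuousOn.comp (Continuous.prodMk_right y).continuousOn fun v _ => ⟨hy, Set.mem_univ v⟩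
  have hk'c : Continuous (k' y) := continuousOn_univ.1
    (hc.comp (Continuous.prodMk_right y).continuousOn fun v _ => ⟨hy, Set.mem_univ v⟩)
  have hfin : IsFiniteMeasure (volume.restrict C) :=
    ⟨by simpa using hC.measure_lt_top⟩
  have key : HasFDerivAt (fun y => ∫ v in C, g v * K y v) (∫ v in C, k' y v) y := by
    refine hasFDerivAt_integral_of_dominated_of_fderiv_le (bound := fun _ => M)
      (s := Metric.closedBall y ε) (Metric.closedBall_mem_nhds y hε) ?_
      ((hkc y hy).continuousOn.integrableOn_compact hC) hk'c.aestronglyMeasurable ?_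
      (integrable_const M) ?_
    · filter_upwards [hW.mem_nhds hy] with z hz using (hkc z hz).aestronglyMeasurable
    · filter_upwards [ae_restrict_mem hC.measurableSet] with v hv z hz
      exact hM (z, v) ⟨hz, hv⟩
    · exact Filter.Eventually.of_forall fun v z hz => hd v z (hball hz)
  refine ⟨key.differentiableAt, fun i => ?_⟩
  rw [partialD, key.fderiv, ContinuousLinearMap.integral_apply
    (hk'c.continuousOn.integrableOn_compact hC)]
  refine integral_congr_ae (Filter.Eventually.of_forall fun v => ?_)
  simp only [hk', partialD, (hd0 v y hy).fderiv]
  rfl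

/-- The function `y ↦ ∫ g(ỹ - (y₀ / L) z) ψ(z) dz`. -/
def mollify (L : ℝ) (g ψ : Euc n → ℝ) (y : Euc (n + 1)) : ℝ :=
  ∫ z, g (tail y - (y 0 / L) • z) * ψ z

/-- The divergence of `z ψ(z)`. -/
def divMul (ψ : Euc n → ℝ) (z : Euc n) : ℝ := ∑ i, partialD i (fun z => ψ z * z i) z

theorem isTest_univ_iff {d : ℕ} {ψ : Euc d → ℝ} :
    IsTest Set.univ ψ ↔ ContDiff ℝ ∞ ψ ∧ HasCompactSupport ψ := by
  simp [IsTest]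

theorem IsTest.mul_coord {d : ℕ} {ψ : Euc d → ℝ} (h : IsTest Set.univ ψ) (i : Fin d) :
    IsTest Set.univ fun z => ψ z * z i :=
  h.mul isOpen_univ (by fun_prop)

theorem IsTest.add {d : ℕ} {O : Set (Euc d)} {ψ ψ' : Euc d → ℝ} (h : IsTest O ψ)
    (h' : IsTest O ψ') : IsTest O fun z => ψ z + ψ' z :=
  ⟨h.1.add h'.1, h.2.1.add h'.2.1, (tsupport_add ψ ψ').trans (Set.union_subset h.2.2 h'.2.2)⟩

theorem isTest_zero {d : ℕ} (O : Set (Euc d)) : IsTest O fun _ => 0 :=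
  ⟨contDiff_const, HasCompactSupport.zero, by
    rw [show tsupport (fun _ : Euc d => (0 : ℝ)) = ∅ from tsupport_eq_empty_iff.2 rfl]
    exact Set.empty_subset _⟩

theorem IsTest.sum {ι : Type*} {d : ℕ} {O : Set (Euc d)} (t : Finset ι) {ψ : ι → Euc d → ℝ}
    (h : ∀ i ∈ t, IsTest O (ψ i)) : IsTest O fun z => ∑ i ∈ t, ψ i z := by
  classical
  induction t using Finset.induction_on with
  | empty => simpa using isTest_zero O
  | insert i t hi ih =>
    simp only [Finset.sum_insert hi]
    exact (h i (Finset.mem_insert_self _ _)).add (ih fun j hj => h j (Finset.mem_insert_of_mem hj))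

theorem IsTest.divMul {ψ : Euc n → ℝ} (h : IsTest Set.univ ψ) :
    IsTest Set.univ (divMul ψ) :=
  IsTest.sum _ fun i _ => isTest_partialD (h.mul_coord i) i

theorem IsTest.integrable {d : ℕ} {O : Set (Euc d)} {ψ : Euc d → ℝ} (h : IsTest O ψ) :
    Integrable ψ := h.1.continuous.integrable_of_hasCompactSupport h.2.1

/-- A divergence of compactly supported fields has mean zero; this cancellation later yields the
factor y₀^λ. -/
theorem IsTest.integral_divMul {ψ : Euc n → ℝ} (h : IsTest Set.univ ψ) :
    ∫ z, WeightedSobolev.divMul ψ z = 0 := by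
  unfold WeightedSobolev.divMul
  rw [integral_finsetSum _ fun i _ => (isTest_partialD (h.mul_coord i) i).integrable]
  refine Finset.sum_eq_zero fun i _ => ?_
  simpa using (h.mul_coord i).integral_partialD i

/-- The right-hand side is what differentiating r^n ψ(r z) in the scale r produces at r = 1; hence
the normal derivative of the kernel is again a kernel, built from `divMul ψ`. -/
theorem divMul_eq {ψ : Euc n → ℝ} (h : ContDiff ℝ ∞ ψ) (z : Euc n) :
    divMul ψ z = n * ψ z + fderiv ℝ ψ z z := by
  have : ∀ i : Fin n, partialD i (fun z => ψ z * z i) z = ψ z + z i * partialD i ψ z := by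
    intro i
    have h1 := partialD_smul (i := i) (f := fun z : Euc n => z i) (h.differentiable (by simp) z)
      (by fun_prop)
    have h2 : partialD i (fun z : Euc n => z i) z = 1 := by
      have : (fun z : Euc n => z i) = (EuclideanSpace.proj i : Euc n →L[ℝ] ℝ) := rfl
      rw [partialD, this, ContinuousLinearMap.fderiv]
      simp
    simp only [smul_eq_mul] at h1
    rw [h1, h2]
    ring
  rw [divMul, fderiv_eq_sum_partialD]
  simp [this, Finset.sum_add_distrib]

theorem mollify_eq_setIntegral (L : ℝ) (g ψ : Euc n → ℝ) (y : Euc (n + 1)) :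
    mollify L g ψ y = ∫ z in tsupport ψ, g (tail y - (y 0 / L) • z) * ψ z :=
  (setIntegral_eq_integral_of_forall_compl_eq_zero fun z hz => by
    rw [image_eq_zero_of_notMem_tsupport hz, mul_zero]).symm

theorem continuous_mollify {L : ℝ} {g ψ : Euc n → ℝ} (hg : Continuous g)
    (hψ : IsTest Set.univ ψ) : Continuous (mollify L g ψ) := by
  rw [show mollify L g ψ = fun y => ∫ z in tsupport ψ, g (tail y - (y 0 / L) • z) * ψ z from
    funext (mollify_eq_setIntegral L g ψ)]
  have hψc := hψ.1.continuous
  exact continuous_parametric_integral_of_continuous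
    (f := fun (y : Euc (n + 1)) z => g (tail y - (y 0 / L) • z) * ψ z) (by fun_prop) hψ.2.1

/-- The derivatives fall on g: no power of y₀ is lost, and the normal derivative merely multiplies
the mollifier by -z_i / L. This is used while g is still C¹, and it is valid across y₀ = 0. -/
theorem mollify_differentiable_of_contDiff {L : ℝ} {g ψ : Euc n → ℝ} (hg : ContDiff ℝ 1 g)
    (hψ : IsTest Set.univ ψ) (y : Euc (n + 1)) :
    DifferentiableAt ℝ (mollify L g ψ) y ∧
      (∀ i : Fin n, partialD i.succ (mollify L g ψ) y = mollify L (partialD i g) ψ y) ∧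
      partialD 0 (mollify L g ψ) y =
        ∑ i, -(1 / L) * mollify L (partialD i g) (fun z => ψ z * z i) y := by
  set K : Euc (n + 1) → Euc n → ℝ := fun y z => g (tail y - (y 0 / L) • z) * ψ z with hK
  have hψ1 : ContDiff ℝ 1 ψ := contDiff_nat_of_infty hψ.1 1
  have hKc : ContDiff ℝ 1 (Function.uncurry K) := by
    have : Function.uncurry K = fun z : Euc (n + 1) × Euc n =>
      g (tail z.1 - (z.1 0 / L) • z.2) * ψ z.2 := rfl
    rw [this]
    fun_prop
  have key := partialD_integral (g := fun _ : Euc n => (1 : ℝ)) continuous_const isOpen_univ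
    hKc.contDiffOn hψ.2.1.isCompact (Set.mem_univ y)
  simp only [one_mul] at key
  rw [show mollify L g ψ = fun y => ∫ z in tsupport ψ, K y z from
    funext (mollify_eq_setIntegral L g ψ)]
  have hpd : ∀ i z, partialD i (fun y => K y z) y =
      fderiv ℝ g (tail y - (y 0 / L) • z) (tail (EuclideanSpace.single i 1) -
        ((EuclideanSpace.single i (1 : ℝ) : Euc (n + 1)) 0 / L) • z) * ψ z := by
    intro i z
    set Λ : Euc (n + 1) →L[ℝ] Euc n :=
      tailL - ((1 / L) • (EuclideanSpace.proj 0 : Euc (n + 1) →L[ℝ] ℝ)).smulRight z with hΛ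
    have hΛa : ∀ y : Euc (n + 1), Λ y = tail y - (y 0 / L) • z := by
      intro y
      simp [hΛ, tailL_apply, div_eq_inv_mul]
    have h1 : HasFDerivAt (fun y => g (Λ y)) ((fderiv ℝ g (Λ y)).comp Λ) y :=
      ((hg.differentiable (by simp) (Λ y)).hasFDerivAt).comp y Λ.hasFDerivAt
    have h2 : (fun y => K y z) = fun y => g (Λ y) * ψ z := by
      funext y
      rw [hΛa]
    rw [h2, partialD, (h1.mul_const (ψ z)).fderiv, ← hΛa, ← hΛa]
    simp [mul_comm]
  refine ⟨key.1, fun i => ?_, ?_⟩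
  · rw [key.2, mollify_eq_setIntegral]
    congr 1
    funext z
    rw [hpd]
    simp [partialD]
  · rw [key.2]
    have hint : ∀ i, IntegrableOn (fun z => partialD i g (tail y - (y 0 / L) • z) * (ψ z * z i))
        (tsupport ψ) := by
      intro i
      have h1 : Continuous (partialD i g) := (contDiff_partialD (r := 0) hg (by simp) i).continuous
      have h2 := hψ.1.continuous
      exact (Continuous.continuousOn (by fun_prop)).integrableOn_compact hψ.2.1
    have hm : ∀ i, mollify L (partialD i g) (fun z => ψ z * z i) y =
        ∫ z in tsupport ψ, partialD i g (tail y - (y 0 / L) • z) * (ψ z * z i) := fun i =>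
      (setIntegral_eq_integral_of_forall_compl_eq_zero fun z hz => by
        show partialD i g _ * (ψ z * z i) = 0
        rw [image_eq_zero_of_notMem_tsupport hz, zero_mul, mul_zero]).symm
    simp only [hm]
    rw [← Finset.mul_sum, ← integral_finsetSum _ fun i _ => hint i, ← integral_const_mul]
    congr 1
    funext z
    rw [hpd, show (EuclideanSpace.single 0 (1 : ℝ) : Euc (n + 1)) = e₁ n from rfl, tail_e₁, zero_sub,
      e₁_zero, map_neg, map_smul, fderiv_eq_sum_partialD, smul_eq_mul, Finset.mul_sum, neg_mul,
      Finset.sum_mul, Finset.mul_sum, ← Finset.sum_neg_distrib]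
    refine Finset.sum_congr rfl fun i _ => ?_
    simp only [smul_eq_mul]
    ring

/-- The kernel of `mollify`. -/
def mollifyKernel (L : ℝ) (ψ : Euc n → ℝ) (y : Euc (n + 1)) (v : Euc n) : ℝ :=
  (L / y 0) ^ n * ψ ((L / y 0) • (tail y - v))

/-- The substitution v = ỹ - (y₀ / L) z moves the dependence on y from g into the kernel, so that g
need only be continuous. -/
theorem mollify_eq_kernel {L : ℝ} (hL : 0 < L) (g ψ : Euc n → ℝ) {y : Euc (n + 1)}
    (hy : y ∈ halfSpace n) : mollify L g ψ y = ∫ v, g v * mollifyKernel L ψ y v := by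
  have hy0 : 0 < y 0 := hy
  set r := L / y 0 with hr
  have hr0 : 0 < r := by positivity
  have e1 := Measure.integral_comp_smul (volume : Measure (Euc n))
    (fun z => g (tail y - (y 0 / L) • z) * ψ z) r
  have hrr : y 0 / L = r⁻¹ := by rw [hr, inv_div]
  rw [finrank_euclideanSpace, Fintype.card_fin, abs_of_pos (by positivity)] at e1
  have e2 : mollify L g ψ y = r ^ n * ∫ x, g (tail y - x) * ψ (r • x) := by
    have : ∀ x, g (tail y - (y 0 / L) • r • x) * ψ (r • x) = g (tail y - x) * ψ (r • x) := by
      intro x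
      rw [hrr, smul_smul, inv_mul_cancel₀ hr0.ne', one_smul]
    simp only [this] at e1
    rw [e1, smul_eq_mul, ← mul_assoc, mul_inv_cancel₀ (by positivity), one_mul, mollify]
  have e3 := integral_sub_left_eq_self (fun x => g (tail y - x) * ψ (r • x))
    (volume : Measure (Euc n)) (tail y)
  rw [e2, ← e3, ← integral_const_mul]
  congr 1
  funext v
  rw [sub_sub_cancel, mollifyKernel]
  ring

theorem mollifyKernel_partialD {L : ℝ} {ψ : Euc n → ℝ} (hψ : ContDiff ℝ ∞ ψ) {y : Euc (n + 1)}
    (hy : y ∈ halfSpace n) (v : Euc n) :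
    DifferentiableAt ℝ (fun y => mollifyKernel L ψ y v) y →
    (∀ i : Fin n, partialD i.succ (fun y => mollifyKernel L ψ y v) y =
      L / y 0 * mollifyKernel L (partialD i ψ) y v) ∧
    partialD 0 (fun y => mollifyKernel L ψ y v) y =
      -(1 / y 0) * mollifyKernel L (divMul ψ) y v := by
  intro hd
  have hy0 : 0 < y 0 := hy
  have hψd : ∀ z, HasFDerivAt ψ (fderiv ℝ ψ z) z := fun z =>
    (hψ.differentiable (by simp) z).hasFDerivAt
  have huniq : ∀ (i : Fin (n + 1)) (D : ℝ), HasDerivAt (fun t : ℝ =>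
      mollifyKernel L ψ (y + t • EuclideanSpace.single i 1) v) D 0 →
      partialD i (fun y => mollifyKernel L ψ y v) y = D := fun i D h =>
    HasDerivAt.unique (hd.hasFDerivAt.hasLineDerivAt (EuclideanSpace.single i (1 : ℝ))) h
  refine ⟨fun i => huniq _ _ ?_, huniq _ _ ?_⟩
  · have e : (fun t : ℝ => mollifyKernel L ψ (y + t • EuclideanSpace.single i.succ 1) v) =
        fun t => (L / y 0) ^ n *
          ψ ((L / y 0) • (tail y + t • EuclideanSpace.single i 1 - v)) := by
      funext t
      simp [mollifyKernel, tail_add, tail_smul]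
    rw [e]
    have h1 : HasDerivAt (fun t : ℝ => (L / y 0) • (tail y + t • EuclideanSpace.single i (1 : ℝ) - v))
        ((L / y 0) • EuclideanSpace.single i (1 : ℝ)) 0 := by
      have := (((hasDerivAt_id (0 : ℝ)).smul_const (EuclideanSpace.single i (1 : ℝ))).const_add
        (tail y)).sub_const v |>.const_smul (L / y 0)
      exact this.congr_deriv (by rw [one_smul])
    have h2 := ((hψd _).comp_hasDerivAt (0 : ℝ) h1).const_mul ((L / y 0) ^ n)
    refine h2.congr_deriv ?_
    rw [map_smul]
    simp only [mollifyKernel, partialD, zero_smul, add_zero, smul_eq_mul]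
    ring
  · have e : (fun t : ℝ => mollifyKernel L ψ (y + t • EuclideanSpace.single 0 1) v) =
        fun t => (L / (y 0 + t)) ^ n * ψ ((L / (y 0 + t)) • (tail y - v)) := by
      funext t
      rw [show (EuclideanSpace.single 0 (1 : ℝ) : Euc (n + 1)) = e₁ n from rfl]
      simp [mollifyKernel, tail_add, tail_smul]
    rw [e]
    have h0 : HasDerivAt (fun t : ℝ => L / (y 0 + t)) (-(L / y 0) * (1 / y 0)) 0 := by
      have := ((hasDerivAt_id (0 : ℝ)).const_add (y 0)).inv (by simpa using hy0.ne')
        |>.const_mul L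
      refine (this.congr_deriv ?_).congr_of_eventuallyEq
        (Filter.Eventually.of_forall fun t => div_eq_mul_inv _ _)
      simp
      field_simp
    have h1 := h0.smul_const (tail y - v)
    have hψd' : HasFDerivAt ψ (fderiv ℝ ψ ((L / y 0) • (tail y - v)))
        ((L / (y 0 + 0)) • (tail y - v)) := by
      rw [add_zero]; exact hψd _
    have h2 := (h0.pow n).mul (hψd'.comp_hasDerivAt (0 : ℝ) h1)
    refine HasDerivAt.congr_deriv (f := fun t => (L / (y 0 + t)) ^ n *
      ψ ((L / (y 0 + t)) • (tail y - v))) h2 ?_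
    rw [map_smul, mollifyKernel, divMul_eq hψ, map_smul]
    -- Differentiating the nth power produces the exponent n - 1, which is truncated for n = 0.
    rcases Nat.eq_zero_or_pos n with hn | hn
    · subst hn
      simp
      ring
    · obtain ⟨m, rfl⟩ : ∃ m, n = m + 1 := ⟨n - 1, by omega⟩
      simp only [Nat.add_sub_cancel, smul_eq_mul, add_zero, Function.comp_apply, Pi.pow_apply]
      ring

theorem contDiffOn_mollifyKernel {L : ℝ} {ψ : Euc n → ℝ} (hψ : ContDiff ℝ ∞ ψ) :
    ContDiffOn ℝ 1 (Function.uncurry (mollifyKernel L ψ)) (halfSpace n ×ˢ Set.univ) := by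
  have h1 : ContDiffOn ℝ 1 (fun z : Euc (n + 1) × Euc n => L / z.1 0)
      (halfSpace n ×ˢ Set.univ) :=
    contDiffOn_const.div (ContDiff.contDiffOn (by fun_prop)) fun z hz => ne_of_gt hz.1
  have h2 : ContDiffOn ℝ 1 (fun z : Euc (n + 1) × Euc n => tail z.1 - z.2)
      (halfSpace n ×ˢ Set.univ) := ContDiff.contDiffOn (by fun_prop)
  exact (h1.pow n).mul ((contDiff_nat_of_infty hψ 1).comp_contDiffOn (h1.smul h2))

/-- The complementary form: the derivatives fall on the kernel and each costs a factor 1/y₀, but the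
new mollifiers ∂_iψ and div(zψ) have mean zero. -/
theorem mollify_differentiable {L : ℝ} (hL : 0 < L) {g ψ : Euc n → ℝ} (hg : Continuous g)
    (hψ : IsTest Set.univ ψ) {y : Euc (n + 1)} (hy : y ∈ halfSpace n) :
    DifferentiableAt ℝ (mollify L g ψ) y ∧
      (∀ i : Fin n, partialD i.succ (mollify L g ψ) y = L / y 0 * mollify L g (partialD i ψ) y) ∧
      partialD 0 (mollify L g ψ) y = -(1 / y 0) * mollify L g (divMul ψ) y := by
  have hy0 : 0 < y 0 := hy
  obtain ⟨ρ, hρ⟩ := hψ.2.1.isCompact.isBounded.subset_closedBall (0 : Euc n)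
  -- One ball must contain the supports of the kernels for all x within distance one of y: there |v|
  -- ≤ |ỹ| + |x̃ - ỹ| + |ρ| x₀ / L and x₀ ≤ y₀ + 1.
  set R : ℝ := ‖tail y‖ + ‖(tailL : Euc (n + 1) →L[ℝ] Euc n)‖ + |ρ| * ((y 0 + 1) / L) with hR
  set C : Set (Euc n) := Metric.closedBall 0 R with hC
  set W : Set (Euc (n + 1)) := halfSpace n ∩ Metric.ball y 1 with hW
  have hWo : IsOpen W := isOpen_halfSpace.inter Metric.isOpen_ball
  have hyW : y ∈ W := ⟨hy, Metric.mem_ball_self one_pos⟩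
  have hsupp : ∀ ψ' : Euc n → ℝ, tsupport ψ' ⊆ tsupport ψ → ∀ x ∈ W, ∀ v, v ∉ C →
      mollifyKernel L ψ' x v = 0 := by
    intro ψ' hψ' x hx v hv
    have hx0 : 0 < x 0 := hx.1
    refine mul_eq_zero_of_right _ (image_eq_zero_of_notMem_tsupport fun hmem => ?_)
    refine hv ?_
    have h1 := hρ (hψ' hmem)
    rw [mem_closedBall_zero_iff, norm_smul, Real.norm_of_nonneg (by positivity)] at h1
    have hxy : dist x y < 1 := hx.2
    rw [dist_eq_norm] at hxy
    have hx1 : x 0 ≤ y 0 + 1 := by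
      have : |(x - y) 0| ≤ ‖x - y‖ := PiLp.norm_apply_le (x - y) 0
      have h2 := (abs_le.1 (this.trans hxy.le)).2
      simp only [PiLp.sub_apply] at h2
      linarith
    have h2 : ‖tail x - v‖ ≤ |ρ| * ((y 0 + 1) / L) := by
      have : ‖tail x - v‖ = (L / x 0 * ‖tail x - v‖) * (x 0 / L) := by field_simp
      rw [this]
      exact mul_le_mul (h1.trans (le_abs_self ρ)) (by gcongr) (by positivity) (abs_nonneg ρ)
    have h3 : ‖tail x - tail y‖ ≤ ‖(tailL : Euc (n + 1) →L[ℝ] Euc n)‖ := by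
      rw [← tail_sub, ← tailL_apply]
      exact (tailL.le_opNorm _).trans (mul_le_of_le_one_right (norm_nonneg _) hxy.le)
    rw [hC, mem_closedBall_zero_iff, hR]
    calc ‖v‖ = ‖tail y + (tail x - tail y) - (tail x - v)‖ := by congr 1; abel
      _ ≤ ‖tail y‖ + ‖tail x - tail y‖ + ‖tail x - v‖ :=
        (norm_sub_le _ _).trans (by gcongr; exact norm_add_le _ _)
      _ ≤ _ := by gcongr
  have heq : ∀ ψ' : Euc n → ℝ, tsupport ψ' ⊆ tsupport ψ → ∀ x ∈ W,
      mollify L g ψ' x = ∫ v in C, g v * mollifyKernel L ψ' x v := by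
    intro ψ' hψ' x hx
    rw [mollify_eq_kernel hL g ψ' hx.1]
    refine (setIntegral_eq_integral_of_forall_compl_eq_zero fun v hv => ?_).symm
    rw [hsupp ψ' hψ' x hx v hv, mul_zero]
  have hcd := contDiffOn_mollifyKernel (L := L) hψ.1
  obtain ⟨k1, k2⟩ := partialD_integral hg hWo (hcd.mono (Set.prod_mono Set.inter_subset_left
    subset_rfl)) (isCompact_closedBall (0 : Euc n) R) hyW
  have hev : mollify L g ψ =ᶠ[nhds y] fun x => ∫ v in C, g v * mollifyKernel L ψ x v :=
    Filter.eventuallyEq_of_mem (hWo.mem_nhds hyW) fun x hx => heq ψ subset_rfl x hx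
  have hpd : ∀ i, partialD i (mollify L g ψ) y =
      ∫ v in C, g v * partialD i (fun y => mollifyKernel L ψ y v) y := by
    intro i
    rw [← k2 i, partialD, hev.fderiv_eq]
    rfl
  have hkd : ∀ v, DifferentiableAt ℝ (fun y => mollifyKernel L ψ y v) y := by
    intro v
    have h1 : DifferentiableAt ℝ (Function.uncurry (mollifyKernel L ψ)) (y, v) :=
      (hcd.contDiffAt ((isOpen_halfSpace.prod isOpen_univ).mem_nhds
        ⟨hy, Set.mem_univ v⟩)).differentiableAt (by simp)
    exact h1.comp y (by fun_prop : DifferentiableAt ℝ (fun y => (y, v)) y)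
  have htp : ∀ i, tsupport (partialD i ψ) ⊆ tsupport ψ := fun i =>
    tsupport_fderiv_apply_subset ℝ _
  have htd : tsupport (divMul ψ) ⊆ tsupport ψ := by
    refine closure_minimal (fun z hz => ?_) (isClosed_tsupport ψ)
    by_contra hcon
    refine hz ?_
    have h1 : ψ z = 0 := image_eq_zero_of_notMem_tsupport hcon
    have h2 : fderiv ℝ ψ z = 0 :=
      image_eq_zero_of_notMem_tsupport fun h => hcon (tsupport_fderiv_subset ℝ h)
    simp [divMul_eq hψ.1, h1, h2]
  refine ⟨k1.congr_of_eventuallyEq hev, fun i => ?_, ?_⟩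
  · rw [hpd, heq _ (htp i) y hyW, ← integral_const_mul]
    congr 1
    funext v
    rw [(mollifyKernel_partialD hψ.1 hy v (hkd v)).1]
    ring
  · rw [hpd, heq _ htd y hyW, ← integral_const_mul]
    congr 1
    funext v
    rw [(mollifyKernel_partialD hψ.1 hy v (hkd v)).2]
    ring

end Mollify

end

end WeightedSobolev

namespace WeightedSobolev

noncomputable section

/-! ### Derivatives of mollifications of Hölder functions -/

section MollifySymbol

variable {n : ℕ}

/-- `g` has bounded derivatives up to order `r`, and those of order `r` are `λ`-Hölder
continuous. -/
def IsHolderReg (lam : ℝ) : ℕ → (Euc n → ℝ) → Prop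
  | 0, g => Continuous g ∧ (∃ C, ∀ x, |g x| ≤ C) ∧ ∃ C, ∀ x y, |g x - g y| ≤ C * dist x y ^ lam
  | r + 1, g => ContDiff ℝ 1 g ∧ (∃ C, ∀ x, |g x| ≤ C) ∧ ∀ i, IsHolderReg lam r (partialD i g)

theorem IsHolderReg.bounded {lam : ℝ} {r : ℕ} {g : Euc n → ℝ} (h : IsHolderReg lam r g) :
    ∃ C, ∀ x, |g x| ≤ C := by
  cases r with
  | zero => exact h.2.1
  | succ r => exact h.2.1

theorem IsHolderReg.continuous {lam : ℝ} {r : ℕ} {g : Euc n → ℝ} (h : IsHolderReg lam r g) :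
    Continuous g := by
  cases r with
  | zero => exact h.1
  | succ r => exact h.1.continuous

theorem hasCompactSupport_multiD {d : ℕ} {f : Euc d → ℝ} (hf : HasCompactSupport f)
    (α : Fin d → ℕ) : HasCompactSupport (multiD α f) := by
  unfold multiD
  induction List.finRange d with
  | nil => exact hf
  | cons i l ih =>
    rw [List.foldr_cons]
    generalize α i = m
    induction m with
    | zero => exact ih
    | succ m ihm =>
      rw [Function.iterate_succ_apply']
      exact ihm.fderiv_apply ℝ _

theorem MemCcHolder.isHolderReg_multiD {ℓ : ℕ} {lam : ℝ≥0} {h : Euc n → ℝ}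
    (hh : MemCcHolder ℓ lam h) {r : ℕ} {α : Fin n → ℕ} (hα : ∑ i, α i + r = ℓ) :
    IsHolderReg lam r (multiD α h) := by
  have hcd : ∀ {r : ℕ} {α : Fin n → ℕ}, ∑ i, α i + r = ℓ → ContDiff ℝ r (multiD α h) := by
    intro r α hα
    exact contDiff_multiD α (by rw [hα]; exact hh.contDiff)
  have hb : ∀ {r : ℕ} {α : Fin n → ℕ}, ∑ i, α i + r = ℓ → ∃ C, ∀ x, |multiD α h x| ≤ C :=
    fun hα => (hasCompactSupport_multiD hh.hasCompactSupport _).exists_bound_of_continuous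
      (hcd hα).continuous
  induction r generalizing α with
  | zero =>
    refine ⟨(hcd hα).continuous, hb hα, ?_⟩
    have h1 := hh.holder (MIdx.ofFun α (by omega))
    rw [MIdx.val_ofFun, eHolderNorm_lt_top] at h1
    obtain ⟨C, hC⟩ := h1
    exact ⟨C, fun x y => by simpa [Real.dist_eq] using hC.dist_le x y⟩
  | succ r ih =>
    refine ⟨(hcd hα).of_le (by norm_cast; omega), hb hα, fun i => ?_⟩
    have h1 : ContDiff ℝ ((∑ i, α i) + 1 : ℕ) h := hh.contDiff.of_le (by norm_cast; omega)
    rw [← multiD_partialD α i h1, ← multiD_add_single α i h1]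
    refine ih ?_
    simp only [Pi.add_apply, Finset.sum_add_distrib, Finset.sum_pi_single', Finset.mem_univ,
      if_true]
    omega

theorem MemCcHolder.isHolderReg {ℓ : ℕ} {lam : ℝ≥0} {h : Euc n → ℝ}
    (hh : MemCcHolder ℓ lam h) : IsHolderReg lam ℓ h := by
  have := hh.isHolderReg_multiD (α := 0) (r := ℓ) (by simp)
  rwa [multiD_zero] at this

theorem abs_mollify_le {L C : ℝ} {g ψ : Euc n → ℝ} (hψ : IsTest Set.univ ψ)
    (hC : ∀ x, |g x| ≤ C) (y : Euc (n + 1)) : |mollify L g ψ y| ≤ C * ∫ z, |ψ z| := by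
  rw [← integral_const_mul]
  refine norm_integral_le_of_norm_le (f := fun z => g (tail y - (y 0 / L) • z) * ψ z)
    (hψ.integrable.abs.const_mul C)
    (Filter.Eventually.of_forall fun z => ?_)
  rw [Real.norm_eq_abs, abs_mul]
  gcongr
  exact hC _

/-- Since ψ has mean zero, g(ỹ) may be subtracted under the integral, and the increment of g over
the distance y₀|z| / L is of size y₀^λ. -/
theorem abs_mollify_le_rpow {L C lam : ℝ} (hL : 0 < L) (hlam : 0 ≤ lam) {g ψ : Euc n → ℝ}
    (hg : Continuous g) (hψ : IsTest Set.univ ψ) (h0 : ∫ z, ψ z = 0)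
    (hC : ∀ x y, |g x - g y| ≤ C * dist x y ^ lam) :
    ∃ D, ∀ y ∈ halfSpace n, |mollify L g ψ y| ≤ D * y 0 ^ lam := by
  have hψc := hψ.1.continuous
  have hint : Integrable fun z => |ψ z| * ‖z‖ ^ lam := by
    refine Continuous.integrable_of_hasCompactSupport ?_ (hψ.2.1.abs.mul_right)
    exact hψc.abs.mul (continuous_norm.rpow_const fun _ => Or.inr hlam)
  refine ⟨C / L ^ lam * ∫ z, |ψ z| * ‖z‖ ^ lam, fun y hy => ?_⟩
  have hy0 : 0 < y 0 := hy
  have e : mollify L g ψ y = ∫ z, (g (tail y - (y 0 / L) • z) - g (tail y)) * ψ z := by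
    simp only [sub_mul]
    rw [integral_sub, integral_const_mul, h0, mul_zero, sub_zero, mollify]
    · refine Continuous.integrable_of_hasCompactSupport (by fun_prop) hψ.2.1.mul_left
    · exact hψ.integrable.const_mul _
  rw [e, mul_right_comm, ← integral_const_mul]
  refine norm_integral_le_of_norm_le
    (f := fun z => (g (tail y - (y 0 / L) • z) - g (tail y)) * ψ z) (hint.const_mul _) (Filter.Eventually.of_forall fun z => ?_)
  rw [Real.norm_eq_abs, abs_mul]
  have h1 := hC (tail y - (y 0 / L) • z) (tail y)
  rw [dist_eq_norm, sub_sub_cancel_left, norm_neg, norm_smul, Real.norm_of_nonneg (by positivity),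
    Real.mul_rpow (by positivity) (norm_nonneg _), Real.div_rpow hy0.le hL.le] at h1
  calc _ ≤ C * (y 0 ^ lam / L ^ lam * ‖z‖ ^ lam) * |ψ z| := by gcongr
    _ = _ := by ring

/-- The first derivatives are smooth multiples of mollifications with other test functions, so
induction over all ψ at once applies. -/
theorem contDiffOn_mollify {L : ℝ} (hL : 0 < L) {g : Euc n → ℝ} (hg : Continuous g)
    {ψ : Euc n → ℝ} (hψ : IsTest Set.univ ψ) : ContDiffOn ℝ ∞ (mollify L g ψ) (halfSpace n) := by
  rw [contDiffOn_infty]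
  intro N
  have hinv : ∀ c : ℝ, ContDiffOn ℝ ∞ (fun y : Euc (n + 1) => c / y 0) (halfSpace n) := fun c =>
    contDiffOn_const.div (ContDiff.contDiffOn (by fun_prop)) fun y hy => ne_of_gt hy
  induction N generalizing ψ with
  | zero =>
    exact (contDiff_zero.2 (continuous_mollify hg hψ)).contDiffOn
  | succ N ih =>
    refine contDiffOn_succ_of_partialD isOpen_halfSpace
      (fun y hy => (mollify_differentiable hL hg hψ hy).1.differentiableWithinAt) fun i => ?_
    refine Fin.cases ?_ (fun i => ?_) i
    · refine ContDiffOn.congr (f := fun y => -1 / y 0 * mollify L g (divMul ψ) y) ?_ fun y hy => ?_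
      · exact ((hinv (-1)).of_le (by exact_mod_cast le_top)).mul (ih hψ.divMul)
      · rw [(mollify_differentiable hL hg hψ hy).2.2, neg_div]
    · refine ContDiffOn.congr (f := fun y => L / y 0 * mollify L g (partialD i ψ) y) ?_
        fun y hy => (mollify_differentiable hL hg hψ hy).2.1 i
      exact ((hinv L).of_le (by exact_mod_cast le_top)).mul (ih (isTest_partialD hψ i))

theorem mollify_const_mul (L : ℝ) (g ψ : Euc n → ℝ) (c : ℝ) (y : Euc (n + 1)) :
    mollify L g (fun z => c * ψ z) y = c * mollify L g ψ y := by
  simp only [mollify, ← integral_const_mul]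
  congr 1
  funext z
  ring

theorem mollify_add (L : ℝ) {g ψ ψ' : Euc n → ℝ} (hg : Continuous g) (hψ : IsTest Set.univ ψ)
    (hψ' : IsTest Set.univ ψ') (y : Euc (n + 1)) :
    mollify L g (fun z => ψ z + ψ' z) y = mollify L g ψ y + mollify L g ψ' y := by
  have hint : ∀ {ψ}, IsTest Set.univ ψ →
      Integrable fun z => g (tail y - (y 0 / L) • z) * ψ z := fun {ψ} hψ => by
    have := hψ.1.continuous
    exact Continuous.integrable_of_hasCompactSupport (by fun_prop) hψ.2.1.mul_left
  simp only [mollify, mul_add]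
  exact integral_add (hint hψ) (hint hψ')

theorem IsTest.const_mul {d : ℕ} {O : Set (Euc d)} {ψ : Euc d → ℝ} (h : IsTest O ψ) (c : ℝ) :
    IsTest O fun z => c * ψ z :=
  ⟨contDiff_const.mul h.1, h.2.1.mul_left (f := fun _ => c),
    (tsupport_mul_subset_right (f := fun _ => c)).trans h.2.2⟩

/-- The derivatives of `y₀^{-j} ∫ g(ỹ - (y₀ / L) z) ψ(z) dz`. -/
theorem partialD_inv_pow_mul_mollify {L : ℝ} (hL : 0 < L) {g ψ : Euc n → ℝ} (hg : Continuous g)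
    (hψ : IsTest Set.univ ψ) (j : ℕ) {y : Euc (n + 1)} (hy : y ∈ halfSpace n) :
    (∀ i : Fin n, partialD i.succ (fun y => (y 0)⁻¹ ^ j * mollify L g ψ y) y =
      (y 0)⁻¹ ^ (j + 1) * mollify L g (fun z => L * partialD i ψ z) y) ∧
    partialD 0 (fun y => (y 0)⁻¹ ^ j * mollify L g ψ y) y =
      (y 0)⁻¹ ^ (j + 1) * mollify L g (fun z => -j * ψ z + -1 * divMul ψ z) y := by
  have hy0 : 0 < y 0 := hy
  obtain ⟨h1, h2, h3⟩ := mollify_differentiable hL hg hψ hy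
  have h0 : HasFDerivAt (fun y : Euc (n + 1) => y 0)
      (EuclideanSpace.proj 0 : Euc (n + 1) →L[ℝ] ℝ) y :=
    (EuclideanSpace.proj 0 : Euc (n + 1) →L[ℝ] ℝ).hasFDerivAt
  have h4 : HasFDerivAt (fun y : Euc (n + 1) => (y 0)⁻¹ ^ j)
      ((-j * (y 0)⁻¹ ^ (j + 1)) • (EuclideanSpace.proj 0 : Euc (n + 1) →L[ℝ] ℝ)) y := by
    have e : HasDerivAt (fun t : ℝ => t⁻¹ ^ j) (-j * (y 0)⁻¹ ^ (j + 1)) (y 0) := by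
      refine ((hasDerivAt_inv hy0.ne').pow j).congr_deriv ?_
      rcases Nat.eq_zero_or_pos j with hj | hj
      · subst hj; simp
      · obtain ⟨m, rfl⟩ : ∃ m, j = m + 1 := ⟨j - 1, by omega⟩
        simp only [Nat.add_sub_cancel, inv_pow]
        field_simp
        ring
    exact HasDerivAt.comp_hasFDerivAt (h₂ := fun t : ℝ => t⁻¹ ^ j)
      (f := fun y : Euc (n + 1) => y 0) y e h0
  have hpd : ∀ i, partialD i (fun y => (y 0)⁻¹ ^ j * mollify L g ψ y) y =
      -j * (y 0)⁻¹ ^ (j + 1) * (EuclideanSpace.single i (1 : ℝ) : Euc (n + 1)) 0 *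
        mollify L g ψ y + (y 0)⁻¹ ^ j * partialD i (mollify L g ψ) y := by
    intro i
    have := partialD_smul (i := i) h4.differentiableAt h1
    simp only [smul_eq_mul] at this
    rw [this, partialD, h4.fderiv]
    rfl
  constructor
  · intro i
    rw [hpd, h2, mollify_const_mul]
    simp
    ring
  · rw [hpd, h3, mollify_add L hg (hψ.const_mul _) (hψ.divMul.const_mul _), mollify_const_mul,
      mollify_const_mul]
    simp
    ring

/-- Functions y₀^{-j} times a mollification are closed under differentiation with j replaced by j +
1 and a mollifier of mean zero. For j ≥ 1 the mean zero gives size y₀^{-(j - λ)} near the boundary,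
which is the exponent for order ℓ + j with s = ℓ + λ. For j = 0 boundedness is enough and no
cancellation is needed. -/
theorem isSymbol_inv_pow_mul_mollify {ℓ : ℕ} {lam L : ℝ} (hL : 0 < L) (hlam : 0 ≤ lam)
    (hlam1 : lam ≤ 1) {g : Euc n → ℝ} (hg : IsHolderReg lam 0 g) (N : ℕ) {j : ℕ}
    {ψ : Euc n → ℝ} (hψ : IsTest Set.univ ψ) (h0 : j = 0 ∨ ∫ z, ψ z = 0) :
    IsSymbol (ℓ + lam) N (ℓ + j) fun y => (y 0)⁻¹ ^ j * mollify L g ψ y := by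
  obtain ⟨hgc, ⟨C, hC⟩, C', hC'⟩ := hg
  have key : ∀ {j : ℕ} {ψ : Euc n → ℝ}, IsTest Set.univ ψ → (j = 0 ∨ ∫ z, ψ z = 0) →
      ContDiffOn ℝ ∞ (fun y => (y 0)⁻¹ ^ j * mollify L g ψ y) (halfSpace n) ∧
      ∃ C, ∀ y ∈ halfSpace n, |(y 0)⁻¹ ^ j * mollify L g ψ y| ≤
        C * min (y 0) 1 ^ (-max ((ℓ + j : ℕ) - (ℓ + lam)) 0) := by
    intro j ψ hψ h0
    refine ⟨?_, ?_⟩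
    · refine ContDiffOn.mul (ContDiffOn.pow (ContDiffOn.inv (ContDiff.contDiffOn (by fun_prop))
        fun y hy => ne_of_gt hy) j) (contDiffOn_mollify hL hgc hψ)
    · set I := ∫ z, |ψ z|
      have hI : 0 ≤ I := integral_nonneg fun z => abs_nonneg _
      have hCn : 0 ≤ C := (abs_nonneg _).trans (hC 0)
      have hb := abs_mollify_le (L := L) hψ hC
      rcases Nat.eq_zero_or_pos j with hj | hj
      · subst hj
        refine ⟨C * I, fun y hy => ?_⟩
        rw [pow_zero, one_mul]
        exact (hb y).trans (le_mul_of_one_le_right (by positivity) (one_le_min_rpow hy _))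
      · obtain ⟨D, hD⟩ := abs_mollify_le_rpow hL hlam hgc hψ (h0.resolve_left (by omega)) hC'
        have hj1 : (1 : ℝ) ≤ j := by exact_mod_cast hj
        refine ⟨max (C * I) D, fun y hy => ?_⟩
        have hy0 : 0 < y 0 := hy
        have hM : 0 ≤ max (C * I) D := le_max_of_le_left (by positivity)
        rw [abs_mul, abs_of_pos (by positivity)]
        rcases le_total 1 (y 0) with h1 | h1
        · rw [min_eq_right h1, Real.one_rpow, mul_one]
          calc _ ≤ 1 * (C * I) := mul_le_mul
                (pow_le_one₀ (by positivity) (inv_le_one_of_one_le₀ h1)) (hb y) (abs_nonneg _)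
                zero_le_one
            _ ≤ _ := by rw [one_mul]; exact le_max_left _ _
        · rw [min_eq_left h1, max_eq_left (a := ((ℓ + j : ℕ) : ℝ) - (ℓ + lam))
            (by push_cast; linarith)]
          have e : y 0 ^ (-(((ℓ + j : ℕ) : ℝ) - (ℓ + lam))) = (y 0)⁻¹ ^ j * y 0 ^ lam := by
            rw [show -(((ℓ + j : ℕ) : ℝ) - (ℓ + lam)) = -(j : ℝ) + lam by push_cast; ring,
              Real.rpow_add hy0, Real.rpow_neg hy0.le, Real.rpow_natCast, inv_pow]
          rw [e, mul_left_comm]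
          refine mul_le_mul_of_nonneg_left ((hD y hy).trans ?_) (by positivity)
          gcongr
          exact le_max_right _ _
  induction N generalizing j ψ with
  | zero => exact key hψ h0
  | succ N ih =>
    refine ⟨key hψ h0, fun i => ?_⟩
    refine Fin.cases ?_ (fun i => ?_) i
    · refine (ih (j := j + 1) (ψ := fun z => -j * ψ z + -1 * divMul ψ z)
        ((hψ.const_mul _).add (hψ.divMul.const_mul _)) (Or.inr ?_)).congr fun y hy =>
        ((partialD_inv_pow_mul_mollify hL hgc hψ j hy).2).symm
      rw [integral_add (hψ.integrable.const_mul _) (hψ.divMul.integrable.const_mul _),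
        integral_const_mul, integral_const_mul, hψ.integral_divMul]
      -- The new mollifier has mean -j ∫ψ, which vanishes because either j = 0 or ∫ψ = 0.
      rcases h0 with h0 | h0 <;> simp [h0]
    · refine (ih (j := j + 1) (ψ := fun z => L * partialD i ψ z)
        ((isTest_partialD hψ i).const_mul _) (Or.inr ?_)).congr fun y hy =>
        ((partialD_inv_pow_mul_mollify hL hgc hψ j hy).1 i).symm
      have := hψ.integral_partialD i
      rw [setIntegral_univ] at this
      rw [integral_const_mul, this, mul_zero]

/-- Here m derivatives have already been spent and r are left for g. While r > 0 they are put on g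
and everything stays bounded; for r = 0 only Hölder continuity remains and the singular estimates
take over. -/
theorem IsHolderReg.isSymbol_mollify {ℓ r m : ℕ} {lam L : ℝ} (hL : 0 < L) (hlam : 0 ≤ lam)
    (hlam1 : lam ≤ 1) (hm : m + r = ℓ) {g : Euc n → ℝ} (hg : IsHolderReg lam r g) (N : ℕ)
    {ψ : Euc n → ℝ} (hψ : IsTest Set.univ ψ) :
    IsSymbol (ℓ + lam) N m (mollify L g ψ) := by
  induction r generalizing m g ψ N with
  | zero =>
    have := isSymbol_inv_pow_mul_mollify (ℓ := ℓ) hL hlam hlam1 hg N (j := 0) hψ (Or.inl rfl)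
    simp only [pow_zero, one_mul, add_zero] at this
    rwa [show m = ℓ from hm]
  | succ r ih =>
    have key : ContDiffOn ℝ ∞ (mollify L g ψ) (halfSpace n) ∧
      ∃ C, ∀ y ∈ halfSpace n, |mollify L g ψ y| ≤
        C * min (y 0) 1 ^ (-max (m - (ℓ + lam)) 0) := by
      refine ⟨contDiffOn_mollify hL hg.continuous hψ, ?_⟩
      obtain ⟨C, hC⟩ := hg.bounded
      have hCn : 0 ≤ C := (abs_nonneg _).trans (hC 0)
      refine ⟨C * ∫ z, |ψ z|, fun y hy => (abs_mollify_le hψ hC y).trans ?_⟩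
      exact le_mul_of_one_le_right (mul_nonneg hCn (integral_nonneg fun z => abs_nonneg _))
        (one_le_min_rpow hy _)
    cases N with
    | zero => exact key
    | succ N =>
      refine ⟨key, fun i => ?_⟩
      have hd := fun y => mollify_differentiable_of_contDiff (L := L) hg.1 hψ y
      refine Fin.cases ?_ (fun i => ?_) i
      · refine IsSymbol.congr (a := fun y => ∑ i, mollify L (partialD i g)
          (fun z => -(1 / L) * (ψ z * z i)) y) (IsSymbol.sum _ fun i _ => ?_) fun y _ => ?_
        · exact ih (m := m + 1) (by omega) (hg.2.2 i) N ((hψ.mul_coord i).const_mul _)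
        · rw [(hd y).2.2]
          exact Finset.sum_congr rfl fun i _ => mollify_const_mul _ _ _ _ _
      · exact (ih (m := m + 1) (by omega) (hg.2.2 i) N hψ).congr fun y _ => ((hd y).2.1 i).symm

theorem MemCcHolder.isSmoothSymbol_partialD_mollify {ℓ : ℕ} {lam : ℝ≥0} (hlam : lam ≤ 1)
    {h : Euc n → ℝ} (hh : MemCcHolder ℓ lam h) {L : ℝ} (hL : 0 < L) {ψ : Euc n → ℝ}
    (hψ : IsTest Set.univ ψ) (j : Fin (n + 1)) :
    IsSmoothSymbol (ℓ + lam) 1 (partialD j (mollify L h ψ)) := fun N =>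
  (hh.isHolderReg.isSymbol_mollify hL lam.2 (by exact_mod_cast hlam) (Nat.zero_add ℓ) (N + 1)
    hψ).2 j

end MollifySymbol

end

end WeightedSobolev

namespace WeightedSobolev

noncomputable section

/-! ### Shear maps -/

section Shear

variable {n : ℕ}

theorem norm_sq_eq_tail (y : Euc (n + 1)) : ‖y‖ ^ 2 = y 0 ^ 2 + ‖tail y‖ ^ 2 := by
  simp [EuclideanSpace.norm_sq_eq, Fin.sum_univ_succ]

theorem norm_tail_le (y : Euc (n + 1)) : ‖tail y‖ ≤ ‖y‖ := by
  have := norm_sq_eq_tail y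
  nlinarith [norm_nonneg y, norm_nonneg (tail y), sq_nonneg (y 0)]

theorem abs_zero_le (y : Euc (n + 1)) : |y 0| ≤ ‖y‖ := PiLp.norm_apply_le y 0

theorem norm_le_abs_add (y : Euc (n + 1)) : ‖y‖ ≤ |y 0| + ‖tail y‖ := by
  have := norm_sq_eq_tail y
  have h := sq_abs (y 0)
  nlinarith [norm_nonneg y, norm_nonneg (tail y), abs_nonneg (y 0)]

theorem ext_tail {x y : Euc (n + 1)} (h0 : x 0 = y 0) (h : tail x = tail y) : x = y := by
  ext i
  refine Fin.cases h0 (fun i => ?_) i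
  have := congrArg (fun z : Euc n => z i) h
  simpa using this

/-- `y ↦ y + m(y) e₁`. -/
def shear (m : Euc (n + 1) → ℝ) (y : Euc (n + 1)) : Euc (n + 1) := y + m y • e₁ n

@[simp] theorem shear_apply_zero (m : Euc (n + 1) → ℝ) (y : Euc (n + 1)) :
    shear m y 0 = y 0 + m y := by simp [shear]

@[simp] theorem tail_shear (m : Euc (n + 1) → ℝ) (y : Euc (n + 1)) :
    tail (shear m y) = tail y := by simp [shear, tail_add, tail_smul]

/-- The inverse of the derivative of `shear m` at `y`. -/
def shearInvDeriv (m : Euc (n + 1) → ℝ) (y : Euc (n + 1)) : Euc (n + 1) →L[ℝ] Euc (n + 1) :=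
  ContinuousLinearMap.id ℝ _ - (1 + fderiv ℝ m y (e₁ n))⁻¹ • (fderiv ℝ m y).smulRight (e₁ n)

/-- `m` is Lipschitz continuous, with constant `1/2` in the first variable. -/
def IsShear (K : ℝ≥0) (m : Euc (n + 1) → ℝ) : Prop :=
  ∀ y y', |m y - m y'| ≤ K * ‖tail y - tail y'‖ + 1 / 2 * |y 0 - y' 0|

namespace IsShear

variable {K : ℝ≥0} {m : Euc (n + 1) → ℝ}

theorem lipschitzWith_shear (h : IsShear K m) : LipschitzWith (K + 2) (shear m) := by
  refine LipschitzWith.of_dist_le_mul fun y y' => ?_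
  rw [dist_eq_norm, dist_eq_norm]
  have h1 := h y y'
  have h2 := abs_zero_le (y - y')
  have h3 := norm_tail_le (y - y')
  rw [tail_sub] at h3
  rw [PiLp.sub_apply] at h2
  have e : shear m y - shear m y' = (y - y') + (m y - m y') • e₁ n := by
    simp only [shear, sub_smul]
    abel
  have h4 : ‖(m y - m y') • e₁ n‖ = |m y - m y'| := by
    rw [norm_smul, e₁, PiLp.norm_single, norm_one, mul_one, Real.norm_eq_abs]
  rw [e]
  have h5 := norm_add_le (y - y') ((m y - m y') • e₁ n)
  rw [h4] at h5
  have h6 : (K : ℝ) * ‖tail y - tail y'‖ ≤ K * ‖y - y'‖ := by gcongr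
  push_cast
  nlinarith [norm_nonneg (y - y')]

/-- The constant 1/2 allows absorption: |y₀ - y₀'| is at most twice (1 + K) times the distance of
the images. Adding the tangential part, which the shear does not change, gives 2K + 3. -/
theorem norm_sub_le (h : IsShear K m) (y y' : Euc (n + 1)) :
    ‖y - y'‖ ≤ (2 * K + 3) * ‖shear m y - shear m y'‖ := by
  have h1 := h y y'
  have h2 := abs_zero_le (shear m y - shear m y')
  have h3 := norm_tail_le (shear m y - shear m y')
  rw [tail_sub, tail_shear, tail_shear] at h3
  rw [PiLp.sub_apply, shear_apply_zero, shear_apply_zero] at h2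
  have h4 := norm_le_abs_add (y - y')
  rw [PiLp.sub_apply, tail_sub] at h4
  have h5 : |y 0 - y' 0| ≤ |y 0 + m y - (y' 0 + m y')| + |m y - m y'| := by
    rw [show y 0 - y' 0 = (y 0 + m y - (y' 0 + m y')) - (m y - m y') by ring]
    exact abs_sub _ _
  have h6 : (K : ℝ) * ‖tail y - tail y'‖ ≤ K * ‖shear m y - shear m y'‖ := by gcongr
  nlinarith

theorem injective (h : IsShear K m) : Function.Injective (shear m) := fun y y' e => by
  have := h.norm_sub_le y y'
  rw [e, sub_self, norm_zero, mul_zero] at this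
  exact sub_eq_zero.1 (norm_le_zero_iff.1 this)

/-- On each vertical line t ↦ t + m(t, ỹ) is strictly increasing, so the sign of t is seen by
comparison with the value at t = 0. -/
theorem pos_iff (h : IsShear K m) (y : Euc (n + 1)) :
    0 < y 0 ↔ m (cons 0 (tail y)) < y 0 + m y := by
  have h1 := h (cons 0 (tail y)) y
  have e0 : (cons 0 (tail y) : Euc (n + 1)) 0 = 0 := rfl
  have et : tail (cons 0 (tail y) : Euc (n + 1)) = tail y := rfl
  rw [e0, et, sub_self, norm_zero, mul_zero, zero_add, zero_sub, abs_neg] at h1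
  have h2 := abs_le.1 h1
  constructor
  · intro hy
    rw [abs_of_pos hy] at h2
    linarith
  · intro hy
    by_contra hcon
    rw [abs_of_nonpos (not_lt.1 hcon)] at h2
    linarith [not_lt.1 hcon]

theorem half_le (h : IsShear K m) (hm : ContDiff ℝ 1 m) (y : Euc (n + 1)) :
    1 / 2 ≤ 1 + fderiv ℝ m y (e₁ n) := by
  have h1 : HasDerivAt (fun t : ℝ => m (y + t • e₁ n)) (fderiv ℝ m y (e₁ n)) 0 :=
    (hm.differentiable (by simp) y).hasFDerivAt.hasLineDerivAt (e₁ n)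
  have h2 : LipschitzWith (1 / 2) fun t : ℝ => m (y + t • e₁ n) := by
    refine LipschitzWith.of_dist_le_mul fun t t' => ?_
    have := h (y + t • e₁ n) (y + t' • e₁ n)
    simpa [tail_add, tail_smul, Real.dist_eq] using this
  have h3 := norm_deriv_le_of_lipschitz (x₀ := 0) h2
  rw [h1.deriv, Real.norm_eq_abs] at h3
  have := (abs_le.1 h3).1
  push_cast at this
  linarith

theorem hasFDerivAt_shear (hm : ContDiff ℝ 1 m) (y : Euc (n + 1)) :
    HasFDerivAt (shear m) (ContinuousLinearMap.id ℝ _ + (fderiv ℝ m y).smulRight (e₁ n)) y :=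
  (hasFDerivAt_id y).add ((hm.differentiable (by simp) y).hasFDerivAt.smul_const (e₁ n))

theorem shearInvDeriv_apply (y v : Euc (n + 1)) :
    shearInvDeriv m y v = v - ((1 + fderiv ℝ m y (e₁ n))⁻¹ * fderiv ℝ m y v) • e₁ n := by
  simp [shearInvDeriv, smul_smul]

theorem shearInvDeriv_e₁ (h : IsShear K m) (hm : ContDiff ℝ 1 m) (y : Euc (n + 1)) :
    shearInvDeriv m y (e₁ n) = (1 + fderiv ℝ m y (e₁ n))⁻¹ • e₁ n := by
  have h0 : 1 + fderiv ℝ m y (e₁ n) ≠ 0 := by linarith [h.half_le hm y]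
  rw [shearInvDeriv_apply]
  conv_lhs => enter [1]; rw [← one_smul ℝ (e₁ n)]
  rw [← sub_smul]
  congr 1
  field_simp
  ring

theorem shearInvDeriv_comp (h : IsShear K m) (hm : ContDiff ℝ 1 m) (y v : Euc (n + 1)) :
    shearInvDeriv m y (v + fderiv ℝ m y v • e₁ n) = v := by
  have h0 : 1 + fderiv ℝ m y (e₁ n) ≠ 0 := by linarith [h.half_le hm y]
  rw [map_add, map_smul, shearInvDeriv_e₁ h hm, shearInvDeriv_apply, smul_smul, sub_add,
    ← sub_smul, mul_comm, sub_self, zero_smul, sub_zero]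

variable {G : Euc (n + 1) → Euc (n + 1)}

theorem lipschitzWith_inv (h : IsShear K m) (hG : ∀ x, shear m (G x) = x) :
    LipschitzWith (2 * K + 3) G := by
  refine LipschitzWith.of_dist_le_mul fun x x' => ?_
  have := h.norm_sub_le (G x) (G x')
  rw [hG, hG] at this
  simpa [dist_eq_norm] using this

theorem inv_shear (h : IsShear K m) (hG : ∀ x, shear m (G x) = x) (y : Euc (n + 1)) :
    G (shear m y) = y := h.injective (hG _)

theorem hasFDerivAt_inv (h : IsShear K m) (hm : ContDiff ℝ 1 m) (hG : ∀ x, shear m (G x) = x)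
    (x : Euc (n + 1)) : HasFDerivAt G (shearInvDeriv m (G x)) x := by
  refine (HasFDerivAt.of_comp_of_leftInverse (f'symm := shearInvDeriv m (G x)) (h.lipschitzWith_inv hG).continuous.continuousAt
    (hasFDerivAt_shear hm (G x)) (hasFDerivAt_id x)
    (Filter.Eventually.of_forall fun y => hG y) (fun v => ?_)).congr_fderiv
    (ContinuousLinearMap.comp_id _)
  exact h.shearInvDeriv_comp hm (G x) v

theorem contDiffOn_shearInvDeriv (h : IsShear K m) (hm : ContDiff ℝ 1 m) {W : Set (Euc (n + 1))}
    {r : ℕ∞ω} (hW : ContDiffOn ℝ r (fderiv ℝ m) W) : ContDiffOn ℝ r (shearInvDeriv m) W := by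
  have h0 : ∀ y, 1 + fderiv ℝ m y (e₁ n) ≠ 0 := fun y => by linarith [h.half_le hm y]
  have h1 : ContDiffOn ℝ r (fun y => (1 + fderiv ℝ m y (e₁ n))⁻¹) W :=
    (contDiffOn_const.add (hW.clm_apply contDiffOn_const)).inv fun y _ => h0 y
  exact contDiffOn_const.sub (h1.smul (hW.smulRight contDiffOn_const))

theorem contDiff_inv (h : IsShear K m) (hm : ContDiff ℝ 1 m) (hG : ∀ x, shear m (G x) = x) :
    ContDiff ℝ 1 G := by
  rw [contDiff_one_iff_fderiv]
  refine ⟨fun x => (h.hasFDerivAt_inv hm hG x).differentiableAt, ?_⟩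
  rw [show fderiv ℝ G = fun x => shearInvDeriv m (G x) from
    funext fun x => (h.hasFDerivAt_inv hm hG x).fderiv]
  have h1 : ContDiffOn ℝ 0 (fderiv ℝ m) Set.univ :=
    (hm.fderiv_right (m := 0) (by simp)).contDiffOn
  exact (contDiffOn_univ.1 (h.contDiffOn_shearInvDeriv hm h1)).continuous.comp
    (h.lipschitzWith_inv hG).continuous

/-- Bootstrap from DG = (D shear)⁻¹ ∘ G: if G is C^N and m is smooth on U, the right-hand side is
C^N. -/
theorem contDiffOn_inv (h : IsShear K m) (hm : ContDiff ℝ 1 m) (hG : ∀ x, shear m (G x) = x)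
    {U W : Set (Euc (n + 1))} (hU : IsOpen U) (hW : IsOpen W) (hGW : Set.MapsTo G W U)
    (hmU : ContDiffOn ℝ ∞ m U) : ContDiffOn ℝ ∞ G W := by
  have h1 : ContDiffOn ℝ ∞ (shearInvDeriv m) U :=
    h.contDiffOn_shearInvDeriv hm (hmU.fderiv_of_isOpen hU (by simp))
  rw [contDiffOn_infty]
  intro N
  induction N with
  | zero => exact (contDiff_zero.2 (h.lipschitzWith_inv hG).continuous).contDiffOn
  | succ N ih =>
    push_cast
    rw [contDiffOn_succ_iff_fderiv_of_isOpen hW]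
    refine ⟨fun x _ => (h.hasFDerivAt_inv hm hG x).differentiableAt.differentiableWithinAt,
      by simp, ?_⟩
    rw [show fderiv ℝ G = shearInvDeriv m ∘ G from
      funext fun x => (h.hasFDerivAt_inv hm hG x).fderiv]
    exact (h1.of_le (by exact_mod_cast le_top)).comp ih hGW

end IsShear

end Shear

end

end WeightedSobolev

namespace WeightedSobolev

noncomputable section

/-! ### Bi-Lipschitz diffeomorphisms and weights -/

section BiLip

variable {d : ℕ}

/-- `χ` is a bi-Lipschitz `C¹`-diffeomorphism of the whole space that restricts to a smooth
diffeomorphism of `V` onto `V'`. -/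
structure IsBiLipDiffeo (C : ℝ≥0) (V V' : Set (Euc d)) (χ θ : Euc d → Euc d) : Prop
    extends IsSmoothDiffeo V V' χ θ where
  lipschitz : LipschitzWith C χ
  lipschitz_inv : LipschitzWith C θ
  leftInverse : Function.LeftInverse θ χ
  rightInverse : Function.RightInverse θ χ
  contDiff_one : ContDiff ℝ 1 χ
  contDiff_one_inv : ContDiff ℝ 1 θ

/-- A bound for the determinants of the linear maps of norm at most `C`. -/
theorem exists_abs_det_le (d : ℕ) (C : ℝ) :
    ∃ D : ℝ, ∀ A : Euc d →L[ℝ] Euc d, ‖A‖ ≤ C → |A.det| ≤ D := by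
  obtain ⟨D, hD⟩ := (isCompact_closedBall (0 : Euc d →L[ℝ] Euc d) C).exists_bound_of_continuousOn
    (f := fun A => A.det) ContinuousLinearMap.continuous_det.continuousOn
  exact ⟨D, fun A hA => hD A (by simpa using hA)⟩

/-- For γ < 0 the power reverses the inequality, so both comparisons between a and b are needed. -/
theorem rpow_le_mul_rpow {a b C : ℝ} (hC : 1 ≤ C) (ha : 0 < a) (hb : 0 < b) (hab : a ≤ C * b)
    (hba : b ≤ C * a) (γ : ℝ) : a ^ γ ≤ C ^ |γ| * b ^ γ := by
  have hC0 : 0 < C := by linarith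
  rcases le_total 0 γ with hγ | hγ
  · rw [abs_of_nonneg hγ, ← Real.mul_rpow hC0.le hb.le]
    exact Real.rpow_le_rpow ha.le hab hγ
  · rw [abs_of_nonpos hγ]
    have h1 := Real.rpow_le_rpow_of_nonpos hb hba hγ
    rw [Real.mul_rpow hC0.le ha.le] at h1
    calc a ^ γ = C ^ (-γ) * (C ^ γ * a ^ γ) := by
          rw [← mul_assoc, ← Real.rpow_add hC0, neg_add_cancel, Real.rpow_zero, one_mul]
      _ ≤ _ := by gcongr

theorem lintegral_weightedMeasure (O : Set (Euc d)) (γ : ℝ) (F : Euc d → ℝ≥0∞) :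
    ∫⁻ y, F y ∂weightedMeasure O γ =
      ∫⁻ y in O, F y * ENNReal.ofReal (Metric.infDist y (frontier O) ^ γ) := by
  have hm : Measurable fun y => ENNReal.ofReal (Metric.infDist y (frontier O) ^ γ) :=
    ((Metric.continuous_infDist_pt _).measurable.pow_const γ).ennreal_ofReal
  rw [weightedMeasure, lintegral_withDensity_eq_lintegral_mul_non_measurable _ hm
    (Filter.Eventually.of_forall fun y => ENNReal.ofReal_lt_top)]
  simp only [Pi.mul_apply, mul_comm]

namespace IsBiLipDiffeo

variable {C : ℝ≥0} {V V' : Set (Euc d)} {χ θ : Euc d → Euc d}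

theorem symm (H : IsBiLipDiffeo C V V' χ θ) : IsBiLipDiffeo C V' V θ χ :=
  ⟨H.toIsSmoothDiffeo.symm, H.3, H.2, H.5, H.4, H.7, H.6⟩

/-- The homeomorphism of the whole space. -/
def homeomorph (H : IsBiLipDiffeo C V V' χ θ) : Euc d ≃ₜ Euc d where
  toFun := χ
  invFun := θ
  left_inv := H.leftInverse
  right_inv := H.rightInverse
  continuous_toFun := H.lipschitz.continuous
  continuous_invFun := H.lipschitz_inv.continuous

theorem image_frontier (H : IsBiLipDiffeo C V V' χ θ) : χ '' frontier V = frontier V' := by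
  have := H.homeomorph.image_frontier V
  rw [show (H.homeomorph : Euc d → Euc d) = χ from rfl, H.image_eq] at this
  exact this

theorem image_closure (H : IsBiLipDiffeo C V V' χ θ) : χ '' closure V = closure V' := by
  have := H.homeomorph.image_closure V
  rw [show (H.homeomorph : Euc d → Euc d) = χ from rfl, H.image_eq] at this
  exact this

theorem preimage_eq (H : IsBiLipDiffeo C V V' χ θ) : χ ⁻¹' V' = V :=
  Set.Subset.antisymm (fun x hx => by rw [← H.leftInverse x]; exact H.mapsTo_inv hx) H.mapsTo

theorem infDist_le (H : IsBiLipDiffeo C V V' χ θ) (hV : (frontier V).Nonempty) (x : Euc d) :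
    Metric.infDist (χ x) (frontier V') ≤ C * Metric.infDist x (frontier V) := by
  refine le_of_forall_pos_le_add fun ε hε => ?_
  have hC : (0 : ℝ) ≤ C := C.2
  -- An almost nearest boundary point suffices, since χ maps the frontier to the frontier; the slack
  -- ε / (C + 1) also covers C = 0.
  obtain ⟨z, hz, hxz⟩ := (Metric.infDist_lt_iff hV).1
    (lt_add_of_pos_right (Metric.infDist x (frontier V)) (div_pos hε (by positivity : 0 < (C : ℝ) + 1)))
  have h1 : Metric.infDist (χ x) (frontier V') ≤ dist (χ x) (χ z) :=
    Metric.infDist_le_dist_of_mem (by rw [← H.image_frontier]; exact Set.mem_image_of_mem χ hz)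
  have h2 := H.lipschitz.dist_le_mul x z
  have h3 : (C : ℝ) * (ε / (C + 1)) ≤ ε := by
    rw [mul_div_assoc', div_le_iff₀ (by positivity)]
    nlinarith
  nlinarith

theorem infDist_pos (H : IsBiLipDiffeo C V V' χ θ) (hV : (frontier V).Nonempty) {x : Euc d}
    (hx : x ∈ V) : 0 < Metric.infDist x (frontier V) := by
  rw [← isClosed_frontier.notMem_iff_infDist_pos hV, H.isOpen_source.frontier_eq]
  exact fun h => h.2 hx

/-- Composition is bounded on the weighted Lebesgue spaces. -/
theorem exists_eLpNorm_comp_le (H : IsBiLipDiffeo C V V' χ θ) (hV : (frontier V).Nonempty)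
    {p : ℝ≥0∞} (hp0 : p ≠ 0) (hp : p ≠ ⊤) (γ : ℝ) :
    ∃ D : ℝ≥0∞, D ≠ ⊤ ∧ ∀ {X : Type*} [NormedAddCommGroup X] (f : Euc d → X),
      eLpNorm (f ∘ χ) p (weightedMeasure V γ) ≤ D * eLpNorm f p (weightedMeasure V' γ) := by
  obtain ⟨J, hJ⟩ := exists_abs_det_le d C
  have hV' : (frontier V').Nonempty := by rw [← H.image_frontier]; exact hV.image χ
  have hJ0 : 0 ≤ J := (abs_nonneg _).trans (hJ (fderiv ℝ θ 0)
    (norm_fderiv_le_of_lipschitz ℝ H.lipschitz_inv))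
  -- C + 1 replaces C because the comparison of powers requires a constant of at least one.
  set M : ℝ := (C + 1 : ℝ) ^ |γ| with hM
  have hC : (0 : ℝ) ≤ C := C.2
  have hw : ∀ y ∈ V', Metric.infDist (θ y) (frontier V) ^ γ ≤
      M * Metric.infDist y (frontier V') ^ γ := by
    intro y hy
    have h1 := H.symm.infDist_le hV' y
    have h2 := H.infDist_le hV (θ y)
    rw [H.rightInverse] at h2
    have h3 := H.symm.infDist_pos hV' hy
    have h4 := H.infDist_pos hV (H.mapsTo_inv hy)
    exact rpow_le_mul_rpow (by linarith) h4 h3 (by nlinarith) (by nlinarith) γ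
  set q := p.toReal with hq
  have hq0 : 0 < q := ENNReal.toReal_pos hp0 hp
  refine ⟨ENNReal.ofReal (J * M) ^ (1 / q), by simp [hq0.le], fun {X} _ f => ?_⟩
  rw [eLpNorm_eq_lintegral_rpow_enorm_toReal hp0 hp, eLpNorm_eq_lintegral_rpow_enorm_toReal hp0 hp,
    ← ENNReal.mul_rpow_of_nonneg _ _ (by positivity)]
  refine ENNReal.rpow_le_rpow ?_ (by positivity)
  rw [lintegral_weightedMeasure, lintegral_weightedMeasure,
    ← lintegral_const_mul' _ _ ENNReal.ofReal_ne_top]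
  have e := H.lintegral_eq H.isOpen_target.measurableSet subset_rfl fun x =>
    ‖(f ∘ χ) x‖ₑ ^ q * ENNReal.ofReal (Metric.infDist x (frontier V) ^ γ)
  rw [H.toIsSmoothDiffeo.symm.image_eq] at e
  rw [e]
  refine setLIntegral_mono' H.isOpen_target.measurableSet fun y hy => ?_
  rw [Function.comp_apply, H.rightInverse, mul_left_comm, mul_left_comm (ENNReal.ofReal (J * M)),
    ← ENNReal.ofReal_mul (show 0 ≤ absJac θ y from abs_nonneg _),
    ← ENNReal.ofReal_mul (by positivity)]
  refine mul_le_mul' le_rfl (ENNReal.ofReal_le_ofReal ?_)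
  have h1 : absJac θ y ≤ J := hJ _ (norm_fderiv_le_of_lipschitz ℝ H.lipschitz_inv)
  have h5 : 0 ≤ Metric.infDist (θ y) (frontier V) ^ γ :=
    Real.rpow_nonneg Metric.infDist_nonneg _
  rw [mul_assoc]
  exact mul_le_mul h1 (hw y hy) h5 hJ0

end IsBiLipDiffeo

end BiLip

/-! ### Transport of test functions -/

section TestTransport

variable {d : ℕ} {X : Type*} [NormedAddCommGroup X] [NormedSpace ℝ X]

namespace IsBiLipDiffeo

variable {C : ℝ≥0} {V V' : Set (Euc d)} {χ θ : Euc d → Euc d}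

theorem hasCompactSupportIn_comp (H : IsBiLipDiffeo C V V' χ θ) {f : Euc d → X}
    (hf : HasCompactSupportIn V' f) : HasCompactSupportIn V (f ∘ χ) := by
  obtain ⟨K, hK, hf⟩ := hf
  refine ⟨θ '' K, hK.image H.lipschitz_inv.continuous, fun x hx hxK => hf _ ?_ fun h => hxK ?_⟩
  · rw [← H.image_closure]; exact Set.mem_image_of_mem χ hx
  · exact ⟨χ x, h, H.leftInverse x⟩

/-- Smoothness is only required inside, where χ is smooth, and first derivatives up to the boundary,
where χ is still C¹. The Neumann condition survives because Dχ maps v to a multiple of v'. -/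
theorem isTestFun_comp (H : IsBiLipDiffeo C V V' χ θ) {v v' : Euc d}
    (hv : ∀ x, ∃ c : ℝ, fderiv ℝ χ x v = c • v') {b : BC} {f : Euc d → X}
    (hf : IsTestFun V' v' b f) : IsTestFun V v b (f ∘ χ) := by
  have hcl : Set.MapsTo χ (closure V) (closure V') := fun x hx => by
    rw [← H.image_closure]; exact Set.mem_image_of_mem χ hx
  have hfr : Set.MapsTo χ (frontier V) (frontier V') := fun x hx => by
    rw [← H.image_frontier]; exact Set.mem_image_of_mem χ hx
  have hc : Continuous χ := H.lipschitz.continuous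
  cases b with
  | zero =>
    obtain ⟨h1, h2, h3⟩ := hf
    have hs : tsupport (f ∘ χ) ⊆ V := by
      refine (closure_minimal (s := Function.support (f ∘ χ)) (t := χ ⁻¹' tsupport f)
        (fun x hx => subset_tsupport f hx) ((isClosed_tsupport f).preimage hc)).trans ?_
      rw [← H.preimage_eq]
      exact Set.preimage_mono h3
    exact ⟨contDiff_of_contDiffOn_tsupport H.isOpen_source (h1.comp_contDiffOn H.contDiffOn) hs,
      h2.comp_homeomorph H.homeomorph, hs⟩
  | dir =>
    obtain ⟨h1, h2, h3, h4⟩ := hf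
    exact ⟨h1.comp H.contDiffOn H.mapsTo, h2.comp hc.continuousOn hcl,
      H.hasCompactSupportIn_comp h3, fun x hx => h4 _ (hfr hx)⟩
  | neu =>
    obtain ⟨h1, h2, h3, G, h4, h5, h6⟩ := hf
    refine ⟨h1.comp H.contDiffOn H.mapsTo, h2.comp hc.continuousOn hcl,
      H.hasCompactSupportIn_comp h3, fun x => (G (χ x)).comp (fderiv ℝ χ x), ?_, ?_, ?_⟩
    · exact (h4.comp hc.continuousOn hcl).clm_comp
        (H.contDiff_one.continuous_fderiv (by simp)).continuousOn
    · exact fun x hx => (h5 _ (H.mapsTo hx)).comp x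
        (H.contDiff_one.differentiable (by simp) x).hasFDerivAt
    · intro x hx
      obtain ⟨c, hc⟩ := hv x
      rw [ContinuousLinearMap.comp_apply, hc, map_smul, h6 _ (hfr hx), smul_zero]

variable {𝕜 : Type*} [RCLike 𝕜] [NormedSpace 𝕜 X] [SMulCommClass ℝ 𝕜 X] {k : ℕ} {p : ℝ≥0∞}
  [Fact (1 ≤ p)] {γ : ℝ}

theorem mem_testSubmodule_comp (H : IsBiLipDiffeo C V V' χ θ) (hV' : (frontier V').Nonempty)
    {v v' : Euc d} (hv : ∀ x, ∃ c : ℝ, fderiv ℝ χ x v = c • v') {b : BC}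
    {u : sobolev X 𝕜 V' k p γ} (hu : u ∈ testSubmodule X 𝕜 V' v' b k p γ)
    {w : sobolev X 𝕜 V k p γ} (hw : sobolevFun w =ᵐ[volume.restrict V] sobolevFun u ∘ χ) :
    w ∈ testSubmodule X 𝕜 V v b k p γ := by
  obtain ⟨f, hf, hf'⟩ := hu
  refine ⟨f ∘ χ, H.isTestFun_comp hv hf, ?_⟩
  refine (weightedMeasure_absolutelyContinuous V γ).ae_eq (hw.trans ?_)
  exact H.ae_comp ((volume_absolutelyContinuous_weightedMeasure H.isOpen_target hV' γ).ae_eq hf')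

/-- The composition isomorphism preserves the boundary conditions. -/
theorem map_sobolevBC (H : IsBiLipDiffeo C V V' χ θ) (hV : (frontier V).Nonempty)
    (hV' : (frontier V').Nonempty) {v v' : Euc d}
    (hv : ∀ x, ∃ c : ℝ, fderiv ℝ χ x v = c • v') (hv' : ∀ x, ∃ c : ℝ, fderiv ℝ θ x v' = c • v)
    (Φ : sobolev X 𝕜 V' k p γ ≃L[𝕜] sobolev X 𝕜 V k p γ)
    (h₁ : ∀ f, sobolevFun (Φ f) =ᵐ[volume.restrict V] sobolevFun f ∘ χ)
    (h₂ : ∀ g, sobolevFun (Φ.symm g) =ᵐ[volume.restrict V'] sobolevFun g ∘ θ) (b : BC) :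
    (sobolevBC X 𝕜 V' v' b k p γ).map
        (Φ : sobolev X 𝕜 V' k p γ →ₗ[𝕜] sobolev X 𝕜 V k p γ) = sobolevBC X 𝕜 V v b k p γ := by
  have himg : Φ '' (testSubmodule X 𝕜 V' v' b k p γ : Set (sobolev X 𝕜 V' k p γ)) =
      testSubmodule X 𝕜 V v b k p γ := by
    refine Set.Subset.antisymm ?_ fun w hw => ?_
    · rintro _ ⟨u, hu, rfl⟩
      exact H.mem_testSubmodule_comp hV' hv hu (h₁ u)
    · exact ⟨Φ.symm w, H.symm.mem_testSubmodule_comp hV hv' hw (h₂ w), Φ.apply_symm_apply w⟩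
  refine SetLike.coe_injective ?_
  rw [sobolevBC, sobolevBC, Submodule.topologicalClosure_coe, ← himg, ← Φ.image_closure,
    Submodule.map_coe, Submodule.topologicalClosure_coe]
  rfl

end IsBiLipDiffeo

end TestTransport

end

end WeightedSobolev

namespace WeightedSobolev

noncomputable section

/-! ### The Dahlberg–Kenig–Stein diffeomorphism -/

section DKS

variable {n : ℕ}

theorem IsMollifier.isTest {φ : Euc n → ℝ} (hφ : IsMollifier φ) : IsTest Set.univ φ :=
  isTest_univ_iff.2 ⟨hφ.contDiff, HasCompactSupport.of_support_subset_isCompact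
    (isCompact_closedBall 0 1) hφ.support_subset⟩

/-- At order zero the Hölder seminorm with exponent one is a summand of the norm, and it is a
Lipschitz constant. Finiteness has to be checked, since `ENNReal.toNNReal` sends ⊤ to zero. -/
theorem lipschitzWith_holderNorm {h : Euc n → ℝ} (hh : ContDiff ℝ 1 h)
    (hc : HasCompactSupport h) : LipschitzWith (holderNorm 0 1 h).toNNReal h := by
  obtain ⟨C, hC⟩ := hh.lipschitzWith_of_hasCompactSupport hc (by simp)
  have hm : MemHolder 1 h := ⟨C, holderWith_one.2 hC⟩
  obtain ⟨B, hB⟩ := hc.exists_bound_of_continuous hh.continuous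
  have hz : ∀ α : MIdx n 0, multiD α.val h = h := fun α => by
    have : α.val = 0 := funext fun i => by
      have := (Finset.single_le_sum (f := α.val) (fun _ _ => Nat.zero_le _)
        (Finset.mem_univ i)).trans α.sum_val_le
      simpa using this
    rw [this, multiD_zero]
  have ho : ∀ α : MIdx n 0, α.order = 0 := fun α => Nat.le_zero.1 α.sum_val_le
  have hfin : holderNorm 0 1 h ≠ ⊤ := by
    simp only [holderNorm, hz, ho, if_true, one_ne_zero, if_false]
    refine ENNReal.add_ne_top.2 ⟨ENNReal.sum_ne_top.2 fun α _ => ?_,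
      ENNReal.sum_ne_top.2 fun α _ => hm.eHolderNorm_lt_top.ne⟩
    refine ne_top_of_le_ne_top ENNReal.ofReal_ne_top (iSup_le fun x => ?_) (b := ENNReal.ofReal B)
    rw [← ofReal_norm]
    exact ENNReal.ofReal_le_ofReal (hB x)
  have hle : eHolderNorm 1 h ≤ holderNorm 0 1 h := by
    simp only [holderNorm, hz, ho, if_true, one_ne_zero, if_false]
    refine le_trans ?_ le_add_self
    exact ennreal_le_sum_univ (fun _ : MIdx n 0 => eHolderNorm 1 h) (MIdx.zero n 0)
  have h1 := holderWith_one.1 hm.holderWith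
  refine h1.weaken ?_
  rw [← ENNReal.coe_le_coe, hm.coe_nnHolderNorm_eq_eHolderNorm, ENNReal.coe_toNNReal hfin]
  exact hle

/-- φ is a probability density on the unit ball, so the increment of h₂ is at most K(|ỹ - ỹ'| + |y₀
- y₀'| / L), and K / L ≤ 1/2. -/
theorem IsMollifier.isShear {φ : Euc n → ℝ} (hφ : IsMollifier φ) {h : Euc n → ℝ} {K : ℝ≥0}
    (hh : LipschitzWith K h) {L : ℝ} (hL : 0 < L) (hKL : 2 * K ≤ L) :
    IsShear K (mollify L h φ) := by
  intro y y'
  have hφc := hφ.contDiff.continuous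
  have hhc := hh.continuous
  have hint : ∀ y : Euc (n + 1), Integrable fun z => h (tail y - (y 0 / L) • z) * φ z := fun y =>
    Continuous.integrable_of_hasCompactSupport (by fun_prop) hφ.isTest.2.1.mul_left
  rw [mollify, mollify, ← integral_sub (hint y) (hint y')]
  set c := K * ‖tail y - tail y'‖ + 1 / 2 * |y 0 - y' 0| with hc
  have e : c = ∫ z, c * φ z := by rw [integral_const_mul, hφ.integral_eq_one, mul_one]
  rw [e]
  refine norm_integral_le_of_norm_le (f := fun z => h (tail y - (y 0 / L) • z) * φ z -
    h (tail y' - (y' 0 / L) • z) * φ z) (hφ.isTest.integrable.const_mul c)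
    (Filter.Eventually.of_forall fun z => ?_)
  rw [← sub_mul, norm_mul, Real.norm_of_nonneg (hφ.nonneg z)]
  by_cases hz : z ∈ Function.support φ
  · refine mul_le_mul_of_nonneg_right ?_ (hφ.nonneg z)
    have hz1 : ‖z‖ ≤ 1 := by simpa using hφ.support_subset hz
    have h1 := hh.dist_le_mul (tail y - (y 0 / L) • z) (tail y' - (y' 0 / L) • z)
    rw [dist_eq_norm, dist_eq_norm] at h1
    have h2 : ‖tail y - (y 0 / L) • z - (tail y' - (y' 0 / L) • z)‖ ≤
        ‖tail y - tail y'‖ + |y 0 - y' 0| / L := by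
      rw [show tail y - (y 0 / L) • z - (tail y' - (y' 0 / L) • z) =
        (tail y - tail y') - ((y 0 - y' 0) / L) • z by rw [sub_div, sub_smul]; abel]
      refine (norm_sub_le _ _).trans (add_le_add_right ?_ _)
      rw [norm_smul, Real.norm_eq_abs, abs_div, abs_of_pos hL]
      exact mul_le_of_le_one_right (by positivity) hz1
    refine h1.trans ((mul_le_mul_of_nonneg_left h2 K.coe_nonneg).trans ?_)
    rw [hc, mul_add]
    refine add_le_add_right ?_ _
    rw [mul_div_assoc', div_le_iff₀ hL]
    nlinarith [mul_le_mul_of_nonneg_right hKL (abs_nonneg (y 0 - y' 0))]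
  · rw [Function.notMem_support.1 hz, mul_zero, mul_zero]

theorem mollify_cons (L : ℝ) (h φ : Euc n → ℝ) (t : ℝ) (w : Euc n) :
    mollify L h φ (cons t w) = smoothed h φ L t w := rfl

theorem IsShear.existsUnique {K : ℝ≥0} {h φ : Euc n → ℝ} {L : ℝ}
    (H : IsShear K (mollify L h φ)) (x : Euc (n + 1)) :
    ∃! t : ℝ, t = x 0 - smoothed h φ L t (tail x) := by
  have hc : ContractingWith (1 / 2) fun t : ℝ => x 0 - smoothed h φ L t (tail x) := by
    refine ⟨by rw [← NNReal.coe_lt_coe]; norm_num, LipschitzWith.of_dist_le_mul fun t t' => ?_⟩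
    have h1 := H (cons t (tail x)) (cons t' (tail x))
    rw [mollify_cons, mollify_cons, show tail (cons t (tail x)) = tail x from rfl,
      show tail (cons t' (tail x)) = tail x from rfl, sub_self, norm_zero, mul_zero, zero_add,
      show (cons t (tail x)) 0 = t from rfl, show (cons t' (tail x)) 0 = t' from rfl] at h1
    rw [dist_sub_left, Real.dist_eq, Real.dist_eq]
    simpa using h1
  exact ⟨hc.fixedPoint, hc.fixedPoint_isFixedPt.symm, fun t ht => hc.fixedPoint_unique ht.symm⟩

theorem dksInv_eq_shear (h φ : Euc n → ℝ) (L : ℝ) : dksInv h φ L = shear (mollify L h φ) :=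
  funext fun y => ext_tail (by rw [shear_apply_zero]; rfl) (by rw [tail_shear]; rfl)

theorem IsShear.shear_dks {K : ℝ≥0} {h φ : Euc n → ℝ} {L : ℝ}
    (H : IsShear K (mollify L h φ)) (x : Euc (n + 1)) :
    shear (mollify L h φ) (dks h φ L x) = x := by
  have h1 : regDist h φ L x = x 0 - smoothed h φ L (regDist h φ L x) (tail x) :=
    Classical.epsilon_spec (H.existsUnique x).exists
  refine ext_tail ?_ (by rw [tail_shear]; rfl)
  rw [shear_apply_zero, dks, mollify_cons]
  show regDist h φ L x + _ = _
  linarith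

theorem smoothed_zero {φ : Euc n → ℝ} (hφ : IsMollifier φ) (h : Euc n → ℝ) (L : ℝ) (w : Euc n) :
    smoothed h φ L 0 w = h w := by
  simp [smoothed, integral_const_mul, hφ.integral_eq_one]

/-- At t = 0 the mollification reduces to h itself, so the sign criterion for the shear is the
condition of lying above the graph. -/
theorem IsShear.dks_mem_halfSpace_iff {K : ℝ≥0} {h φ : Euc n → ℝ} (hφ : IsMollifier φ) {L : ℝ}
    (H : IsShear K (mollify L h φ)) (x : Euc (n + 1)) :
    dks h φ L x ∈ halfSpace n ↔ x ∈ aboveGraph h := by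
  have h1 := H.pos_iff (dks h φ L x)
  rw [← shear_apply_zero, H.shear_dks, mollify_cons, smoothed_zero hφ] at h1
  exact h1

/-! ### The weight of the half-space -/

theorem frontier_halfSpace : frontier (halfSpace n) = {y | y 0 = 0} := by
  have hs : Function.Surjective (EuclideanSpace.proj 0 : Euc (n + 1) →L[ℝ] ℝ) := fun t =>
    ⟨t • e₁ n, by simp⟩
  have := ((EuclideanSpace.proj 0 : Euc (n + 1) →L[ℝ] ℝ).isOpenMap
    hs).preimage_frontier_eq_frontier_preimage (ContinuousLinearMap.continuous _) (Set.Ioi 0)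
  rw [frontier_Ioi] at this
  exact this.symm

theorem frontier_halfSpace_nonempty : (frontier (halfSpace n)).Nonempty :=
  ⟨0, by rw [frontier_halfSpace]; rfl⟩

theorem infDist_frontier_halfSpace {y : Euc (n + 1)} (hy : y ∈ halfSpace n) :
    Metric.infDist y (frontier (halfSpace n)) = y 0 := by
  have hy0 : 0 < y 0 := hy
  refine le_antisymm ?_ ?_
  · have hm : y - y 0 • e₁ n ∈ frontier (halfSpace n) := by
      rw [frontier_halfSpace]
      simp
    refine (Metric.infDist_le_dist_of_mem hm).trans ?_
    rw [dist_eq_norm, sub_sub_cancel, norm_smul, e₁, PiLp.norm_single, norm_one, mul_one,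
      Real.norm_of_nonneg hy0.le]
  · refine (Metric.le_infDist frontier_halfSpace_nonempty).2 fun z hz => ?_
    rw [frontier_halfSpace] at hz
    have h1 := abs_zero_le (y - z)
    rw [PiLp.sub_apply, show z 0 = 0 from hz, sub_zero, abs_of_pos hy0] at h1
    rwa [dist_eq_norm]

theorem weightedMeasure_halfSpace (γ : ℝ) :
    weightedMeasure (halfSpace n) γ = powerMeasure n γ := by
  refine withDensity_congr_ae ?_
  filter_upwards [ae_restrict_mem isOpen_halfSpace.measurableSet] with y hy
  rw [infDist_frontier_halfSpace hy]

end DKS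

end

end WeightedSobolev

namespace WeightedSobolev

noncomputable section

/-! ### The pullback to a special domain -/

section Pullback

variable {d n : ℕ}

/-- With g of class C¹ the derivatives fall on g, hence are continuous across y₀ = 0 as well. This
is the regularity up to the boundary that Neumann test functions need. -/
theorem contDiff_mollify {L : ℝ} {g ψ : Euc n → ℝ} (hg : ContDiff ℝ 1 g)
    (hψ : IsTest Set.univ ψ) : ContDiff ℝ 1 (mollify L g ψ) := by
  have hd := mollify_differentiable_of_contDiff (L := L) hg hψ
  have hc : ∀ i, Continuous (partialD i g) := fun i =>
    (contDiff_partialD (r := 0) hg (by simp) i).continuous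
  rw [← contDiffOn_univ]
  refine contDiffOn_succ_of_partialD (N := 0) isOpen_univ
    (fun y _ => (hd y).1.differentiableWithinAt) fun i => ?_
  refine (contDiff_zero.2 ?_).contDiffOn
  refine Fin.cases ?_ (fun i => ?_) i
  · rw [show partialD 0 (mollify L g ψ) = _ from funext fun y => (hd y).2.2]
    exact continuous_finsetSum _ fun i _ =>
      continuous_const.mul (continuous_mollify (hc i) (hψ.mul_coord i))
  · rw [show partialD i.succ (mollify L g ψ) = _ from funext fun y => (hd y).2.1 i]
    exact continuous_mollify (hc i) hψ

theorem hasFDerivAt_affineIsometryEquiv (T : Euc d ≃ᵃⁱ[ℝ] Euc d) (x : Euc d) :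
    HasFDerivAt T (T.linearIsometryEquiv.toContinuousLinearEquiv : Euc d →L[ℝ] Euc d) x := by
  have h1 : (T : Euc d → Euc d) = fun x => T.linearIsometryEquiv x + T 0 := funext fun x => by
    have := T.map_vadd 0 x
    simpa using this
  rw [h1]
  exact (T.linearIsometryEquiv.toContinuousLinearEquiv.hasFDerivAt).add_const _

theorem contDiff_affineIsometryEquiv (T : Euc d ≃ᵃⁱ[ℝ] Euc d) {r : ℕ∞ω} :
    ContDiff ℝ r T := by
  have h1 : (T : Euc d → Euc d) = fun x => T.linearIsometryEquiv x + T 0 := funext fun x => by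
    have := T.map_vadd 0 x
    simpa using this
  rw [h1]
  exact T.linearIsometryEquiv.contDiff.add contDiff_const

theorem linearIsometryEquiv_symm_apply (T : Euc d ≃ᵃⁱ[ℝ] Euc d) (v : Euc d) :
    T.linearIsometryEquiv (T.symm.linearIsometryEquiv v) = v :=
  T.linearIsometryEquiv.apply_symm_apply v

variable {K : ℝ≥0} {m : Euc (n + 1) → ℝ} {G : Euc (n + 1) → Euc (n + 1)}
  {T : Euc (n + 1) ≃ᵃⁱ[ℝ] Euc (n + 1)}

theorem fderiv_symm_comp_shear (hm : ContDiff ℝ 1 m) (y v : Euc (n + 1)) :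
    fderiv ℝ (fun y => T.symm (shear m y)) y v =
      T.symm.linearIsometryEquiv v + fderiv ℝ m y v • T.symm.linearIsometryEquiv (e₁ n) := by
  have := (hasFDerivAt_affineIsometryEquiv T.symm (shear m y)).comp y
    (IsShear.hasFDerivAt_shear hm y)
  rw [show (fun y => T.symm (shear m y)) = T.symm ∘ shear m from rfl, this.fderiv,
    ← map_smul, ← map_add]
  rfl

theorem IsShear.fderiv_inv_comp (H : IsShear K m) (hm : ContDiff ℝ 1 m)
    (hG : ∀ x, shear m (G x) = x) (x v : Euc (n + 1)) :
    fderiv ℝ (fun x => G (T x)) x v = shearInvDeriv m (G (T x)) (T.linearIsometryEquiv v) := by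
  have := (H.hasFDerivAt_inv hm hG (T x)).comp x (hasFDerivAt_affineIsometryEquiv T x)
  rw [show (fun x => G (T x)) = G ∘ T from rfl, this.fderiv]
  rfl

theorem IsShear.isBiLipDiffeo (H : IsShear K m) (hm : ContDiff ℝ 1 m)
    (hmU : ContDiffOn ℝ ∞ m (halfSpace n)) (hG : ∀ x, shear m (G x) = x)
    {O : Set (Euc (n + 1))} (hO : ∀ x, G (T x) ∈ halfSpace n ↔ x ∈ O) :
    IsBiLipDiffeo (2 * K + 3) (halfSpace n) O (fun y => T.symm (shear m y))
      (fun x => G (T x)) := by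
  have hl : Function.LeftInverse (fun x => G (T x)) (fun y => T.symm (shear m y)) := fun y => by
    simp [H.inv_shear hG]
  have hr : Function.RightInverse (fun x => G (T x)) (fun y => T.symm (shear m y)) := fun x => by
    simp [hG]
  have hsc : ContDiff ℝ 1 (shear m) := contDiff_id.add (hm.smul contDiff_const)
  have hΨ : LipschitzWith (2 * K + 3) fun x => G (T x) := by
    have := (H.lipschitzWith_inv hG).comp T.isometry.lipschitz
    rwa [mul_one] at this
  have hκ : LipschitzWith (2 * K + 3) fun y => T.symm (shear m y) := by
    have := T.symm.isometry.lipschitz.comp H.lipschitzWith_shear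
    rw [one_mul] at this
    refine this.weaken (add_le_add ?_ (by norm_num))
    rw [two_mul]
    exact le_add_self
  have hpre : O = (fun x => G (T x)) ⁻¹' halfSpace n := Set.ext fun x => (hO x).symm
  have hOo : IsOpen O := hpre ▸ isOpen_halfSpace.preimage hΨ.continuous
  refine ⟨⟨isOpen_halfSpace, hOo, fun y hy => ?_, fun x hx => (hO x).2 hx, fun y _ => hl y,
    fun x _ => hr x, ?_, ?_⟩, hκ, hΨ, hl, hr, ?_, ?_⟩
  · exact (hO _).1 (by rw [T.apply_symm_apply, H.inv_shear hG]; exact hy)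
  · exact (contDiff_affineIsometryEquiv T.symm).comp_contDiffOn
      (contDiffOn_id.add (hmU.smul contDiffOn_const))
  · have hW : IsOpen (G ⁻¹' halfSpace n) :=
      isOpen_halfSpace.preimage (H.lipschitzWith_inv hG).continuous
    exact (H.contDiffOn_inv hm hG isOpen_halfSpace hW (fun x hx => hx) hmU).comp
      (contDiff_affineIsometryEquiv T).contDiffOn fun x hx => (hO x).2 hx
  · exact (contDiff_affineIsometryEquiv T.symm).comp hsc
  · exact (H.contDiff_inv hm hG).comp (contDiff_affineIsometryEquiv T)

variable {𝕜 X : Type*} [RCLike 𝕜] [NormedAddCommGroup X] [NormedSpace ℝ X] [NormedSpace 𝕜 X]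
  [SMulCommClass ℝ 𝕜 X] [CompleteSpace X]

theorem IsSmoothDiffeo.refl {V : Set (Euc d)} (hV : IsOpen V) : IsSmoothDiffeo V V id id :=
  ⟨hV, hV, fun _ hx => hx, fun _ hx => hx, fun _ _ => rfl, fun _ _ => rfl, contDiffOn_id,
    contDiffOn_id⟩

theorem partialD_id_apply (j i : Fin d) (y : Euc d) :
    partialD j (id : Euc d → Euc d) y i = (EuclideanSpace.single j (1 : ℝ) : Euc d) i := by
  rw [partialD, fderiv_id]
  rfl

/-- The pullback is an isomorphism of weighted Sobolev spaces, with all boundary conditions. -/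
theorem IsShear.exists_sobolev_equiv (H : IsShear K m) (hm : ContDiff ℝ 1 m)
    (hmU : ContDiffOn ℝ ∞ m (halfSpace n)) (hG : ∀ x, shear m (G x) = x)
    {O : Set (Euc (n + 1))} (hO : ∀ x, G (T x) ∈ halfSpace n ↔ x ∈ O) {s : ℝ} (hs : 1 ≤ s)
    (hsym : ∀ j, IsSmoothSymbol s 1 (partialD j m)) {p : ℝ≥0∞} [Fact (1 ≤ p)] (hp : p ≠ ⊤)
    {γ : ℝ} {k : ℕ} (hγ : max ((k : ℝ) - s) 0 * p.toReal - 1 < γ) :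
    ∃ Φ : sobolev X 𝕜 O k p γ ≃L[𝕜] sobolev X 𝕜 (halfSpace n) k p γ,
      (∀ f, sobolevFun (Φ f) =ᵐ[volume.restrict (halfSpace n)]
        sobolevFun f ∘ fun y => T.symm (shear m y)) ∧
      (∀ g, sobolevFun (Φ.symm g) =ᵐ[volume.restrict O] sobolevFun g ∘ fun x => G (T x)) ∧
      ∀ b : BC, (sobolevBC X 𝕜 O (T.symm.linearIsometryEquiv (e₁ n)) b k p γ).map
          (Φ : sobolev X 𝕜 O k p γ →ₗ[𝕜] sobolev X 𝕜 (halfSpace n) k p γ) =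
        sobolevBC X 𝕜 (halfSpace n) (e₁ n) b k p γ := by
  have HB := H.isBiLipDiffeo hm hmU hG hO
  have hU : (frontier (halfSpace n)).Nonempty := frontier_halfSpace_nonempty
  have hO' : (frontier O).Nonempty := by rw [← HB.image_frontier]; exact hU.image _
  have hp0 : p ≠ 0 := (zero_lt_one.trans_le (Fact.out : 1 ≤ p)).ne'
  obtain ⟨C₁, hC₁, hn₁⟩ := HB.exists_eLpNorm_comp_le hU hp0 hp γ
  obtain ⟨C₂, hC₂, hn₂⟩ := HB.symm.exists_eLpNorm_comp_le hO' hp0 hp γ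
  rw [weightedMeasure_halfSpace] at hn₁ hn₂
  have hconst : ∀ c : ℝ, IsSmoothSymbol (n := n) s 1 fun _ => c := fun c N =>
    isSymbol_const N 1 c
  have hdelta : ∀ j i : Fin (n + 1), IsSmoothSymbol (n := n) s 1 fun _ =>
    (EuclideanSpace.single j (1 : ℝ) : Euc (n + 1)) i := fun j i => hconst _
  have hid : ∀ y ∈ halfSpace n, ∀ j i, partialD j (id : Euc (n + 1) → Euc (n + 1)) y i =
    (EuclideanSpace.single j (1 : ℝ) : Euc (n + 1)) i := fun y _ j i => partialD_id_apply j i y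
  have hnid : ∀ f : Euc (n + 1) → X, eLpNorm (f ∘ id) p (powerMeasure n γ) ≤
      1 * eLpNorm f p (powerMeasure n γ) := fun f => by rw [one_mul]; rfl
  have Hid := IsSmoothDiffeo.refl (isOpen_halfSpace (n := n))
  -- For f ∘ Ψ⁻¹ the family is (∂^b f) ∘ Ψ⁻¹, with A the entries of the derivative of T⁻¹ ∘ shear;
  -- the second map is the identity.
  have k₁ := exists_sobolev_comp (X := X) (𝕜 := 𝕜) hp hs
    (A := fun j i y => T.symm.linearIsometryEquiv (EuclideanSpace.single j (1 : ℝ)) i +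
      partialD j m y * T.symm.linearIsometryEquiv (e₁ n) i)
    (fun j i N => (isSymbol_const N 1 _).add
      (((hsym j) N).mul (m := 0) (m' := 0) hs (isSymbol_const N 1 _)))
    hdelta hγ hO' hU HB.toIsSmoothDiffeo Hid
    (fun y _ j i => by
      rw [partialD, fderiv_symm_comp_shear hm]
      rfl)
    hid hC₁ ENNReal.one_ne_top (fun f _ => hn₁ f)
    (fun f _ => by rw [weightedMeasure_halfSpace]; exact hnid f)
  -- For g ∘ Ψ the family is ∂^b g itself, so A is the identity matrix. B consists of the entries of
  -- DΨ at the point with Ψ(x) = y, from the rank-one inverse; its denominator 1 + ∂₀m is at least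
  -- 1/2.
  have k₂ := exists_sobolev_comp (X := X) (𝕜 := 𝕜) hp hs hdelta
    (B := fun i j y => T.linearIsometryEquiv (EuclideanSpace.single i (1 : ℝ)) j +
      (-e₁ n j) * ((1 + partialD 0 m y)⁻¹ *
        ∑ q, T.linearIsometryEquiv (EuclideanSpace.single i (1 : ℝ)) q * partialD q m y))
    (fun i j N => (isSymbol_const N 1 _).add ((isSymbol_const N 1 _).mul (m := 0) (m' := 0) hs
      ((((isSymbol_const N 1 1).add (hsym 0 N)).inv hs one_half_pos fun y _ =>
        (H.half_le hm y).trans (le_abs_self _)).mul (m := 0) (m' := 0) hs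
        (IsSymbol.sum _ fun q _ => (isSymbol_const N 1 _).mul (m := 0) (m' := 0) hs (hsym q N)))))
    hγ hU hO' Hid HB.toIsSmoothDiffeo.symm hid
    (fun x _ i j => by
      rw [partialD, H.fderiv_inv_comp hm hG, IsShear.shearInvDeriv_apply, fderiv_eq_sum_partialD _
        (T.linearIsometryEquiv _), PiLp.sub_apply, PiLp.smul_apply, smul_eq_mul]
      simp only [smul_eq_mul]
      rw [show partialD 0 m (G (T x)) = fderiv ℝ m (G (T x)) (e₁ n) from rfl]
      ring)
    ENNReal.one_ne_top hC₂
    (fun f _ => by rw [weightedMeasure_halfSpace]; exact hnid f) (fun g _ => hn₂ g)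
  obtain ⟨Φ, h₁, h₂⟩ := WeightedSobolev.exists_sobolev_equiv hO' hU HB.toIsSmoothDiffeo k₁ k₂
  refine ⟨Φ, h₁, h₂, fun b => HB.map_sobolevBC hU hO' (fun y => ?_) (fun x => ?_) Φ h₁ h₂ b⟩
  -- The shear acts along e₁, so its derivative maps e₁ to (1 + ∂₀m) e₁; the linear part of T⁻¹ then
  -- gives the vector v.
  · refine ⟨1 + fderiv ℝ m y (e₁ n), ?_⟩
    rw [fderiv_symm_comp_shear hm, add_smul, one_smul]
  · refine ⟨(1 + fderiv ℝ m (G (T x)) (e₁ n))⁻¹, ?_⟩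
    rw [H.fderiv_inv_comp hm hG, linearIsometryEquiv_symm_apply, H.shearInvDeriv_e₁ hm]

end Pullback

end

end WeightedSobolev

/-! ### The isomorphism for the Dahlberg–Kenig–Stein pullback. -/

theorem mainTheorem12 {𝕜 X : Type*} [RCLike 𝕜] [NormedAddCommGroup X] [NormedSpace ℝ X]
    [NormedSpace 𝕜 X] [SMulCommClass ℝ 𝕜 X] [CompleteSpace X]
    (p : ℝ≥0∞) [Fact (1 ≤ p)] (hp : 1 < p) (hp' : p < ⊤)
    (n ℓ k : ℕ) (hℓ : 1 ≤ ℓ) (lam : ℝ≥0) (hlam : lam ≤ 1)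
    (γ : ℝ) (hγ : -1 < γ) (hγp : ∀ j : ℕ, 1 ≤ j → γ ≠ j * p.toReal - 1)
    (hγk : max ((k : ℝ) - (ℓ + lam)) 0 * p.toReal - 1 < γ)
    -- the special domain `O`, of norm at most one
    (h : WeightedSobolev.Euc n → ℝ) (hh : WeightedSobolev.MemCcHolder ℓ lam h)
    (hh1 : WeightedSobolev.holderNorm ℓ lam h ≤ 1)
    (T : WeightedSobolev.Euc (n + 1) ≃ᵃⁱ[ℝ] WeightedSobolev.Euc (n + 1))
    (O : Set (WeightedSobolev.Euc (n + 1))) (hO : T '' O = WeightedSobolev.aboveGraph h)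
    -- the diffeomorphism `Ψ` and its inverse
    (φ : WeightedSobolev.Euc n → ℝ) (hφ : WeightedSobolev.IsMollifier φ)
    (L : ℝ) (hL : 2 * √2 * (1 + (WeightedSobolev.holderNorm 0 1 h).toReal) ≤ L)
    (Ψ Ψinv : WeightedSobolev.Euc (n + 1) → WeightedSobolev.Euc (n + 1))
    (hΨ : Ψ = fun x => WeightedSobolev.dks h φ L (T x))
    (hΨinv : Ψinv = fun y => T.symm (WeightedSobolev.dksInv h φ L y)) :
    (∀ x : WeightedSobolev.Euc (n + 1),
      ∃! t : ℝ, t = x 0 - WeightedSobolev.smoothed h φ L t (WeightedSobolev.tail x)) ∧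
    Set.BijOn Ψ O (WeightedSobolev.halfSpace n) ∧
    Set.InvOn Ψinv Ψ O (WeightedSobolev.halfSpace n) ∧
    ∃ Φ : WeightedSobolev.sobolev X 𝕜 O k p γ ≃L[𝕜]
        WeightedSobolev.sobolev X 𝕜 (WeightedSobolev.halfSpace n) k p γ,
      (∀ f, WeightedSobolev.sobolevFun (Φ f)
        =ᵐ[volume.restrict (WeightedSobolev.halfSpace n)] WeightedSobolev.sobolevFun f ∘ Ψinv) ∧
      (∀ g, WeightedSobolev.sobolevFun (Φ.symm g)
        =ᵐ[volume.restrict O] WeightedSobolev.sobolevFun g ∘ Ψ) ∧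
      ∀ b : WeightedSobolev.BC,
        (WeightedSobolev.sobolevBC X 𝕜 O (T.symm.linearIsometryEquiv (WeightedSobolev.e₁ n)) b
            k p γ).map (Φ : WeightedSobolev.sobolev X 𝕜 O k p γ →ₗ[𝕜]
              WeightedSobolev.sobolev X 𝕜 (WeightedSobolev.halfSpace n) k p γ) =
          WeightedSobolev.sobolevBC X 𝕜 (WeightedSobolev.halfSpace n) (WeightedSobolev.e₁ n) b
            k p γ := by
  subst hΨ hΨinv
  have hs : (1 : ℝ) ≤ ℓ + lam := by
    have h1 : (1 : ℝ) ≤ ℓ := by exact_mod_cast hℓ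
    linarith [lam.coe_nonneg]
  have hcd : ContDiff ℝ 1 h := hh.contDiff.of_le (by exact_mod_cast hℓ)
  have hlip := WeightedSobolev.lipschitzWith_holderNorm hcd hh.hasCompactSupport
  set K : ℝ≥0 := (WeightedSobolev.holderNorm 0 1 h).toNNReal with hK
  -- From √2 ≥ 1. It gives both L > 0 and the bound 2K ≤ L behind the contraction constant 1/2.
  have hLK : 2 * (1 + (K : ℝ)) ≤ L := by
    refine le_trans ?_ hL
    rw [ENNReal.coe_toNNReal_eq_toReal]
    refine mul_le_mul_of_nonneg_right ?_ (by positivity)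
    linarith [Real.one_le_sqrt.2 one_le_two]
  have hL0 : 0 < L := by linarith [K.coe_nonneg]
  have H := hφ.isShear hlip hL0 (by linarith)
  have hm := WeightedSobolev.contDiff_mollify hcd hφ.isTest (L := L)
  have hmem : ∀ x, WeightedSobolev.dks h φ L (T x) ∈ WeightedSobolev.halfSpace n ↔ x ∈ O := by
    intro x
    rw [H.dks_mem_halfSpace_iff hφ, ← hO, T.injective.mem_set_image]
  have hmU := WeightedSobolev.contDiffOn_mollify hL0 hcd.continuous hφ.isTest
  have HB := H.isBiLipDiffeo hm hmU H.shear_dks hmem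
  rw [WeightedSobolev.dksInv_eq_shear]
  refine ⟨H.existsUnique, ?_, ⟨fun x _ => HB.rightInverse x, fun y _ => HB.leftInverse y⟩,
    H.exists_sobolev_equiv hm hmU H.shear_dks hmem hs
      (hh.isSmoothSymbol_partialD_mollify hlam hL0 hφ.isTest) hp'.ne hγk⟩
  exact Set.InvOn.bijOn ⟨fun x _ => HB.rightInverse x, fun y _ => HB.leftInverse y⟩
    HB.mapsTo_inv HB.mapsTo
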